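/- Let $b\in\mathbb{C}$ and let $\mathscr{L}_b$ be the maximal realization of $(-i\partial_{x_1})^2+(-i\partial_{x_2}-b\,x_1)^2$ in $L^2(\mathbb{R}^2)$, that is, $\psi\in\operatorname{Dom}(\mathscr{L}_b)$ and $\mathscr{L}_b\psi=f$ if and only if $\psi,f\in L^2(\mathbb{R}^2)$ and $\left[(-i\partial_{x_1})^2+(-i\partial_{x_2}-b\,x_1)^2\right]\psi=f$ in the sense of distributions. Let $\operatorname{Spec}(\mathscr{L}_b)$ be the spectrum, let $\operatorname{Spec}_{\mathrm{p}}(\mathscr{L}_b)$ be the set of eigenvalues, and let $\operatorname{Spec}_{\mathrm{c}}(\mathscr{L}_b)$ be the set of $z\in\mathbb{C}$ for which $\mathscr{L}_b-z$ is injective with dense range different from $L^2(\mathbb{R}^2)$. Put $$\Lambda_b=\{(2k+1)b : k\in\mathbb{N}_0\}\ \text{ if } \operatorname{Re} b>0,\qquad \Lambda_b=\{-(2k+1)b : k\in\mathbb{N}_0\}\ \text{ if } \operatorname{Re} b<0 .$$ (i) If $b\in\mathbb{C}\setminus(\mathbb{R}\cup i\mathbb{R})$, then $$\operatorname{Spec}(\mathscr{L}_b)=\mathbb{C},\qquad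 \operatorname{Spec}_{\mathrm{c}}(\mathscr{L}_b)=\mathbb{C}\setminus\Lambda_b,\qquad \operatorname{Spec}_{\mathrm{p}}(\mathscr{L}_b)=\Lambda_b .$$ (ii) If $b\in i\mathbb{R}\setminus\{0\}$, then $$\operatorname{Spec}(\mathscr{L}_b)=\mathbb{C},\qquad \operatorname{Spec}_{\mathrm{c}}(\mathscr{L}_b)=\mathbb{C},\qquad \operatorname{Spec}_{\mathrm{p}}(\mathscr{L}_b)=\emptyset .$$ In both cases $\operatorname{Spec}_{\mathrm{ess},k}(\mathscr{L}_b)=\operatorname{Spec}(\mathscr{L}_b)$ for all $k\in\{1,\dots,5\}$, where, for a closed operator $\mathscr{L}$, the set $\operatorname{Spec}_{\mathrm{ess},k}(\mathscr{L})$ consists of the $z\in\mathbb{C}$ for which: $\mathscr{L}-z$ is not semi-Fredholm, i.e. it is not the case that its range is closed and its kernel has finite dimension or its range finite codimension ($k=1$); it is not the case that the range of $\mathscr{L}-z$ is closed and its kernel has finite dimension ($k=2$); $\mathscr{L}-z$ is not Fredholm ($k=3$); $\mathscr{L}-z$ is not Fredholm of index $0$ ($k=4$); $z\in\operatorname{Spec}(\mathscr{L})$,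 but $z$ is not an eigenvalue that is isolated in $\operatorname{Spec}(\mathscr{L})$, has finite algebraic multiplicity $\dim\bigcup_n\operatorname{Ker}(\mathscr{L}-z)^n$ and is such that the range of $\mathscr{L}-z$ is closed ($k=5$). -/

import Mathlib

open MeasureTheory
open scoped ContDiff Topology ComplexConjugate

noncomputable section

namespace UnboundedOp

variable {H : Type*} [NormedAddCommGroup H] [NormedSpace ℂ H]

/-- The operator `L - z`, as a linear map from the domain of `L`. -/
def shift (L : H →ₗ.[ℂ] H) (z : ℂ) : L.domain →ₗ[ℂ] H :=
  L.toFun - z • L.domain.subtype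

/-- The spectrum: the complement of the set of `z` such that `L - z` is a bijection from the domain
onto the whole space whose inverse is bounded. -/
def spectrum (L : H →ₗ.[ℂ] H) : Set ℂ :=
  {z | ¬ (Function.Bijective (shift L z) ∧
    ∃ R : H →L[ℂ] H, ∀ x : L.domain, R (shift L z x) = x)}

/-- The set of eigenvalues. -/
def pointSpectrum (L : H →ₗ.[ℂ] H) : Set ℂ :=
  {z | ¬ Function.Injective (shift L z)}

/-- `L - z` is injective, with dense range different from the whole space. -/
def continuousSpectrum (L : H →ₗ.[ℂ] H) : Set ℂ :=
  {z | Function.Injective (shift L z) ∧ Dense (Set.range (shift L z)) ∧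
    Set.range (shift L z) ≠ Set.univ}

/-- The range of `L - z` is closed. -/
def ClosedRange (L : H →ₗ.[ℂ] H) (z : ℂ) : Prop :=
  IsClosed (Set.range (shift L z))

/-- The kernel of `L - z` has finite dimension. -/
def FiniteNullity (L : H →ₗ.[ℂ] H) (z : ℂ) : Prop :=
  FiniteDimensional ℂ (LinearMap.ker (shift L z))

/-- The range of `L - z` has finite codimension. -/
def FiniteDeficiency (L : H →ₗ.[ℂ] H) (z : ℂ) : Prop :=
  FiniteDimensional ℂ (H ⧸ LinearMap.range (shift L z))

/-- `L - z` is semi-Fredholm (for a closed operator `L`). -/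
def IsSemiFredholm (L : H →ₗ.[ℂ] H) (z : ℂ) : Prop :=
  ClosedRange L z ∧ (FiniteNullity L z ∨ FiniteDeficiency L z)

/-- `L - z` is Fredholm (for a closed operator `L`). -/
def IsFredholm (L : H →ₗ.[ℂ] H) (z : ℂ) : Prop :=
  ClosedRange L z ∧ FiniteNullity L z ∧ FiniteDeficiency L z

/-- The index of `L - z`; only used when `L - z` is Fredholm. -/
def index (L : H →ₗ.[ℂ] H) (z : ℂ) : ℤ :=
  (Module.finrank ℂ (LinearMap.ker (shift L z)) : ℤ) -
    (Module.finrank ℂ (H ⧸ LinearMap.range (shift L z)) : ℤ)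

/-- The kernel of `(L - z) ^ n`, on the natural domain of that power. -/
def powKer (L : H →ₗ.[ℂ] H) (z : ℂ) : ℕ → Submodule ℂ H
  | 0 => ⊥
  | n + 1 => ((powKer L z n).comap (shift L z)).map L.domain.subtype

/-- The root subspace at `z`, the span (in fact the union) of the kernels of all `(L - z) ^ n`;
its dimension is the algebraic multiplicity of `z`. -/
def rootSubspace (L : H →ₗ.[ℂ] H) (z : ℂ) : Submodule ℂ H :=
  ⨆ n, powKer L z n

/-- `z` is an eigenvalue which is an isolated point of the spectrum. -/
def IsIsolatedEigenvalue (L : H →ₗ.[ℂ] H) (z : ℂ) : Prop :=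
  z ∈ pointSpectrum L ∧ ∀ᶠ w in 𝓝[≠] z, w ∉ spectrum L

/-- The complement of the set of `z` with `L - z` semi-Fredholm. -/
def essSpectrum1 (L : H →ₗ.[ℂ] H) : Set ℂ :=
  {z | ¬ IsSemiFredholm L z}

/-- The complement of the set of `z` with `L - z` of closed range and finite nullity. -/
def essSpectrum2 (L : H →ₗ.[ℂ] H) : Set ℂ :=
  {z | ¬ (ClosedRange L z ∧ FiniteNullity L z)}

/-- The complement of the set of `z` with `L - z` Fredholm. -/
def essSpectrum3 (L : H →ₗ.[ℂ] H) : Set ℂ :=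
  {z | ¬ IsFredholm L z}

/-- The complement of the set of `z` with `L - z` Fredholm of index zero. -/
def essSpectrum4 (L : H →ₗ.[ℂ] H) : Set ℂ :=
  {z | ¬ (IsFredholm L z ∧ index L z = 0)}

/-- The points of the spectrum that are not isolated eigenvalues of finite algebraic multiplicity
with `L - z` of closed range. -/
def essSpectrum5 (L : H →ₗ.[ℂ] H) : Set ℂ :=
  {z | z ∈ spectrum L ∧
    ¬ (IsIsolatedEigenvalue L z ∧ FiniteDimensional ℂ (rootSubspace L z) ∧ ClosedRange L z)}

end UnboundedOp

namespace MagneticLaplacian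

/-- The Hilbert space `L²(ℝ²)` of complex-valued functions, with respect to Lebesgue measure. -/
abbrev L2 : Type := Lp ℂ 2 (volume : Measure (ℝ × ℝ))

/-- The operator `-i ∂₁` on functions. -/
def D₁ (φ : ℝ × ℝ → ℂ) : ℝ × ℝ → ℂ :=
  fun x => -Complex.I * fderiv ℝ φ x (1, 0)

/-- The operator `-i ∂₂ - b x₁` on functions. -/
def D₂ (b : ℂ) (φ : ℝ × ℝ → ℂ) : ℝ × ℝ → ℂ :=
  fun x => -Complex.I * fderiv ℝ φ x (0, 1) - b * x.1 * φ x

/-- The differential expression `(-i ∂₁)² + (-i ∂₂ - b x₁)²`, on smooth functions. -/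
def expr (b : ℂ) (φ : ℝ × ℝ → ℂ) : ℝ × ℝ → ℂ :=
  fun x => D₁ (D₁ φ) x + D₂ b (D₂ b φ) x

/-- `[(-i ∂₁)² + (-i ∂₂ - b x₁)²] ψ = f` in the sense of distributions. -/
def IsWeakAction (b : ℂ) (ψ f : L2) : Prop :=
  ∀ φ : ℝ × ℝ → ℂ, ContDiff ℝ ∞ φ → HasCompactSupport φ →
    (∫ x, ψ x * conj (expr (conj b) φ x)) = (∫ x, f x * conj (φ x))

theorem smooth_D₁ {φ : ℝ × ℝ → ℂ} (h : ContDiff ℝ ∞ φ) : ContDiff ℝ ∞ (D₁ φ) := by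
  have h' := h.fderiv_right (m := ∞) (by simp)
  unfold D₁
  fun_prop

theorem smooth_D₂ (b : ℂ) {φ : ℝ × ℝ → ℂ} (h : ContDiff ℝ ∞ φ) : ContDiff ℝ ∞ (D₂ b φ) := by
  have h' := h.fderiv_right (m := ∞) (by simp)
  have h1 : ContDiff ℝ ∞ (fun x : ℝ × ℝ => (x.1 : ℂ)) :=
    Complex.ofRealCLM.contDiff.comp contDiff_fst
  unfold D₂
  fun_prop

theorem compact_D₁ {φ : ℝ × ℝ → ℂ} (h : HasCompactSupport φ) : HasCompactSupport (D₁ φ) :=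
  (h.fderiv_apply ℝ (1, 0)).mul_left

theorem compact_D₂ (b : ℂ) {φ : ℝ × ℝ → ℂ} (h : HasCompactSupport φ) :
    HasCompactSupport (D₂ b φ) :=
  HasCompactSupport.sub (h.fderiv_apply ℝ (0, 1)).mul_left h.mul_left

theorem smooth_expr (b : ℂ) {φ : ℝ × ℝ → ℂ} (h : ContDiff ℝ ∞ φ) : ContDiff ℝ ∞ (expr b φ) :=
  (smooth_D₁ (smooth_D₁ h)).add (smooth_D₂ b (smooth_D₂ b h))

theorem compact_expr (b : ℂ) {φ : ℝ × ℝ → ℂ} (h : HasCompactSupport φ) :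
    HasCompactSupport (expr b φ) :=
  (compact_D₁ (compact_D₁ h)).add (compact_D₂ b (compact_D₂ b h))

theorem integrable_mul_conj (ψ : L2) {g : ℝ × ℝ → ℂ} (hg : Continuous g)
    (hc : HasCompactSupport g) : Integrable (fun x => ψ x * conj (g x)) := by
  have h2 : MemLp (fun x => conj (g x)) 2 (volume : Measure (ℝ × ℝ)) :=
    (Complex.continuous_conj.comp hg).memLp_of_hasCompactSupport (hc.comp_left (by simp))
  exact (Lp.memLp ψ).integrable_mul h2

/-- The graph of the maximal operator. -/
def maximalGraph (b : ℂ) : Submodule ℂ (L2 × L2) where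
  carrier := {p | IsWeakAction b p.1 p.2}
  zero_mem' := by
    intro φ _ _
    simp
  add_mem' := by
    intro p q hp hq φ h hc
    have key : ∀ (u v : L2) (g : ℝ × ℝ → ℂ), Continuous g → HasCompactSupport g →
        ∫ x, (u + v : L2) x * conj (g x) = (∫ x, u x * conj (g x)) + (∫ x, v x * conj (g x)) := by
      intro u v g hg hgc
      rw [← integral_add (integrable_mul_conj u hg hgc) (integrable_mul_conj v hg hgc)]
      refine integral_congr_ae ?_
      filter_upwards [Lp.coeFn_add u v] with x hx
      rw [hx, Pi.add_apply, add_mul]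
    rw [Prod.fst_add, Prod.snd_add, key _ _ _ (smooth_expr _ h).continuous (compact_expr _ hc),
      key _ _ _ h.continuous hc, hp φ h hc, hq φ h hc]
  smul_mem' := by
    intro c p hp φ h hc
    have key : ∀ (u : L2) (g : ℝ × ℝ → ℂ),
        ∫ x, (c • u : L2) x * conj (g x) = c * ∫ x, u x * conj (g x) := by
      intro u g
      rw [← integral_const_mul]
      refine integral_congr_ae ?_
      filter_upwards [Lp.coeFn_smul c u] with x hx
      rw [hx, Pi.smul_apply, smul_eq_mul, mul_assoc]
    rw [Prod.smul_fst, Prod.smul_snd, key, key, hp φ h hc]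

theorem maximalGraph_snd_eq_zero (b : ℂ) (p : L2 × L2) (hp : p ∈ maximalGraph b)
    (h0 : p.1 = 0) : p.2 = 0 := by
  have hp' : IsWeakAction b p.1 p.2 := hp
  rw [Lp.eq_zero_iff_ae_eq_zero]
  refine ae_eq_zero_of_integral_contDiff_smul_eq_zero
    ((Lp.memLp p.2).locallyIntegrable (by norm_num)) fun g hg hc => ?_
  have h := hp' (fun x => (g x : ℂ)) (Complex.ofRealCLM.contDiff.comp hg)
    (hc.comp_left (g := ((↑) : ℝ → ℂ)) (by simp))
  rw [h0, integral_eq_zero_of_ae] at h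
  · rw [h]
    refine integral_congr_ae (Filter.Eventually.of_forall fun x => ?_)
    simp [mul_comm]
  · filter_upwards [Lp.coeFn_zero ℂ 2 (volume : Measure (ℝ × ℝ))] with x hx
    simp

/-- The maximal realization of `(-i ∂₁)² + (-i ∂₂ - b x₁)²` in `L²(ℝ²)`: its domain consists of
the `ψ` in `L²` for which there is an `f` in `L²` (unique by `maximalGraph_snd_eq_zero`) with
`IsWeakAction b ψ f`, and it sends `ψ` to `f`. -/
def maximalOp (b : ℂ) : L2 →ₗ.[ℂ] L2 :=
  (maximalGraph b).toLinearPMap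

theorem mem_graph_maximalOp_iff (b : ℂ) (ψ f : L2) :
    (ψ, f) ∈ (maximalOp b).graph ↔ IsWeakAction b ψ f := by
  rw [maximalOp, Submodule.toLinearPMap_graph_eq _ (maximalGraph_snd_eq_zero b)]
  rfl

/-- The complex Landau levels: `(2k+1) b` if `Re b > 0` and `-(2k+1) b` if `Re b < 0`. -/
def landauLevels (b : ℂ) : Set ℂ :=
  {z | ∃ k : ℕ, (0 < b.re ∧ z = (2 * k + 1) * b) ∨ (b.re < 0 ∧ z = -((2 * k + 1) * b))}

end MagneticLaplacian

end

/-! Write `b = σ a` with `σ = ±1`, and put `w = x₁ + iσ x₂`. Conjugating by `exp (-a x₁² / 2)` turns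
the operator into `-Δ + 2 a x₁ (∂₁ + iσ ∂₂) + a`, where `∂₁ + iσ ∂₂` annihilates holomorphic
functions of `w`. All test functions, eigenfunctions and approximate eigenfunctions come from this
form.

A point `z` is put into the continuous spectrum by three facts, collected in `IsRegularPoint`. There
is no `L²` solution for `(b, z)`, so `L - z` is injective. There is none for `(conj b, conj z)`, so
the range is dense, its orthogonal complement consisting of such solutions. There are approximate
eigenfunctions, so `L - z` is not onto, because by the closed graph theorem the inverse would be
bounded. A dense proper range is not closed, hence `L - z` is not semi-Fredholm.

If `Re b` and `Im b` are non-zero, take `Re a > 0`. As `Im a ≠ 0`, some `q` makes `exp (-a x₁² / 2 +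
q w² + c w)` a decaying Gaussian for which the linear form `ℓ = a x₁ - 2 q w - c` runs through one
real line of `ℂ` (`exists_decaying_gauss`, `linForm_eq`). On `g(ℓ)` times the Gaussian the operator
acts as `g ↦ a g + 2 a ζ g' - a (a - 4 q) g''`. On monomials this is triangular with diagonal `(2 j
+ 1) a`. Testing a weak solution against these functions (for `conj b`) therefore kills it unless
`z` is a Landau level, since the functions are total. At a Landau level, Hermite polynomials in `ℓ`
with varying `c` give infinitely many independent solutions, and the same for `conj b`, so nullity
and deficiency are both infinite. For any `z`, the power `g = ζ ^ ν` with `2 ν + 1 = z / a` solves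
the equation up to `O(ℓ⁻²)`, and `c` pushes the line of values of `ℓ` away from `0`: these are the
approximate eigenfunctions.

If `b` is purely imaginary and non-zero, the factor `exp (-a x₁² / 2)` is unimodular. Approximate
eigenfunctions are `x₁ ^ ν (1 + δ w) ^ (-N)` times that factor, cut off to `x₁ ≥ 1`, with the sign
of `a` chosen so that `Re (z / a) ≥ 0`; as `δ → 0` their mass moves to infinity, where the error is
relatively small. For the absence of eigenvalues, remove the unimodular factor and take the Fourier
transform: the equation becomes a first-order transport equation along the real direction of the
frequency plane. Its integrating factor decays exponentially in one direction on each half plane `±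
Im k > 0`, while the pairing with transported test functions is constant; so the `L²` solution
vanishes (`eq_zero_of_fourierSideOp`).

In both cases the spectrum is the whole plane, so it has no isolated point, and no point is
semi-Fredholm; all five essential spectra follow. -/

noncomputable section

namespace MagneticLaplacian

/-! ### Integration by parts and the formal adjoint -/

section IntegrationByParts

variable {f φ : ℝ × ℝ → ℂ}

theorem fderiv_conj_apply (hφ : Differentiable ℝ φ) (x v : ℝ × ℝ) :
    fderiv ℝ (fun y => conj (φ y)) x v = conj (fderiv ℝ φ x v) := by
  have h := (Complex.conjCLE.toContinuousLinearMap.hasFDerivAt (x := φ x)).comp x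
    (hφ x).hasFDerivAt
  have h' : HasFDerivAt (fun y => conj (φ y))
      (Complex.conjCLE.toContinuousLinearMap.comp (fderiv ℝ φ x)) x := h
  rw [h'.fderiv]
  simp

theorem continuous_fderiv_apply_const (hf : ContDiff ℝ ∞ f) (v : ℝ × ℝ) :
    Continuous fun x => fderiv ℝ f x v :=
  (hf.continuous_fderiv (by simp)).clm_apply continuous_const

theorem integrable_mul_conj_of_continuous (hf : Continuous f) (hφ : Continuous φ)
    (hc : HasCompactSupport φ) : Integrable (fun x => f x * conj (φ x)) :=
  (hf.mul (Complex.continuous_conj.comp hφ)).integrable_of_hasCompactSupport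
    (hc.comp_left (g := fun z : ℂ => conj z) (by simp)).mul_left

theorem integral_mul_conj_fderiv (hf : ContDiff ℝ ∞ f) (hφ : ContDiff ℝ ∞ φ)
    (hc : HasCompactSupport φ) (v : ℝ × ℝ) :
    ∫ x, f x * conj (fderiv ℝ φ x v) = -∫ x, fderiv ℝ f x v * conj (φ x) := by
  have hφd : Differentiable ℝ φ := hφ.differentiable (by simp)
  have hfd : Differentiable ℝ f := hf.differentiable (by simp)
  have hgd : Differentiable ℝ fun y => conj (φ y) :=
    fun x => (Complex.conjCLE.toContinuousLinearMap.differentiableAt).comp x (hφd x)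
  have key := integral_mul_fderiv_eq_neg_fderiv_mul_of_integrable (μ := (volume : Measure (ℝ × ℝ)))
    (f := f) (g := fun y => conj (φ y)) (v := v) ?_ ?_ ?_ (fun x _ => hfd x) (fun x _ => hgd x)
  · simpa only [fderiv_conj_apply hφd] using key
  · exact integrable_mul_conj_of_continuous (continuous_fderiv_apply_const hf v) hφ.continuous hc
  · simp only [fderiv_conj_apply hφd]
    exact integrable_mul_conj_of_continuous hf.continuous
      (continuous_fderiv_apply_const hφ v) (hc.fderiv_apply ℝ v)
  · exact integrable_mul_conj_of_continuous hf.continuous hφ.continuous hc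

theorem integral_mul_conj_D₁ (hf : ContDiff ℝ ∞ f) (hφ : ContDiff ℝ ∞ φ)
    (hc : HasCompactSupport φ) :
    ∫ x, f x * conj (D₁ φ x) = ∫ x, D₁ f x * conj (φ x) := by
  have h := integral_mul_conj_fderiv hf hφ hc (1, 0)
  have e1 : ∀ x, f x * conj (D₁ φ x) = Complex.I * (f x * conj (fderiv ℝ φ x (1, 0))) := by
    intro x; simp [D₁]; ring
  have e2 : ∀ x, D₁ f x * conj (φ x) = -Complex.I * (fderiv ℝ f x (1, 0) * conj (φ x)) := by
    intro x; simp [D₁]; ring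
  simp_rw [e1, e2, integral_const_mul, h]
  ring

theorem integral_mul_conj_D₂ (b : ℂ) (hf : ContDiff ℝ ∞ f) (hφ : ContDiff ℝ ∞ φ)
    (hc : HasCompactSupport φ) :
    ∫ x, f x * conj (D₂ (conj b) φ x) = ∫ x, D₂ b f x * conj (φ x) := by
  have h := integral_mul_conj_fderiv hf hφ hc (0, 1)
  have hx : Continuous fun x : ℝ × ℝ => (x.1 : ℂ) := by fun_prop
  have i0 : Integrable fun x : ℝ × ℝ => b * x.1 * f x * conj (φ x) :=
    integrable_mul_conj_of_continuous (f := fun x : ℝ × ℝ => b * x.1 * f x)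
      ((continuous_const.mul hx).mul hf.continuous) hφ.continuous hc
  have i1 : Integrable fun x => f x * conj (fderiv ℝ φ x (0, 1)) :=
    integrable_mul_conj_of_continuous hf.continuous
      (continuous_fderiv_apply_const hφ _) (hc.fderiv_apply ℝ _)
  have i2 : Integrable fun x => fderiv ℝ f x (0, 1) * conj (φ x) :=
    integrable_mul_conj_of_continuous (continuous_fderiv_apply_const hf _) hφ.continuous hc
  have e1 : ∀ x, f x * conj (D₂ (conj b) φ x)
      = Complex.I * (f x * conj (fderiv ℝ φ x (0, 1))) - b * x.1 * f x * conj (φ x) := by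
    intro x; simp [D₂]; ring
  have e2 : ∀ x, D₂ b f x * conj (φ x)
      = -Complex.I * (fderiv ℝ f x (0, 1) * conj (φ x)) - b * x.1 * f x * conj (φ x) := by
    intro x; simp [D₂]; ring
  simp_rw [e1, e2]
  rw [integral_sub (i1.const_mul _) i0, integral_sub (i2.const_mul _) i0, integral_const_mul,
    integral_const_mul, h]
  ring

/-- `D₁` is formally self-adjoint and the formal adjoint of `D₂ b` is `D₂ (conj b)`; this is applied
twice to each square. -/
theorem integral_mul_conj_expr (b : ℂ) (hf : ContDiff ℝ ∞ f) (hφ : ContDiff ℝ ∞ φ)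
    (hc : HasCompactSupport φ) :
    ∫ x, f x * conj (expr (conj b) φ x) = ∫ x, expr b f x * conj (φ x) := by
  have h1 : ∫ x, f x * conj (D₁ (D₁ φ) x) = ∫ x, D₁ (D₁ f) x * conj (φ x) := by
    rw [integral_mul_conj_D₁ hf (smooth_D₁ hφ) (compact_D₁ hc),
      integral_mul_conj_D₁ (smooth_D₁ hf) hφ hc]
  have h2 : ∫ x, f x * conj (D₂ (conj b) (D₂ (conj b) φ) x)
      = ∫ x, D₂ b (D₂ b f) x * conj (φ x) := by
    rw [integral_mul_conj_D₂ b hf (smooth_D₂ _ hφ) (compact_D₂ _ hc),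
      integral_mul_conj_D₂ b (smooth_D₂ b hf) hφ hc]
  simp only [expr, map_add, mul_add, add_mul]
  rw [integral_add, integral_add, h1, h2]
  · exact integrable_mul_conj_of_continuous (smooth_D₁ (smooth_D₁ hf)).continuous hφ.continuous hc
  · exact integrable_mul_conj_of_continuous (smooth_D₂ _ (smooth_D₂ _ hf)).continuous
      hφ.continuous hc
  · exact integrable_mul_conj_of_continuous hf.continuous
      (smooth_D₁ (smooth_D₁ hφ)).continuous (compact_D₁ (compact_D₁ hc))
  · exact integrable_mul_conj_of_continuous hf.continuous
      (smooth_D₂ _ (smooth_D₂ _ hφ)).continuous (compact_D₂ _ (compact_D₂ _ hc))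

/-- A smooth `L²` function whose classical image is `L²` belongs to the maximal domain. -/
theorem isWeakAction_toLp (b : ℂ) (hf : ContDiff ℝ ∞ f) (h : MemLp f 2 volume)
    (h' : MemLp (expr b f) 2 volume) :
    IsWeakAction b (h.toLp f) (h'.toLp (expr b f)) := by
  intro φ hφ hc
  have e1 : ∫ x, (h.toLp f) x * conj (expr (conj b) φ x)
      = ∫ x, f x * conj (expr (conj b) φ x) := by
    refine integral_congr_ae ?_
    filter_upwards [h.coeFn_toLp] with x hx
    rw [hx]
  have e2 : ∫ x, (h'.toLp (expr b f)) x * conj (φ x) = ∫ x, expr b f x * conj (φ x) := by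
    refine integral_congr_ae ?_
    filter_upwards [h'.coeFn_toLp] with x hx
    rw [hx]
  rw [e1, e2, integral_mul_conj_expr b hf hφ hc]

end IntegrationByParts

/-! ### Product rules, and extension of the weak equation to non-compact test functions -/

section Cutoff

variable {χ η : ℝ × ℝ → ℂ}

theorem D₁_mul (hχ : ContDiff ℝ ∞ χ) (hη : ContDiff ℝ ∞ η) (x : ℝ × ℝ) :
    D₁ (fun y => χ y * η y) x = χ x * D₁ η x + D₁ χ x * η x := by
  have h1 : DifferentiableAt ℝ χ x := hχ.differentiable (by simp) x
  have h2 : DifferentiableAt ℝ η x := hη.differentiable (by simp) x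
  simp only [D₁, fderiv_fun_mul h1 h2, add_apply,
    smul_apply, smul_eq_mul]
  ring

/-- The potential is additive, so the field may be split between the two factors. A cutoff takes the
share `0`. -/
theorem D₂_mul (b c : ℂ) (hχ : ContDiff ℝ ∞ χ) (hη : ContDiff ℝ ∞ η) (x : ℝ × ℝ) :
    D₂ (c + b) (fun y => χ y * η y) x = χ x * D₂ b η x + D₂ c χ x * η x := by
  have h1 : DifferentiableAt ℝ χ x := hχ.differentiable (by simp) x
  have h2 : DifferentiableAt ℝ η x := hη.differentiable (by simp) x
  simp only [D₂, fderiv_fun_mul h1 h2, add_apply,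
    smul_apply, smul_eq_mul]
  ring

theorem D₁_add {f g : ℝ × ℝ → ℂ} (hf : ContDiff ℝ ∞ f) (hg : ContDiff ℝ ∞ g) (x : ℝ × ℝ) :
    D₁ (fun y => f y + g y) x = D₁ f x + D₁ g x := by
  have h1 : DifferentiableAt ℝ f x := hf.differentiable (by simp) x
  have h2 : DifferentiableAt ℝ g x := hg.differentiable (by simp) x
  simp only [D₁, fderiv_fun_add h1 h2, add_apply]
  ring

theorem D₂_add (b : ℂ) {f g : ℝ × ℝ → ℂ} (hf : ContDiff ℝ ∞ f) (hg : ContDiff ℝ ∞ g)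
    (x : ℝ × ℝ) : D₂ b (fun y => f y + g y) x = D₂ b f x + D₂ b g x := by
  have h1 : DifferentiableAt ℝ f x := hf.differentiable (by simp) x
  have h2 : DifferentiableAt ℝ g x := hg.differentiable (by simp) x
  simp only [D₂, fderiv_fun_add h1 h2, add_apply]
  ring

/-- The terms other than `χ * expr b η` form the commutator with the cutoff. They contain
derivatives of `χ` only, hence gain a factor `c` when `χ` is replaced by `χ (c • ·)`. -/
theorem expr_mul (b : ℂ) (hχ : ContDiff ℝ ∞ χ) (hη : ContDiff ℝ ∞ η) (x : ℝ × ℝ) :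
    expr b (fun y => χ y * η y) x = χ x * expr b η x + 2 * (D₁ χ x * D₁ η x)
      + 2 * (D₂ 0 χ x * D₂ b η x) + expr 0 χ x * η x := by
  have a1 : D₁ (fun y => χ y * η y) = fun y => χ y * D₁ η y + D₁ χ y * η y :=
    funext (D₁_mul hχ hη)
  have a2 : D₂ b (fun y => χ y * η y) = fun y => χ y * D₂ b η y + D₂ 0 χ y * η y :=
    funext fun y => by simpa using D₂_mul b 0 hχ hη y
  have b2 : ∀ {u v : ℝ × ℝ → ℂ}, ContDiff ℝ ∞ u → ContDiff ℝ ∞ v →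
      D₂ b (fun y => u y * v y) x = u x * D₂ b v x + D₂ 0 u x * v x :=
    fun hu hv => by simpa using D₂_mul b 0 hu hv x
  simp only [expr]
  rw [a1, a2, D₁_add (hχ.mul (smooth_D₁ hη)) ((smooth_D₁ hχ).mul hη),
    D₂_add b (hχ.mul (smooth_D₂ b hη)) ((smooth_D₂ 0 hχ).mul hη),
    D₁_mul hχ (smooth_D₁ hη), D₁_mul (smooth_D₁ hχ) hη, b2 hχ (smooth_D₂ b hη),
    b2 (smooth_D₂ 0 hχ) hη]
  ring

theorem fderiv_comp_smul_apply (c : ℝ) (hχ : ContDiff ℝ ∞ χ) (x v : ℝ × ℝ) :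
    fderiv ℝ (fun y => χ (c • y)) x v = c * fderiv ℝ χ (c • x) v := by
  have h1 : HasFDerivAt (fun y : ℝ × ℝ => c • y) (c • ContinuousLinearMap.id ℝ (ℝ × ℝ)) x :=
    (hasFDerivAt_id x).const_smul c
  have h2 := ((hχ.differentiable (by simp) (c • x)).hasFDerivAt).comp x h1
  have h3 : HasFDerivAt (fun y => χ (c • y))
      ((fderiv ℝ χ (c • x)).comp (c • ContinuousLinearMap.id ℝ (ℝ × ℝ))) x := h2
  rw [h3.fderiv]
  simp

theorem D₁_comp_smul (c : ℝ) (hχ : ContDiff ℝ ∞ χ) (x : ℝ × ℝ) :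
    D₁ (fun y => χ (c • y)) x = c * D₁ χ (c • x) := by
  simp only [D₁, fderiv_comp_smul_apply c hχ]
  ring

theorem D₂_zero_comp_smul (c : ℝ) (hχ : ContDiff ℝ ∞ χ) (x : ℝ × ℝ) :
    D₂ 0 (fun y => χ (c • y)) x = c * D₂ 0 χ (c • x) := by
  simp only [D₂, fderiv_comp_smul_apply c hχ]
  ring

theorem D₁_const_mul (c : ℂ) {f : ℝ × ℝ → ℂ} (hf : ContDiff ℝ ∞ f) (x : ℝ × ℝ) :
    D₁ (fun y => c * f y) x = c * D₁ f x := by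
  simpa [D₁] using D₁_mul (contDiff_const (c := c)) hf x

theorem D₂_const_mul (b c : ℂ) {f : ℝ × ℝ → ℂ} (hf : ContDiff ℝ ∞ f) (x : ℝ × ℝ) :
    D₂ b (fun y => c * f y) x = c * D₂ b f x := by
  simpa [D₂] using D₂_mul b 0 (contDiff_const (c := c)) hf x

theorem expr_zero_comp_smul (c : ℝ) (hχ : ContDiff ℝ ∞ χ) (x : ℝ × ℝ) :
    expr 0 (fun y => χ (c • y)) x = c * (c * expr 0 χ (c • x)) := by
  have a1 : D₁ (fun y => χ (c • y)) = fun y => c * D₁ χ (c • y) := funext (D₁_comp_smul c hχ)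
  have a2 : D₂ 0 (fun y => χ (c • y)) = fun y => c * D₂ 0 χ (c • y) :=
    funext (D₂_zero_comp_smul c hχ)
  have s : ContDiff ℝ ∞ fun y : ℝ × ℝ => c • y := contDiff_const_smul c
  simp only [expr]
  rw [a1, a2, D₁_const_mul (c : ℂ) (f := fun y => D₁ χ (c • y)) ((smooth_D₁ hχ).comp s),
    D₂_const_mul 0 (c : ℂ) (f := fun y => D₂ 0 χ (c • y)) ((smooth_D₂ 0 hχ).comp s),
    D₁_comp_smul c (smooth_D₁ hχ) x, D₂_zero_comp_smul c (smooth_D₂ 0 hχ) x]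
  ring

/-- The weak action identity holds against all smooth functions which, together with their images
under `D₁`, `D₂` and `expr`, are square integrable. -/
theorem IsWeakAction.integral_eq {b : ℂ} {ψ f : L2} (h : IsWeakAction b ψ f)
    (hη : ContDiff ℝ ∞ η) (m0 : MemLp η 2 volume) (m1 : MemLp (D₁ η) 2 volume)
    (m2 : MemLp (D₂ (conj b) η) 2 volume) (m3 : MemLp (expr (conj b) η) 2 volume) :
    ∫ x, ψ x * conj (expr (conj b) η x) = ∫ x, f x * conj (η x) := by
  let β : ContDiffBump (0 : ℝ × ℝ) := ⟨1, 2, by norm_num, by norm_num⟩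
  let χ : ℝ × ℝ → ℂ := fun x => (β x : ℂ)
  have hχ : ContDiff ℝ ∞ χ := Complex.ofRealCLM.contDiff.comp β.contDiff
  have hχc : HasCompactSupport χ := β.hasCompactSupport.comp_left (g := ((↑) : ℝ → ℂ)) (by simp)
  have hχ1 : ∀ x, ‖χ x‖ ≤ 1 := fun x => by
    simp only [χ, Complex.norm_real, Real.norm_eq_abs, abs_of_nonneg β.nonneg]
    exact β.le_one
  obtain ⟨C1, hC1⟩ := (compact_D₁ hχc).exists_bound_of_continuous (smooth_D₁ hχ).continuous
  obtain ⟨C2, hC2⟩ := (compact_D₂ 0 hχc).exists_bound_of_continuous (smooth_D₂ 0 hχ).continuous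
  obtain ⟨C3, hC3⟩ := (compact_expr 0 hχc).exists_bound_of_continuous (smooth_expr 0 hχ).continuous
  -- Dilating the bump by `c n → 0` makes the cutoff tend to `1` pointwise, while its derivatives
  -- stay bounded and tend to `0`.
  let c : ℕ → ℝ := fun n => 1 / ((n : ℝ) + 1)
  have hc0 : Filter.Tendsto c Filter.atTop (𝓝 0) := tendsto_one_div_add_atTop_nhds_zero_nat
  have hcpos : ∀ n, 0 < c n := fun n => Nat.one_div_pos_of_nat
  have hcle : ∀ n, c n ≤ 1 := fun n => by
    simp only [c]; rw [div_le_one (by positivity)]; linarith [n.cast_nonneg (α := ℝ)]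
  have hχn : ∀ n, ContDiff ℝ ∞ fun x => χ (c n • x) := fun n => hχ.comp (contDiff_const_smul _)
  have hχnc : ∀ n, HasCompactSupport fun x => χ (c n • x) := fun n =>
    hχc.comp_smul (hcpos n).ne'
  have key : ∀ n, ∫ x, ψ x * conj (expr (conj b) (fun y => χ (c n • y) * η y) x)
      = ∫ x, f x * conj (χ (c n • x) * η x) :=
    fun n => h _ ((hχn n).mul hη) (hχnc n).mul_right
  have hcx : ∀ x : ℝ × ℝ, Filter.Tendsto (fun n => c n • x) Filter.atTop (𝓝 0) := fun x => by
    simpa using hc0.smul_const x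
  have hχlim : ∀ x : ℝ × ℝ, Filter.Tendsto (fun n => χ (c n • x)) Filter.atTop (𝓝 1) := fun x => by
    have : χ 0 = 1 := by
      simp only [χ]
      rw [β.one_of_mem_closedBall (by simp [β])]
      simp
    simpa [this, Function.comp_def] using (hχ.continuous.tendsto 0).comp (hcx x)
  have hcC : Filter.Tendsto (fun n => (c n : ℂ)) Filter.atTop (𝓝 0) := by
    simpa [Function.comp_def] using (Complex.continuous_ofReal.tendsto 0).comp hc0
  have lim2 : Filter.Tendsto (fun n => ∫ x, f x * conj (χ (c n • x) * η x)) Filter.atTop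
      (𝓝 (∫ x, f x * conj (η x))) := by
    refine tendsto_integral_of_dominated_convergence (fun x => ‖f x‖ * ‖η x‖) (fun n => ?_) ?_
      (fun n => ?_) ?_
    · exact (Lp.aestronglyMeasurable f).mul (Complex.continuous_conj.comp_aestronglyMeasurable
        ((hχn n).continuous.aestronglyMeasurable.mul m0.1))
    · exact (Lp.memLp f).norm.integrable_mul m0.norm
    · refine Filter.Eventually.of_forall fun x => ?_
      rw [norm_mul, RCLike.norm_conj, norm_mul]
      gcongr
      exact mul_le_of_le_one_left (norm_nonneg _) (hχ1 _)
    · refine Filter.Eventually.of_forall fun x => ?_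
      have := ((Complex.continuous_conj.tendsto _).comp ((hχlim x).mul_const (η x))).const_mul (f x)
      simpa [Function.comp_def] using this
  have lim1 : Filter.Tendsto
      (fun n => ∫ x, ψ x * conj (expr (conj b) (fun y => χ (c n • y) * η y) x)) Filter.atTop
      (𝓝 (∫ x, ψ x * conj (expr (conj b) η x))) := by
    -- The majorant pairs `ψ` with each of the four `L²` functions occurring in `expr_mul`; this is
    -- where `m0` to `m3` enter.
    refine tendsto_integral_of_dominated_convergence
      (fun x => ‖ψ x‖ * (‖expr (conj b) η x‖ + 2 * (C1 * ‖D₁ η x‖)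
        + 2 * (C2 * ‖D₂ (conj b) η x‖) + C3 * ‖η x‖)) (fun n => ?_) ?_ (fun n => ?_) ?_
    · exact (Lp.aestronglyMeasurable ψ).mul (Complex.continuous_conj.comp_aestronglyMeasurable
        (smooth_expr _ ((hχn n).mul hη)).continuous.aestronglyMeasurable)
    · refine (Lp.memLp ψ).norm.integrable_mul (q := 2) ?_
      exact ((m3.norm.add ((m1.norm.const_mul C1).const_mul 2)).add
        ((m2.norm.const_mul C2).const_mul 2)).add (m0.norm.const_mul C3)
    · refine Filter.Eventually.of_forall fun x => ?_
      rw [norm_mul, RCLike.norm_conj, expr_mul _ (hχn n) hη, D₁_comp_smul _ hχ,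
        D₂_zero_comp_smul _ hχ, expr_zero_comp_smul _ hχ]
      have n1 : ‖(c n : ℂ)‖ ≤ 1 := by
        rw [Complex.norm_real, Real.norm_eq_abs, abs_of_pos (hcpos n)]; exact hcle n
      have k : ∀ (u : ℂ) (C : ℝ), ‖u‖ ≤ C → ‖(c n : ℂ) * u‖ ≤ C := fun u C hu => by
        rw [norm_mul]
        exact (mul_le_of_le_one_left (norm_nonneg _) n1).trans hu
      gcongr
      refine (norm_add_le _ _).trans (add_le_add ((norm_add_le _ _).trans (add_le_add
        ((norm_add_le _ _).trans (add_le_add ?_ ?_)) ?_)) ?_)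
      · rw [norm_mul]
        exact mul_le_of_le_one_left (norm_nonneg _) (hχ1 _)
      · rw [norm_mul, norm_mul, RCLike.norm_ofNat]
        gcongr
        exact k _ _ (hC1 _)
      · rw [norm_mul, norm_mul, RCLike.norm_ofNat]
        gcongr
        exact k _ _ (hC2 _)
      · rw [norm_mul]
        gcongr
        exact k _ _ (k _ _ (hC3 _))
    · refine Filter.Eventually.of_forall fun x => ?_
      have g1 := ((smooth_D₁ hχ).continuous.tendsto 0).comp (hcx x)
      have g2 := ((smooth_D₂ 0 hχ).continuous.tendsto 0).comp (hcx x)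
      have g3 := ((smooth_expr 0 hχ).continuous.tendsto 0).comp (hcx x)
      have hh := ((((hχlim x).mul_const (expr (conj b) η x)).add
        (((hcC.mul g1).mul_const (D₁ η x)).const_mul 2)).add
        (((hcC.mul g2).mul_const (D₂ (conj b) η x)).const_mul 2)).add
        ((hcC.mul (hcC.mul g3)).mul_const (η x))
      have hh' := ((Complex.continuous_conj.tendsto _).comp hh).const_mul (ψ x)
      simp only [zero_mul, mul_zero, add_zero, one_mul] at hh'
      refine hh'.congr fun n => ?_
      simp only [Function.comp_apply]
      rw [expr_mul _ (hχn n) hη, D₁_comp_smul _ hχ,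
        D₂_zero_comp_smul _ hχ, expr_zero_comp_smul _ hχ]
  exact tendsto_nhds_unique lim1 (lim2.congr fun n => (key n).symm)

end Cutoff

end MagneticLaplacian

namespace MagneticLaplacian

open UnboundedOp
open scoped InnerProductSpace

/-! ### From weak solutions to properties of the unbounded operator -/

section Operator

variable {b z : ℂ}

theorem inner_toLp_left {X : Type*} [MeasurableSpace X] {μ : Measure X} {g : X → ℂ}
    (hg : MemLp g 2 μ) (ψ : Lp ℂ 2 μ) : ⟪hg.toLp g, ψ⟫_ℂ = ∫ x, ψ x * conj (g x) ∂μ := by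
  rw [L2.inner_def]
  refine integral_congr_ae ?_
  filter_upwards [hg.coeFn_toLp] with x hx
  rw [hx]
  rfl

theorem memLp_of_contDiff {φ : ℝ × ℝ → ℂ} (h : ContDiff ℝ ∞ φ) (hc : HasCompactSupport φ) :
    MemLp φ 2 (volume : Measure (ℝ × ℝ)) :=
  h.continuous.memLp_of_hasCompactSupport hc

/-- In this form the condition is visibly closed in `(ψ, f)`, by continuity of the inner product. -/
theorem isWeakAction_iff_inner (b : ℂ) (ψ f : L2) : IsWeakAction b ψ f ↔
    ∀ (φ : ℝ × ℝ → ℂ) (h : ContDiff ℝ ∞ φ) (hc : HasCompactSupport φ),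
      ⟪(memLp_of_contDiff (smooth_expr (conj b) h) (compact_expr _ hc)).toLp _, ψ⟫_ℂ
        = ⟪(memLp_of_contDiff h hc).toLp _, f⟫_ℂ := by
  simp only [inner_toLp_left, IsWeakAction]

/-- The maximal operator is closed. -/
theorem isWeakAction_of_tendsto {u v : ℕ → L2} {ψ f : L2} (h : ∀ n, IsWeakAction b (u n) (v n))
    (hu : Filter.Tendsto u Filter.atTop (𝓝 ψ)) (hv : Filter.Tendsto v Filter.atTop (𝓝 f)) :
    IsWeakAction b ψ f := by
  rw [isWeakAction_iff_inner]
  intro φ hφ hc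
  have h1 := tendsto_const_nhds.inner (𝕜 := ℂ) hu
    (x := (memLp_of_contDiff (smooth_expr (conj b) hφ) (compact_expr _ hc)).toLp _)
  have h2 := tendsto_const_nhds.inner (𝕜 := ℂ) hv (x := (memLp_of_contDiff hφ hc).toLp _)
  refine tendsto_nhds_unique h1 (h2.congr fun n => ?_)
  exact ((isWeakAction_iff_inner b _ _).1 (h n) φ hφ hc).symm

theorem exists_shift_eq {ψ f : L2} (h : IsWeakAction b ψ f) (z : ℂ) :
    ∃ x : (maximalOp b).domain, (x : L2) = ψ ∧ shift (maximalOp b) z x = f - z • ψ := by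
  obtain ⟨x, hx, hf⟩ := (LinearPMap.mem_graph_iff _).1 ((mem_graph_maximalOp_iff b ψ f).2 h)
  refine ⟨x, hx, ?_⟩
  simp only at hx hf
  rw [← hf, ← hx]
  simp [shift]

theorem isWeakAction_shift (z : ℂ) (x : (maximalOp b).domain) :
    IsWeakAction b x (shift (maximalOp b) z x + z • (x : L2)) := by
  rw [← mem_graph_maximalOp_iff]
  have := (maximalOp b).mem_graph x
  convert this using 2
  simp [shift]

theorem shift_injective_iff : Function.Injective (shift (maximalOp b) z) ↔
    ∀ ψ : L2, IsWeakAction b ψ (z • ψ) → ψ = 0 := by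
  rw [injective_iff_map_eq_zero]
  constructor
  · intro h ψ hψ
    obtain ⟨x, hx, hs⟩ := exists_shift_eq hψ z
    rw [sub_self] at hs
    rw [← hx, h x hs]
    rfl
  · intro h x hx
    have := isWeakAction_shift z x
    rw [hx, zero_add] at this
    exact Subtype.ext (h _ this)

/-- A vector orthogonal to the range is orthogonal to the images of compactly supported smooth
functions, which says precisely that it solves the equation for `conj b` and `conj z`. -/
theorem dense_range_shift (h : ∀ ψ : L2, IsWeakAction (conj b) ψ (conj z • ψ) → ψ = 0) :
    Dense (Set.range (shift (maximalOp b) z)) := by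
  rw [← LinearMap.coe_range, Submodule.dense_iff_topologicalClosure_eq_top,
    Submodule.topologicalClosure_eq_top_iff, Submodule.eq_bot_iff]
  intro g hg
  refine h g fun φ hφ hc => ?_
  have m0 := memLp_of_contDiff hφ hc
  have m1 := memLp_of_contDiff (smooth_expr b hφ) (compact_expr b hc)
  obtain ⟨x, -, hs⟩ := exists_shift_eq (isWeakAction_toLp b hφ m0 m1) z
  have h0 := (Submodule.mem_orthogonal _ _).1 hg _ (LinearMap.mem_range_self _ x)
  rw [hs, inner_sub_left, sub_eq_zero, inner_smul_left, ← inner_smul_right, inner_toLp_left,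
    inner_toLp_left] at h0
  rw [Complex.conj_conj]
  exact h0

/-- Approximate eigenfunctions prevent an injective `L - z` from being onto. -/
theorem range_shift_ne_univ (hinj : Function.Injective (shift (maximalOp b) z))
    (hps : ∀ ε > 0, ∃ ψ g : L2, IsWeakAction b ψ (g + z • ψ) ∧ ψ ≠ 0 ∧ ‖g‖ ≤ ε * ‖ψ‖) :
    Set.range (shift (maximalOp b) z) ≠ Set.univ := by
  intro hr
  have hbij : Function.Bijective (shift (maximalOp b) z) := ⟨hinj, Set.range_eq_univ.1 hr⟩
  let e := LinearEquiv.ofBijective (shift (maximalOp b) z) hbij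
  let R : L2 →ₗ[ℂ] L2 := (maximalOp b).domain.subtype ∘ₗ e.symm.toLinearMap
  have hRw : ∀ g, IsWeakAction b (R g) (g + z • R g) := fun g => by
    have := isWeakAction_shift z (e.symm g)
    have h2 : shift (maximalOp b) z (e.symm g) = g := e.apply_symm_apply g
    rwa [h2] at this
  have huniq : ∀ ψ g, IsWeakAction b ψ (g + z • ψ) → ψ = R g := by
    intro ψ g h
    obtain ⟨x, hx, hs⟩ := exists_shift_eq h z
    rw [add_sub_cancel_right] at hs
    have : e x = g := hs
    simp [R, ← this, hx]
  -- The closed graph theorem, applied to the inverse.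
  have hcont : Continuous R := by
    refine LinearMap.continuous_of_seq_closed_graph R fun u x y hu hy => ?_
    refine huniq _ _ (isWeakAction_of_tendsto (fun n => hRw (u n)) hy ?_)
    exact hu.add (hy.const_smul z)
  let R' : L2 →L[ℂ] L2 := ⟨R, hcont⟩
  -- With this tolerance `‖ψ‖ ≤ ‖R'‖ ‖g‖` gives `‖ψ‖ ≤ ‖ψ‖ / 2`, a contradiction.
  obtain ⟨ψ, g, hw, h0, hle⟩ := hps (1 / (‖R'‖ + 1) / 2) (by positivity)
  have h1 : ‖ψ‖ ≤ ‖R'‖ * ‖g‖ := by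
    have : ψ = R' g := huniq _ _ hw
    rw [this]
    exact R'.le_opNorm g
  have hpos : 0 < ‖ψ‖ := norm_pos_iff.2 h0
  have hN := norm_nonneg R'
  have h2 : ‖ψ‖ ≤ ‖R'‖ * (1 / (‖R'‖ + 1) / 2 * ‖ψ‖) := h1.trans (by gcongr)
  have h3 : ‖R'‖ * (1 / (‖R'‖ + 1) / 2 * ‖ψ‖) = (‖R'‖ / (‖R'‖ + 1)) * (‖ψ‖ / 2) := by
    field_simp
  have h4 : ‖R'‖ / (‖R'‖ + 1) ≤ 1 := by
    rw [div_le_one (by positivity)]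
    linarith
  nlinarith

theorem not_finiteNullity {N : ℕ → L2} (hli : LinearIndependent ℂ N)
    (hN : ∀ n, IsWeakAction b (N n) (z • N n)) : ¬ FiniteNullity (maximalOp b) z := by
  intro hfin
  have hfin' : FiniteDimensional ℂ (LinearMap.ker (shift (maximalOp b) z)) := hfin
  choose x hx hs using fun n => exists_shift_eq (hN n) z
  let k : ℕ → LinearMap.ker (shift (maximalOp b) z) := fun n => ⟨x n, by simp [hs]⟩
  have hk : LinearIndependent ℂ k := by
    refine LinearIndependent.of_comp
      ((maximalOp b).domain.subtype ∘ₗ (LinearMap.ker (shift (maximalOp b) z)).subtype) ?_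
    convert hli using 1
    funext n
    exact hx n
  exact hk.finite.false

/-- The span of the `N n` is orthogonal to the range, so it meets it only in `0` and embeds in the
quotient. -/
theorem not_finiteDeficiency {N : ℕ → L2} (hli : LinearIndependent ℂ N)
    (hN : ∀ n ψ f, IsWeakAction b ψ f → ⟪N n, f - z • ψ⟫_ℂ = 0) :
    ¬ FiniteDeficiency (maximalOp b) z := by
  intro hfin
  have hfin' : FiniteDimensional ℂ (L2 ⧸ LinearMap.range (shift (maximalOp b) z)) := hfin
  let K := Submodule.span ℂ (Set.range N)
  have hK : ∀ k ∈ K, ∀ x, ⟪k, shift (maximalOp b) z x⟫_ℂ = 0 := by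
    intro k hk x
    have hw := isWeakAction_shift z x
    induction hk using Submodule.span_induction with
    | mem k hk =>
      obtain ⟨n, rfl⟩ := hk
      simpa using hN n _ _ hw
    | zero => simp
    | add u v _ _ hu hv => rw [inner_add_left, hu, hv, add_zero]
    | smul c u _ hu => rw [inner_smul_left, hu, mul_zero]
  have hq : LinearIndependent ℂ ((LinearMap.range (shift (maximalOp b) z)).mkQ ∘ N) := by
    refine hli.map ?_
    rw [Submodule.ker_mkQ, Submodule.disjoint_def]
    rintro k hk ⟨x, rfl⟩
    exact inner_self_eq_zero.1 (hK _ hk x)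
  exact hq.finite.false

end Operator

end MagneticLaplacian

namespace MagneticLaplacian

/-! ### Calculus of partial derivatives -/

section Partials

/-- `F` has partial derivatives `F₁`, `F₂` at `x` (in the Fréchet sense). -/
def HasPartialsAt (F : ℝ × ℝ → ℂ) (F₁ F₂ : ℂ) (x : ℝ × ℝ) : Prop :=
  HasFDerivAt F ((ContinuousLinearMap.fst ℝ ℝ ℝ).smulRight F₁ +
    (ContinuousLinearMap.snd ℝ ℝ ℝ).smulRight F₂) x

variable {F G : ℝ × ℝ → ℂ} {F₁ F₂ G₁ G₂ : ℂ} {x : ℝ × ℝ}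

theorem HasPartialsAt.congr_partials (h : HasPartialsAt F F₁ F₂ x) (h1 : F₁ = G₁) (h2 : F₂ = G₂) :
    HasPartialsAt F G₁ G₂ x := by
  subst h1 h2; exact h

theorem HasPartialsAt.D₁_eq (h : HasPartialsAt F F₁ F₂ x) : D₁ F x = -Complex.I * F₁ := by
  rw [D₁, HasFDerivAt.fderiv h]
  simp

theorem HasPartialsAt.D₂_eq (b : ℂ) (h : HasPartialsAt F F₁ F₂ x) :
    D₂ b F x = -Complex.I * F₂ - b * x.1 * F x := by
  rw [D₂, HasFDerivAt.fderiv h]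
  simp

theorem hasPartialsAt_const (c : ℂ) (x : ℝ × ℝ) : HasPartialsAt (fun _ => c) 0 0 x := by
  have := hasFDerivAt_const (𝕜 := ℝ) c x
  simpa [HasPartialsAt] using this

theorem hasPartialsAt_fst (x : ℝ × ℝ) : HasPartialsAt (fun y => (y.1 : ℂ)) 1 0 x := by
  have h : HasFDerivAt (fun y : ℝ × ℝ => (y.1 : ℂ))
      (Complex.ofRealCLM.comp (ContinuousLinearMap.fst ℝ ℝ ℝ)) x :=
    (Complex.ofRealCLM.comp (ContinuousLinearMap.fst ℝ ℝ ℝ)).hasFDerivAt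
  refine h.congr_fderiv ?_
  ext <;> simp

theorem hasPartialsAt_snd (x : ℝ × ℝ) : HasPartialsAt (fun y => (y.2 : ℂ)) 0 1 x := by
  have h : HasFDerivAt (fun y : ℝ × ℝ => (y.2 : ℂ))
      (Complex.ofRealCLM.comp (ContinuousLinearMap.snd ℝ ℝ ℝ)) x :=
    (Complex.ofRealCLM.comp (ContinuousLinearMap.snd ℝ ℝ ℝ)).hasFDerivAt
  refine h.congr_fderiv ?_
  ext <;> simp

theorem HasPartialsAt.add (hF : HasPartialsAt F F₁ F₂ x) (hG : HasPartialsAt G G₁ G₂ x) :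
    HasPartialsAt (fun y => F y + G y) (F₁ + G₁) (F₂ + G₂) x := by
  refine (HasFDerivAt.fun_add hF hG).congr_fderiv ?_
  ext <;> simp

theorem HasPartialsAt.mul (hF : HasPartialsAt F F₁ F₂ x) (hG : HasPartialsAt G G₁ G₂ x) :
    HasPartialsAt (fun y => F y * G y) (F x * G₁ + F₁ * G x) (F x * G₂ + F₂ * G x) x := by
  refine (HasFDerivAt.fun_mul hF hG).congr_fderiv ?_
  ext <;> simp [mul_comm]

theorem HasPartialsAt.const_mul (c : ℂ) (hF : HasPartialsAt F F₁ F₂ x) :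
    HasPartialsAt (fun y => c * F y) (c * F₁) (c * F₂) x :=
  ((hasPartialsAt_const c x).mul hF).congr_partials (by simp) (by simp)

theorem HasPartialsAt.comp {g : ℂ → ℂ} {g' : ℂ} (hg : HasDerivAt g g' (F x))
    (hF : HasPartialsAt F F₁ F₂ x) :
    HasPartialsAt (fun y => g (F y)) (g' * F₁) (g' * F₂) x := by
  have h := (hg.hasFDerivAt.restrictScalars ℝ).comp x hF
  refine HasFDerivAt.congr_fderiv (f := fun y => g (F y)) h ?_
  ext <;> simp [mul_comm]

end Partials

/-! ### Complex Gaussians and the action of the operator on functions of the linear form -/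

section GaussianFamily

/-- The complex coordinate `x₁ + i σ x₂`. -/
def cplx (σ : ℝ) (x : ℝ × ℝ) : ℂ := x.1 + Complex.I * σ * x.2

/-- The linear form `a x₁ - 2 q w - c`, where `w` is the complex coordinate. -/
def linForm (σ : ℝ) (a q c : ℂ) (x : ℝ × ℝ) : ℂ := a * x.1 - 2 * q * cplx σ x - c

/-- The complex Gaussian `exp (- a x₁ ^ 2 / 2 + q w ^ 2 + c w)`. -/
def gauss (σ : ℝ) (a q c : ℂ) (x : ℝ × ℝ) : ℂ :=
  Complex.exp (-a / 2 * (x.1 * x.1) + q * (cplx σ x * cplx σ x) + c * cplx σ x)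

variable {σ : ℝ} {a q c : ℂ}

theorem hasPartialsAt_cplx (σ : ℝ) (x : ℝ × ℝ) :
    HasPartialsAt (cplx σ) 1 (Complex.I * σ) x :=
  ((hasPartialsAt_fst x).add ((hasPartialsAt_snd x).const_mul (Complex.I * σ))).congr_partials
    (by simp) (by simp)

theorem hasPartialsAt_linForm (σ : ℝ) (a q c : ℂ) (x : ℝ × ℝ) :
    HasPartialsAt (linForm σ a q c) (a - 2 * q) (-2 * q * (Complex.I * σ)) x := by
  have h := (((hasPartialsAt_fst x).const_mul a).add
    ((hasPartialsAt_cplx σ x).const_mul (-2 * q))).add (hasPartialsAt_const (-c) x)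
  have e : (fun y : ℝ × ℝ => a * (y.1 : ℂ) + -2 * q * cplx σ y + -c) = linForm σ a q c := by
    funext y; simp only [linForm]; ring
  rw [e] at h
  exact h.congr_partials (by ring) (by ring)

/-- The linear form is minus the logarithmic `x₁`-derivative of the Gaussian. It follows that `D₁`
and `D₂ (σ a)` multiply the Gaussian by `i ℓ` and `-σ ℓ`, which is why functions of `ℓ` times the
Gaussian form an invariant class. -/
theorem hasPartialsAt_gauss (σ : ℝ) (a q c : ℂ) (x : ℝ × ℝ) :
    HasPartialsAt (gauss σ a q c) (-linForm σ a q c x * gauss σ a q c x)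
      (Complex.I * σ * (a * x.1 - linForm σ a q c x) * gauss σ a q c x) x := by
  have h := ((((hasPartialsAt_fst x).mul (hasPartialsAt_fst x)).const_mul (-a / 2)).add
    (((hasPartialsAt_cplx σ x).mul (hasPartialsAt_cplx σ x)).const_mul q)).add
    ((hasPartialsAt_cplx σ x).const_mul c)
  refine (h.comp (Complex.hasDerivAt_exp _)).congr_partials ?_ ?_
  · simp only [linForm, gauss]; ring
  · simp only [linForm, gauss]; ring

theorem contDiff_cplx (σ : ℝ) : ContDiff ℝ ∞ (cplx σ) := by
  have h1 : ContDiff ℝ ∞ (fun x : ℝ × ℝ => (x.1 : ℂ)) :=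
    Complex.ofRealCLM.contDiff.comp contDiff_fst
  have h2 : ContDiff ℝ ∞ (fun x : ℝ × ℝ => (x.2 : ℂ)) :=
    Complex.ofRealCLM.contDiff.comp contDiff_snd
  unfold cplx
  fun_prop

theorem contDiff_linForm (σ : ℝ) (a q c : ℂ) : ContDiff ℝ ∞ (linForm σ a q c) := by
  have h1 : ContDiff ℝ ∞ (fun x : ℝ × ℝ => (x.1 : ℂ)) :=
    Complex.ofRealCLM.contDiff.comp contDiff_fst
  have h2 := contDiff_cplx σ
  unfold linForm
  fun_prop

theorem contDiff_gauss (σ : ℝ) (a q c : ℂ) : ContDiff ℝ ∞ (gauss σ a q c) := by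
  have h1 : ContDiff ℝ ∞ (fun x : ℝ × ℝ => (x.1 : ℂ)) :=
    Complex.ofRealCLM.contDiff.comp contDiff_fst
  have h2 := contDiff_cplx σ
  unfold gauss
  fun_prop

/-- The operator `D₁` on functions of the linear form times the Gaussian. -/
theorem D₁_comp_linForm_mul_gauss {g g' : ℂ → ℂ} {x : ℝ × ℝ}
    (hg : HasDerivAt g (g' (linForm σ a q c x)) (linForm σ a q c x)) :
    D₁ (fun y => g (linForm σ a q c y) * gauss σ a q c y) x =
      -Complex.I * ((a - 2 * q) * g' (linForm σ a q c x)
        - linForm σ a q c x * g (linForm σ a q c x)) * gauss σ a q c x := by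
  rw [(((hasPartialsAt_linForm σ a q c x).comp hg).mul (hasPartialsAt_gauss σ a q c x)).D₁_eq]
  ring

/-- The operator `D₂` on functions of the linear form times the Gaussian. -/
theorem D₂_comp_linForm_mul_gauss {b : ℂ} (hb : b = σ * a) {g g' : ℂ → ℂ}
    {x : ℝ × ℝ} (hg : HasDerivAt g (g' (linForm σ a q c x)) (linForm σ a q c x)) :
    D₂ b (fun y => g (linForm σ a q c y) * gauss σ a q c y) x =
      σ * (-2 * q * g' (linForm σ a q c x)
        - linForm σ a q c x * g (linForm σ a q c x)) * gauss σ a q c x := by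
  rw [(((hasPartialsAt_linForm σ a q c x).comp hg).mul (hasPartialsAt_gauss σ a q c x)).D₂_eq]
  subst hb
  linear_combination (-(σ : ℂ) * (-2 * q * g' (linForm σ a q c x)
    + (a * x.1 - linForm σ a q c x) * g (linForm σ a q c x)) * gauss σ a q c x) * Complex.I_sq

/-- The magnetic Laplacian on functions of the linear form times the Gaussian. -/
theorem expr_comp_linForm_mul_gauss (hσ : σ ^ 2 = 1) {b : ℂ} (hb : b = σ * a) {g g' g'' : ℂ → ℂ}
    (hg : ∀ x, HasDerivAt g (g' (linForm σ a q c x)) (linForm σ a q c x))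
    (hg' : ∀ x, HasDerivAt g' (g'' (linForm σ a q c x)) (linForm σ a q c x)) (x : ℝ × ℝ) :
    expr b (fun y => g (linForm σ a q c y) * gauss σ a q c y) x =
      (a * g (linForm σ a q c x) + 2 * a * linForm σ a q c x * g' (linForm σ a q c x)
        - a * (a - 4 * q) * g'' (linForm σ a q c x)) * gauss σ a q c x := by
  have h1 : D₁ (fun y => g (linForm σ a q c y) * gauss σ a q c y) =
      fun y => (fun ζ => -Complex.I * ((a - 2 * q) * g' ζ - ζ * g ζ)) (linForm σ a q c y)
        * gauss σ a q c y := funext fun y => D₁_comp_linForm_mul_gauss (hg y)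
  have h2 : D₂ b (fun y => g (linForm σ a q c y) * gauss σ a q c y) =
      fun y => (fun ζ => (σ : ℂ) * (-2 * q * g' ζ - ζ * g ζ)) (linForm σ a q c y)
        * gauss σ a q c y := funext fun y => D₂_comp_linForm_mul_gauss hb (hg y)
  have hp : HasDerivAt (fun ζ => ζ * g ζ) (g (linForm σ a q c x)
      + linForm σ a q c x * g' (linForm σ a q c x)) (linForm σ a q c x) := by
    simpa using (hasDerivAt_id (linForm σ a q c x)).fun_mul (hg x)
  have d1 : HasDerivAt (fun ζ => -Complex.I * ((a - 2 * q) * g' ζ - ζ * g ζ))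
      ((fun ζ => -Complex.I * ((a - 2 * q) * g'' ζ - (g ζ + ζ * g' ζ))) (linForm σ a q c x))
      (linForm σ a q c x) := (((hg' x).const_mul (a - 2 * q)).fun_sub hp).const_mul _
  have d2 : HasDerivAt (fun ζ => (σ : ℂ) * (-2 * q * g' ζ - ζ * g ζ))
      ((fun ζ => (σ : ℂ) * (-2 * q * g'' ζ - (g ζ + ζ * g' ζ))) (linForm σ a q c x))
      (linForm σ a q c x) := (((hg' x).const_mul (-2 * q)).fun_sub hp).const_mul _
  have hσ' : (σ : ℂ) ^ 2 = 1 := by exact_mod_cast hσ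
  simp only [expr]
  rw [h1, h2, D₁_comp_linForm_mul_gauss (g := fun ζ => -Complex.I * ((a - 2 * q) * g' ζ - ζ * g ζ))
      (g' := fun ζ => -Complex.I * ((a - 2 * q) * g'' ζ - (g ζ + ζ * g' ζ))) d1,
    D₂_comp_linForm_mul_gauss hb (g := fun ζ => (σ : ℂ) * (-2 * q * g' ζ - ζ * g ζ))
      (g' := fun ζ => (σ : ℂ) * (-2 * q * g'' ζ - (g ζ + ζ * g' ζ))) d2]
  generalize linForm σ a q c x = ζ
  linear_combination (((a - 2 * q) * ((a - 2 * q) * g'' ζ - (g ζ + ζ * g' ζ))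
    - ζ * ((a - 2 * q) * g' ζ - ζ * g ζ)) * gauss σ a q c x) * Complex.I_sq
    + ((-2 * q * (-2 * q * g'' ζ - (g ζ + ζ * g' ζ)) - ζ * (-2 * q * g' ζ - ζ * g ζ))
      * gauss σ a q c x) * hσ'

end GaussianFamily

/-! ### Square integrability against decaying Gaussians -/

section Decay

theorem memLp_gaussian {ρ : ℝ} (hρ : 0 < ρ) :
    MemLp (fun x : ℝ × ℝ => Real.exp (-ρ * (x.1 ^ 2 + x.2 ^ 2))) 2 volume := by
  rw [memLp_two_iff_integrable_sq (by fun_prop)]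
  have h : Integrable (fun t : ℝ => Real.exp (-(2 * ρ) * t ^ 2)) :=
    integrable_exp_neg_mul_sq (by positivity)
  refine (h.mul_prod h).congr (Filter.Eventually.of_forall fun x => ?_)
  simp only [← Real.exp_add, ← Real.exp_nat_mul]
  congr 1
  push_cast
  ring

/-- Completing the square absorbs the exponential growth at the cost of half of the rate `ρ`. -/
theorem memLp_of_le_gaussian {F : Type*} [NormedAddCommGroup F] {f : ℝ × ℝ → F} {ρ C K : ℝ}
    (hρ : 0 < ρ) (hf : AEStronglyMeasurable f volume)
    (h : ∀ x : ℝ × ℝ, ‖f x‖ ≤ C * Real.exp (K * (|x.1| + |x.2|) - ρ * (x.1 ^ 2 + x.2 ^ 2))) :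
    MemLp f 2 volume := by
  refine ((memLp_gaussian (half_pos hρ)).const_mul (|C| * Real.exp (K ^ 2 / ρ))).mono' hf
    (Filter.Eventually.of_forall fun x => (h x).trans ?_)
  have k : ∀ t : ℝ, K * |t| - ρ * t ^ 2 ≤ K ^ 2 / (2 * ρ) - ρ / 2 * t ^ 2 := fun t => by
    have h1 : 0 ≤ (K / ρ - |t|) ^ 2 * (ρ / 2) := by positivity
    have h2 : (K / ρ - |t|) ^ 2 * (ρ / 2) = K ^ 2 / (2 * ρ) - K * |t| + ρ / 2 * t ^ 2 := by
      rw [← sq_abs t]; field_simp; ring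
    linarith
  calc C * Real.exp (K * (|x.1| + |x.2|) - ρ * (x.1 ^ 2 + x.2 ^ 2))
      ≤ |C| * Real.exp (K ^ 2 / ρ + -(ρ / 2) * (x.1 ^ 2 + x.2 ^ 2)) := by
        gcongr
        · exact le_abs_self C
        · have h1 := k x.1
          have h2 := k x.2
          have h3 : K ^ 2 / ρ = K ^ 2 / (2 * ρ) + K ^ 2 / (2 * ρ) := by field_simp; norm_num
          rw [h3]; linarith
    _ = _ := by rw [Real.exp_add]; ring

variable {σ : ℝ} {a q : ℂ} {ρ : ℝ}

theorem norm_cplx_le (hσ : σ ^ 2 = 1) (x : ℝ × ℝ) : ‖cplx σ x‖ ≤ |x.1| + |x.2| := by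
  have h1 : |σ| = 1 := (pow_eq_one_iff_of_nonneg (abs_nonneg σ) two_ne_zero).1 (by rw [sq_abs, hσ])
  refine (norm_add_le _ _).trans ?_
  simp [h1]

theorem norm_gauss_le (hσ : σ ^ 2 = 1) (hQ : ∀ x : ℝ × ℝ,
    (-a / 2 * (x.1 * x.1) + q * (cplx σ x * cplx σ x)).re ≤ -ρ * (x.1 ^ 2 + x.2 ^ 2))
    (c : ℂ) (x : ℝ × ℝ) :
    ‖gauss σ a q c x‖ ≤ Real.exp (‖c‖ * (|x.1| + |x.2|) - ρ * (x.1 ^ 2 + x.2 ^ 2)) := by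
  rw [gauss, Complex.norm_exp]
  gcongr
  rw [Complex.add_re]
  have h2 : (c * cplx σ x).re ≤ ‖c‖ * (|x.1| + |x.2|) :=
    (Complex.re_le_norm _).trans (by rw [norm_mul]; gcongr; exact norm_cplx_le hσ x)
  linarith [hQ x]

theorem norm_linForm_le (hσ : σ ^ 2 = 1) (a q c : ℂ) (x : ℝ × ℝ) :
    ‖linForm σ a q c x‖ ≤ (‖a‖ + 2 * ‖q‖) * (|x.1| + |x.2|) + ‖c‖ := by
  have h1 : ‖linForm σ a q c x‖ ≤ ‖a * x.1‖ + ‖2 * q * cplx σ x‖ + ‖c‖ :=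
    (norm_sub_le _ _).trans (by gcongr; exact norm_sub_le _ _)
  have h2 : ‖a * x.1‖ ≤ ‖a‖ * (|x.1| + |x.2|) := by
    rw [norm_mul, Complex.norm_real, Real.norm_eq_abs]
    gcongr
    linarith [abs_nonneg x.2]
  have h3 : ‖2 * q * cplx σ x‖ ≤ 2 * ‖q‖ * (|x.1| + |x.2|) := by
    rw [norm_mul, norm_mul, RCLike.norm_ofNat]
    gcongr
    exact norm_cplx_le hσ x
  linarith

theorem memLp_mul_gauss (hσ : σ ^ 2 = 1) (hρ : 0 < ρ) (hQ : ∀ x : ℝ × ℝ,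
    (-a / 2 * (x.1 * x.1) + q * (cplx σ x * cplx σ x)).re ≤ -ρ * (x.1 ^ 2 + x.2 ^ 2))
    (c : ℂ) {u : ℝ × ℝ → ℂ} (hu : Continuous u) {C K : ℝ}
    (h : ∀ x : ℝ × ℝ, ‖u x‖ ≤ C * Real.exp (K * (|x.1| + |x.2|))) :
    MemLp (fun x => u x * gauss σ a q c x) 2 volume := by
  refine memLp_of_le_gaussian (C := C) (K := K + ‖c‖) hρ
    (hu.mul (contDiff_gauss σ a q c).continuous).aestronglyMeasurable fun x => ?_
  rw [norm_mul]
  calc ‖u x‖ * ‖gauss σ a q c x‖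
      ≤ (C * Real.exp (K * (|x.1| + |x.2|)))
        * Real.exp (‖c‖ * (|x.1| + |x.2|) - ρ * (x.1 ^ 2 + x.2 ^ 2)) :=
        mul_le_mul (h x) (norm_gauss_le hσ hQ c x) (norm_nonneg _) ((norm_nonneg _).trans (h x))
    _ = _ := by
      rw [mul_assoc, ← Real.exp_add]
      ring_nf

theorem exists_norm_eval_le_exp (p : Polynomial ℂ) :
    ∃ C : ℝ, 0 ≤ C ∧ ∀ ζ : ℂ, ‖p.eval ζ‖ ≤ C * Real.exp ‖ζ‖ := by
  induction p using Polynomial.induction_on' with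
  | add p r hp hr =>
    obtain ⟨C, hC, h⟩ := hp
    obtain ⟨D, hD, h'⟩ := hr
    refine ⟨C + D, by positivity, fun ζ => ?_⟩
    rw [Polynomial.eval_add, add_mul]
    exact (norm_add_le _ _).trans (add_le_add (h ζ) (h' ζ))
  | monomial n s =>
    refine ⟨‖s‖ * n.factorial, by positivity, fun ζ => ?_⟩
    rw [Polynomial.eval_monomial, norm_mul, norm_pow, mul_assoc]
    gcongr
    have := Real.pow_div_factorial_le_exp ‖ζ‖ (norm_nonneg _) n
    rwa [div_le_iff₀ (by positivity), mul_comm] at this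

theorem memLp_eval_mul_gauss (hσ : σ ^ 2 = 1) (hρ : 0 < ρ) (hQ : ∀ x : ℝ × ℝ,
    (-a / 2 * (x.1 * x.1) + q * (cplx σ x * cplx σ x)).re ≤ -ρ * (x.1 ^ 2 + x.2 ^ 2))
    (c : ℂ) (p : Polynomial ℂ) :
    MemLp (fun x => p.eval (linForm σ a q c x) * gauss σ a q c x) 2 volume := by
  obtain ⟨C, hC, h⟩ := exists_norm_eval_le_exp p
  refine memLp_mul_gauss hσ hρ hQ c (C := C * Real.exp ‖c‖) (K := ‖a‖ + 2 * ‖q‖)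
    (p.continuous.comp (contDiff_linForm σ a q c).continuous) fun x => (h _).trans ?_
  rw [mul_assoc, ← Real.exp_add]
  gcongr
  linarith [norm_linForm_le hσ a q c x]

end Decay

end MagneticLaplacian

namespace MagneticLaplacian

open Polynomial
open scoped InnerProductSpace

/-! ### Uniqueness for the Fourier transform of an integrable function -/

section FourierUniqueness

variable {E : Type*} [NormedAddCommGroup E] [NormedSpace ℝ E] [CompleteSpace E] [MeasurableSpace E]
  [BorelSpace E] [SecondCountableTopology E] {μ : Measure E} [SigmaFinite μ]

/-- The positive and negative parts of `g` are densities of two finite measures with the same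
characteristic function; the measures agree, hence so do the densities. -/
theorem ae_eq_zero_of_integral_exp_real {g : E → ℝ} (hg : Integrable g μ)
    (h : ∀ L : StrongDual ℝ E, ∫ x, (g x : ℂ) * Complex.exp (L x * Complex.I) ∂μ = 0) :
    g =ᵐ[μ] 0 := by
  have hchar : ∀ {u : E → ℝ}, Integrable u μ → (∀ x, 0 ≤ u x) → ∀ L : StrongDual ℝ E,
      charFunDual (μ.withDensity fun x => ENNReal.ofReal (u x)) L
        = ∫ x, (u x : ℂ) * Complex.exp (L x * Complex.I) ∂μ := by
    intro u hu hu0 L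
    rw [charFunDual_apply, integral_withDensity_eq_integral_toReal_smul₀
      hu.1.aemeasurable.ennreal_ofReal (Filter.Eventually.of_forall fun x => ENNReal.ofReal_lt_top)]
    refine integral_congr_ae (Filter.Eventually.of_forall fun x => ?_)
    simp [ENNReal.toReal_ofReal (hu0 x)]
  have hp : Integrable (fun x => max (g x) 0) μ := hg.pos_part
  have hn : Integrable (fun x => max (-g x) 0) μ := hg.neg_part
  have fin : ∀ {u : E → ℝ}, Integrable u μ →
      IsFiniteMeasure (μ.withDensity fun x => ENNReal.ofReal (u x)) := fun hu =>
    isFiniteMeasure_withDensity_ofReal hu.2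
  have := fin hp
  have := fin hn
  have hexp : ∀ {u : E → ℝ}, Integrable u μ → ∀ L : StrongDual ℝ E,
      Integrable (fun x => (u x : ℂ) * Complex.exp (L x * Complex.I)) μ := by
    intro u hu L
    refine hu.ofReal.mul_bdd (c := 1) ?_ (Filter.Eventually.of_forall fun x => ?_)
    · have : Continuous fun x : E => Complex.exp (L x * Complex.I) := by fun_prop
      exact this.aestronglyMeasurable
    · rw [Complex.norm_exp_ofReal_mul_I]
  have heq : (μ.withDensity fun x => ENNReal.ofReal (max (g x) 0))
      = μ.withDensity fun x => ENNReal.ofReal (max (-g x) 0) := by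
    refine Measure.ext_of_charFunDual (funext fun L => ?_)
    rw [hchar hp (fun x => le_max_right _ _), hchar hn (fun x => le_max_right _ _), ← sub_eq_zero,
      ← integral_sub (hexp hp L) (hexp hn L), ← h L]
    refine integral_congr_ae (Filter.Eventually.of_forall fun x => ?_)
    have e : g x = max (g x) 0 - max (-g x) 0 := (posPart_sub_negPart (g x)).symm
    simp only
    rw [← sub_mul]
    congr 1
    exact_mod_cast e.symm
  rw [withDensity_eq_iff_of_sigmaFinite hp.1.aemeasurable.ennreal_ofReal
    hn.1.aemeasurable.ennreal_ofReal] at heq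
  filter_upwards [heq] with x hx
  have h1 := congrArg ENNReal.toReal hx
  rw [ENNReal.toReal_ofReal (le_max_right _ _), ENNReal.toReal_ofReal (le_max_right _ _)] at h1
  have e : g x = max (g x) 0 - max (-g x) 0 := (posPart_sub_negPart (g x)).symm
  rw [e, h1, sub_self]
  rfl

/-- An integrable function whose Fourier transform vanishes is zero. -/
theorem ae_eq_zero_of_integral_exp {g : E → ℂ} (hg : Integrable g μ)
    (h : ∀ L : StrongDual ℝ E, ∫ x, g x * Complex.exp (L x * Complex.I) ∂μ = 0) :
    g =ᵐ[μ] 0 := by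
  have hexp : ∀ {u : E → ℂ}, Integrable u μ → ∀ L : StrongDual ℝ E,
      Integrable (fun x => u x * Complex.exp (L x * Complex.I)) μ := by
    intro u hu L
    refine hu.mul_bdd (c := 1) ?_ (Filter.Eventually.of_forall fun x => ?_)
    · have : Continuous fun x : E => Complex.exp (L x * Complex.I) := by fun_prop
      exact this.aestronglyMeasurable
    · rw [Complex.norm_exp_ofReal_mul_I]
  have hgc : Integrable (fun x => conj (g x)) μ :=
    (Complex.conjCLE.toContinuousLinearMap.integrable_comp hg)
  -- Conjugating the hypothesis at `-L` shows that `conj g` has vanishing transform too, which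
  -- separates real and imaginary parts.
  have hc : ∀ L : StrongDual ℝ E, ∫ x, conj (g x) * Complex.exp (L x * Complex.I) ∂μ = 0 := by
    intro L
    have h1 := h (-L)
    have h2 := congrArg (starRingEnd ℂ) h1
    rw [← integral_conj, map_zero] at h2
    rw [← h2]
    refine integral_congr_ae (Filter.Eventually.of_forall fun x => ?_)
    simp [← Complex.exp_conj]
  have hre : (fun x => (g x).re) =ᵐ[μ] 0 := by
    refine ae_eq_zero_of_integral_exp_real hg.re fun L => ?_
    have e : ∀ x, ((g x).re : ℂ) * Complex.exp (L x * Complex.I)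
        = (1 / 2) * (g x * Complex.exp (L x * Complex.I)
          + conj (g x) * Complex.exp (L x * Complex.I)) := fun x => by
      rw [Complex.re_eq_add_conj]; ring
    change ∫ x, ((g x).re : ℂ) * Complex.exp (L x * Complex.I) ∂μ = 0
    simp_rw [e]
    rw [integral_const_mul, integral_add (hexp hg L) (hexp hgc L), h, hc]
    simp
  have him : (fun x => (g x).im) =ᵐ[μ] 0 := by
    refine ae_eq_zero_of_integral_exp_real hg.im fun L => ?_
    have e : ∀ x, ((g x).im : ℂ) * Complex.exp (L x * Complex.I)
        = (1 / (2 * Complex.I)) * (g x * Complex.exp (L x * Complex.I)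
          - conj (g x) * Complex.exp (L x * Complex.I)) := fun x => by
      rw [Complex.im_eq_sub_conj]; ring
    change ∫ x, ((g x).im : ℂ) * Complex.exp (L x * Complex.I) ∂μ = 0
    simp_rw [e]
    rw [integral_const_mul, integral_sub (hexp hg L) (hexp hgc L), h, hc]
    simp
  filter_upwards [hre, him] with x h1 h2
  exact Complex.ext h1 h2

end FourierUniqueness

/-! ### Polynomial modes: totality, triangularity and Hermite eigenfunctions -/

section GaussianModes

variable {σ : ℝ} {a q : ℂ} {ρ : ℝ}

theorem gauss_ne_zero (c : ℂ) (x : ℝ × ℝ) : gauss σ a q c x ≠ 0 := Complex.exp_ne_zero _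

/-- The functions `ℓ ^ j exp (c w)` times a fixed decaying Gaussian are total in `L²`. -/
theorem eq_zero_of_integral_linForm_pow (hσ : σ ^ 2 = 1) (hρ : 0 < ρ) (ha : a ≠ 0)
    (hQ : ∀ x : ℝ × ℝ,
      (-a / 2 * (x.1 * x.1) + q * (cplx σ x * cplx σ x)).re ≤ -ρ * (x.1 ^ 2 + x.2 ^ 2))
    (ψ : L2)
    (h : ∀ (c : ℂ) (j : ℕ), ∫ x, ψ x * conj (linForm σ a q c x ^ j * gauss σ a q c x) = 0) :
    ψ = 0 := by
  -- The exponential series is summed under the integral; the Gaussian dominates `exp ‖μ ℓ‖`.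
  have hsum : ∀ c μ : ℂ,
      ∫ x, ψ x * conj (Complex.exp (μ * linForm σ a q c x) * gauss σ a q c x) = 0 := by
    intro c μ
    have hL := (contDiff_linForm σ a q c).continuous
    have hG := (contDiff_gauss σ a q c).continuous
    have key := hasSum_integral_of_dominated_convergence (μ := (volume : Measure (ℝ × ℝ)))
      (F := fun (j : ℕ) x => ψ x * conj ((μ * linForm σ a q c x) ^ j / (j.factorial : ℂ)
        * gauss σ a q c x))
      (f := fun x => ψ x * conj (Complex.exp (μ * linForm σ a q c x) * gauss σ a q c x))
      (fun j x => ‖ψ x‖ * (‖μ * linForm σ a q c x‖ ^ j / j.factorial * ‖gauss σ a q c x‖))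
      (fun j => ?_) (fun j => ?_) ?_ ?_ ?_
    · have hz : ∀ j : ℕ, ∫ x, ψ x * conj ((μ * linForm σ a q c x) ^ j / (j.factorial : ℂ)
          * gauss σ a q c x) = 0 := by
        intro j
        have e : ∀ x, ψ x * conj ((μ * linForm σ a q c x) ^ j / (j.factorial : ℂ)
            * gauss σ a q c x) = conj (μ ^ j / (j.factorial : ℂ))
              * (ψ x * conj (linForm σ a q c x ^ j * gauss σ a q c x)) := fun x => by
          simp only [map_mul, map_div₀, map_pow, mul_pow]; ring
        simp_rw [e]
        rw [integral_const_mul, h, mul_zero]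
      simp_rw [hz] at key
      exact key.unique hasSum_zero
    · refine (Lp.aestronglyMeasurable ψ).mul (Continuous.aestronglyMeasurable ?_)
      fun_prop
    · refine Filter.Eventually.of_forall fun x => ?_
      simp
    · refine Filter.Eventually.of_forall fun x => ?_
      exact (((Real.summable_pow_div_factorial _).mul_right _).mul_left _)
    · have e : ∀ x, ∑' j : ℕ, ‖ψ x‖ * (‖μ * linForm σ a q c x‖ ^ j / j.factorial
          * ‖gauss σ a q c x‖)
          = ‖ψ x‖ * ‖((Real.exp ‖μ * linForm σ a q c x‖ : ℝ) : ℂ) * gauss σ a q c x‖ := fun x => by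
        rw [tsum_mul_left, tsum_mul_right, norm_mul (Complex.ofReal _), Complex.norm_real,
          Real.norm_eq_abs, abs_of_pos (Real.exp_pos _), Real.exp_eq_exp_ℝ, NormedSpace.exp_eq_tsum_div]
      simp_rw [e]
      refine (Lp.memLp ψ).norm.integrable_mul (q := 2) (MemLp.norm ?_)
      refine memLp_mul_gauss hσ hρ hQ c (C := Real.exp (‖μ‖ * ‖c‖))
        (K := ‖μ‖ * (‖a‖ + 2 * ‖q‖)) (by fun_prop) fun x => ?_
      rw [Complex.norm_real, Real.norm_eq_abs, abs_of_pos (Real.exp_pos _), ← Real.exp_add, norm_mul]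
      gcongr
      calc ‖μ‖ * ‖linForm σ a q c x‖
          ≤ ‖μ‖ * ((‖a‖ + 2 * ‖q‖) * (|x.1| + |x.2|) + ‖c‖) := by
            gcongr; exact norm_linForm_le hσ a q c x
        _ = _ := by ring
    · refine Filter.Eventually.of_forall fun x => ?_
      have h1 : HasSum (fun j : ℕ => (μ * linForm σ a q c x) ^ j / (j.factorial : ℂ))
          (Complex.exp (μ * linForm σ a q c x)) := by
        rw [Complex.exp_eq_exp_ℂ]
        exact NormedSpace.expSeries_div_hasSum_exp _
      have h2 := (h1.mul_right (gauss σ a q c x))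
      exact (Complex.hasSum_conj'.2 (by simpa using h2)).mul_left (ψ x)
  have hG0 : MemLp (gauss σ a q 0) 2 volume := by
    simpa using memLp_mul_gauss hσ hρ hQ 0 (u := fun _ => 1) (C := 1) (K := 0) continuous_const
      (by simp)
  have hInt : Integrable (fun x => ψ x * conj (gauss σ a q 0 x)) :=
    (Lp.memLp ψ).integrable_mul hG0.star
  have hσ' : (σ : ℂ) ^ 2 = 1 := by exact_mod_cast hσ
  have hz := ae_eq_zero_of_integral_exp hInt fun L => by
    set t1 : ℝ := -L (1, 0) with ht1
    set t2 : ℝ := -L (0, 1) with ht2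
    -- Chosen so that `μ ℓ + c w + μ c = i (t₁ x₁ + t₂ x₂)`: the functions `exp (μ ℓ)` times the
    -- Gaussian with parameter `c` then include every character times the Gaussian with `c = 0`.
    set μ : ℂ := (Complex.I * t1 - σ * t2) / a with hμ
    set c : ℂ := 2 * q * μ + σ * t2 with hc
    have hLx : ∀ x : ℝ × ℝ, L x = -(t1 * x.1 + t2 * x.2) := fun x => by
      have : x = x.1 • ((1, 0) : ℝ × ℝ) + x.2 • ((0, 1) : ℝ × ℝ) := by ext <;> simp
      conv_lhs => rw [this]
      rw [map_add, map_smul, map_smul]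
      simp [ht1, ht2]; ring
    have haμ : a * μ = Complex.I * t1 - σ * t2 := by rw [hμ]; field_simp
    have e : ∀ x, ψ x * conj (gauss σ a q 0 x) * Complex.exp (L x * Complex.I)
        = conj (Complex.exp (μ * c)) * (ψ x * conj (Complex.exp (μ * linForm σ a q c x)
          * gauss σ a q c x)) := by
      intro x
      have e1 : Complex.exp (L x * Complex.I)
          = conj (Complex.exp (Complex.I * (t1 * x.1 + t2 * x.2))) := by
        rw [← Complex.exp_conj, hLx]
        simp; ring_nf
      have e2 : Complex.exp (μ * c) * (Complex.exp (μ * linForm σ a q c x) * gauss σ a q c x)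
          = gauss σ a q 0 x * Complex.exp (Complex.I * (t1 * x.1 + t2 * x.2)) := by
        simp only [gauss, ← Complex.exp_add]
        congr 1
        simp only [linForm, cplx, hc]
        linear_combination x.1 * haμ + Complex.I * t2 * x.2 * hσ'
      rw [e1, mul_assoc, ← map_mul, ← e2, map_mul]
      ring
    simp_rw [e]
    rw [integral_const_mul, hsum, mul_zero]
  rw [Lp.eq_zero_iff_ae_eq_zero]
  filter_upwards [hz] with x hx
  have : conj (gauss σ a q 0 x) ≠ 0 := by simpa using gauss_ne_zero 0 x
  exact (mul_eq_zero.1 hx).resolve_right this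

/-- The action of the magnetic Laplacian on polynomials in the linear form. -/
def landauPoly (a q : ℂ) (p : ℂ[X]) : ℂ[X] :=
  C a * p + C (2 * a) * X * derivative p - C (a * (a - 4 * q)) * derivative (derivative p)

/-- A polynomial in the linear form, times the Gaussian. -/
def mode (σ : ℝ) (a q c : ℂ) (p : ℂ[X]) (x : ℝ × ℝ) : ℂ :=
  p.eval (linForm σ a q c x) * gauss σ a q c x

theorem contDiff_mode (c : ℂ) (p : ℂ[X]) : ContDiff ℝ ∞ (mode σ a q c p) :=
  ((p.differentiable.contDiff.restrict_scalars ℝ).comp (contDiff_linForm σ a q c)).mul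
    (contDiff_gauss σ a q c)

theorem D₁_mode (c : ℂ) (p : ℂ[X]) : D₁ (mode σ a q c p) =
    mode σ a q c (C (-Complex.I) * (C (a - 2 * q) * derivative p - X * p)) := by
  funext x
  refine (D₁_comp_linForm_mul_gauss (g := fun ζ => p.eval ζ)
    (g' := fun ζ => (derivative p).eval ζ) (p.hasDerivAt _)).trans ?_
  simp [mode]

theorem D₂_mode {b : ℂ} (hb : b = σ * a) (c : ℂ) (p : ℂ[X]) : D₂ b (mode σ a q c p) =
    mode σ a q c (C (σ : ℂ) * (C (-2 * q) * derivative p - X * p)) := by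
  funext x
  refine (D₂_comp_linForm_mul_gauss hb (g := fun ζ => p.eval ζ)
    (g' := fun ζ => (derivative p).eval ζ) (p.hasDerivAt _)).trans ?_
  simp [mode]

theorem expr_mode (hσ : σ ^ 2 = 1) {b : ℂ} (hb : b = σ * a) (c : ℂ) (p : ℂ[X]) :
    expr b (mode σ a q c p) = mode σ a q c (landauPoly a q p) := by
  funext x
  refine (expr_comp_linForm_mul_gauss hσ hb (g := fun ζ => p.eval ζ)
    (g' := fun ζ => (derivative p).eval ζ) (g'' := fun ζ => (derivative (derivative p)).eval ζ)
    (fun y => p.hasDerivAt _) (fun y => (derivative p).hasDerivAt _) x).trans ?_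
  simp [mode, landauPoly]

theorem memLp_mode (hσ : σ ^ 2 = 1) (hρ : 0 < ρ) (hQ : ∀ x : ℝ × ℝ,
    (-a / 2 * (x.1 * x.1) + q * (cplx σ x * cplx σ x)).re ≤ -ρ * (x.1 ^ 2 + x.2 ^ 2))
    (c : ℂ) (p : ℂ[X]) : MemLp (mode σ a q c p) 2 volume :=
  memLp_eval_mul_gauss hσ hρ hQ c p

/-- The modes may serve as test functions, since `D₁`, `D₂` and `expr` turn them into modes, all in
`L²`. The parameter `a` belongs here to the adjoint field `conj b`. -/
theorem IsWeakAction.integral_mode (hσ : σ ^ 2 = 1) (hρ : 0 < ρ) (hQ : ∀ x : ℝ × ℝ,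
    (-a / 2 * (x.1 * x.1) + q * (cplx σ x * cplx σ x)).re ≤ -ρ * (x.1 ^ 2 + x.2 ^ 2))
    {b : ℂ} (hb : conj b = σ * a) {ψ f : L2} (h : IsWeakAction b ψ f) (c : ℂ) (p : ℂ[X]) :
    ∫ x, ψ x * conj (mode σ a q c (landauPoly a q p) x)
      = ∫ x, f x * conj (mode σ a q c p x) := by
  have m := memLp_mode hσ hρ hQ c
  have := h.integral_eq (contDiff_mode (σ := σ) (a := a) (q := q) c p) (m p)
    (by rw [D₁_mode]; exact m _) (by rw [D₂_mode hb]; exact m _)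
    (by rw [expr_mode hσ hb]; exact m _)
  rwa [expr_mode hσ hb] at this

/-- Triangularity, with the Landau levels on the diagonal. The truncated subtractions are harmless:
the coefficient `j (j - 1)` vanishes for `j < 2`. -/
theorem landauPoly_X_pow (a q : ℂ) (j : ℕ) : landauPoly a q (X ^ j) =
    C ((2 * j + 1) * a) * X ^ j - C (a * (a - 4 * q) * (j * (j - 1 : ℕ))) * X ^ (j - 2) := by
  rcases j with _ | j
  · simp [landauPoly]
  · have h2 : j + 1 - 2 = j - 1 := by omega
    simp only [landauPoly, derivative_X_pow, derivative_C_mul, Nat.add_sub_cancel, h2]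
    simp only [map_mul, map_add, map_sub, map_natCast, map_ofNat, map_one, Nat.cast_add,
      Nat.cast_one]
    ring

/-- Away from the Landau levels there are no eigenfunctions. -/
theorem eq_zero_of_isWeakAction_of_gaussian (hσ : σ ^ 2 = 1) (hρ : 0 < ρ) (ha : a ≠ 0)
    (hQ : ∀ x : ℝ × ℝ,
      (-a / 2 * (x.1 * x.1) + q * (cplx σ x * cplx σ x)).re ≤ -ρ * (x.1 ^ 2 + x.2 ^ 2))
    {b z : ℂ} (hb : conj b = σ * a) (hz : ∀ k : ℕ, conj z ≠ (2 * k + 1) * a) {ψ : L2}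
    (h : IsWeakAction b ψ (z • ψ)) : ψ = 0 := by
  refine eq_zero_of_integral_linForm_pow hσ hρ ha hQ ψ fun c j => ?_
  have hm : ∀ p : ℂ[X], Integrable fun x => ψ x * conj (mode σ a q c p x) := fun p =>
    (Lp.memLp ψ).integrable_mul (memLp_mode hσ hρ hQ c p).star
  suffices H : ∫ x, ψ x * conj (mode σ a q c (X ^ j) x) = 0 by
    simpa [mode] using H
  -- The equation tested against the `j`-th mode involves only the moments `j` and `j - 2`. The
  -- latter vanishes by induction, and the coefficient of the former is non-zero because `conj z` is
  -- not on the diagonal.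
  induction j using Nat.strong_induction_on with
  | _ j ih =>
    have h1 := h.integral_mode hσ hρ hQ hb c (X ^ j)
    have h2 : ∫ x, (z • ψ : L2) x * conj (mode σ a q c (X ^ j) x)
        = z * ∫ x, ψ x * conj (mode σ a q c (X ^ j) x) := by
      rw [← integral_const_mul]
      refine integral_congr_ae ?_
      filter_upwards [Lp.coeFn_smul z ψ] with x hx
      rw [hx, Pi.smul_apply, smul_eq_mul, mul_assoc]
    have h3 : ∫ x, ψ x * conj (mode σ a q c (landauPoly a q (X ^ j)) x)
        = conj ((2 * j + 1) * a) * (∫ x, ψ x * conj (mode σ a q c (X ^ j) x))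
          - conj (a * (a - 4 * q) * (j * (j - 1 : ℕ)))
            * ∫ x, ψ x * conj (mode σ a q c (X ^ (j - 2)) x) := by
      rw [← integral_const_mul, ← integral_const_mul, ← integral_sub
        ((hm _).const_mul _) ((hm _).const_mul _)]
      refine integral_congr_ae (Filter.Eventually.of_forall fun x => ?_)
      simp only [landauPoly_X_pow, mode, eval_sub, eval_mul, eval_C, sub_mul, map_sub, map_mul]
      ring
    have h4 : conj (a * (a - 4 * q) * (j * (j - 1 : ℕ)))
        * ∫ x, ψ x * conj (mode σ a q c (X ^ (j - 2)) x) = 0 := by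
      rcases Nat.lt_or_ge j 2 with hj | hj
      · have : (j : ℂ) * ((j - 1 : ℕ) : ℂ) = 0 := by interval_cases j <;> simp
        rw [this]; simp
      · rw [ih (j - 2) (by omega), mul_zero]
    rw [h3, h4, sub_zero, h2, ← sub_eq_zero, ← sub_mul, mul_eq_zero] at h1
    refine h1.resolve_left fun h0 => hz j ?_
    rw [sub_eq_zero] at h0
    rw [← h0, Complex.conj_conj]

/-- Hermite polynomials, suitably scaled. -/
def hermitePoly (τ : ℂ) : ℕ → ℂ[X]
  | 0 => 1
  | k + 1 => X * hermitePoly τ k - C (τ / 2) * derivative (hermitePoly τ k)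

/-- The Appell property; with the recursion it yields the Hermite equation. -/
theorem derivative_hermitePoly (τ : ℂ) (k : ℕ) :
    derivative (hermitePoly τ (k + 1)) = C ((k : ℂ) + 1) * hermitePoly τ k := by
  induction k with
  | zero => simp [hermitePoly]
  | succ k ih =>
    rw [hermitePoly, derivative_sub, derivative_mul, derivative_X, derivative_C_mul, ih,
      derivative_C_mul]
    conv_rhs => rw [hermitePoly]
    simp only [hermitePoly, map_add, map_one, map_natCast, Nat.cast_add, Nat.cast_one]
    ring

theorem hermitePoly_natDegree_monic (τ : ℂ) (k : ℕ) :
    (hermitePoly τ k).Monic ∧ (hermitePoly τ k).natDegree = k := by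
  induction k with
  | zero => simp [hermitePoly]
  | succ k ih =>
    have hX : (X * hermitePoly τ k).Monic := monic_X.mul ih.1
    have hd : (X * hermitePoly τ k).natDegree = k + 1 := by
      rw [natDegree_X_mul ih.1.ne_zero, ih.2]
    have hlt : (C (τ / 2) * derivative (hermitePoly τ k)).degree < (X * hermitePoly τ k).degree := by
      rw [degree_eq_natDegree hX.ne_zero, hd]
      refine (degree_le_natDegree).trans_lt ?_
      have h1 := natDegree_C_mul_le (τ / 2) (derivative (hermitePoly τ k))
      have h2 := natDegree_derivative_le (hermitePoly τ k)
      rw [ih.2] at h2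
      exact_mod_cast (by omega : _ < k + 1)
    exact ⟨hX.sub_of_left hlt, (natDegree_eq_of_degree_eq
      (degree_sub_eq_left_of_degree_lt hlt)).trans hd⟩

/-- The scale `τ = a - 4 q` is the one for which the recursion cancels the second-order term of
`landauPoly`. -/
theorem landauPoly_hermitePoly (a q : ℂ) (k : ℕ) :
    landauPoly a q (hermitePoly (a - 4 * q) k) =
      C ((2 * k + 1) * a) * hermitePoly (a - 4 * q) k := by
  rcases k with _ | k
  · simp [landauPoly, hermitePoly]
  · simp only [landauPoly, derivative_hermitePoly, derivative_C_mul]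
    have e : C (a * (a - 4 * q)) = C (2 * a) * C ((a - 4 * q) / 2) := by
      rw [← C_mul]; congr 1; ring
    rw [e]
    have e2 : C ((2 * ((k + 1 : ℕ) : ℂ) + 1) * a) = C a + C (2 * a) * C ((k : ℂ) + 1) := by
      rw [← C_mul, ← C_add]; congr 1; push_cast; ring
    rw [e2]
    conv_rhs => rw [hermitePoly]
    conv_lhs => rw [hermitePoly]
    ring

end GaussianModes

end MagneticLaplacian

namespace MagneticLaplacian

open Polynomial
open scoped InnerProductSpace

/-! ### From functions to classes in `L²` -/

section ContinuousRepresentatives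

theorem eq_zero_of_toLp_eq_zero {f : ℝ × ℝ → ℂ} (hf : Continuous f) (h : MemLp f 2 volume)
    (h0 : h.toLp f = 0) : f = 0 := by
  have h1 := h.coeFn_toLp
  rw [h0] at h1
  have h2 : f =ᵐ[volume] 0 := h1.symm.trans (Lp.coeFn_zero _ _ _)
  exact (hf.ae_eq_iff_eq volume continuous_const).1 h2

/-- A linear combination of the `f i` is continuous, so it vanishes identically once it vanishes
almost everywhere. -/
theorem linearIndependent_toLp {ι : Type*} {f : ι → ℝ × ℝ → ℂ} (hf : ∀ i, Continuous (f i))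
    (h : ∀ i, MemLp (f i) 2 (volume : Measure (ℝ × ℝ))) (hli : LinearIndependent ℂ f) :
    LinearIndependent ℂ fun i => (h i).toLp (f i) := by
  rw [linearIndependent_iff'] at hli ⊢
  intro s g hg
  refine hli s g ?_
  have hc : Continuous (∑ i ∈ s, g i • f i) :=
    Finset.sum_induction _ _ (fun _ _ => Continuous.add) continuous_zero
      fun i _ => (hf i).const_smul (g i)
  have hm : MemLp (∑ i ∈ s, g i • f i) 2 (volume : Measure (ℝ × ℝ)) :=
    memLp_finsetSum' s fun i _ => (h i).const_smul (g i)
  refine eq_zero_of_toLp_eq_zero hc hm ?_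
  rw [← hg, Lp.ext_iff]
  refine hm.coeFn_toLp.trans ?_
  refine Filter.EventuallyEq.trans ?_ (Lp.coeFn_finsetSum _ _).symm
  have : ∀ i ∈ s, (g i • f i) =ᵐ[volume] ⇑(g i • (h i).toLp (f i)) := fun i _ => by
    filter_upwards [Lp.coeFn_smul (g i) ((h i).toLp (f i)), (h i).coeFn_toLp] with x h1 h2
    rw [h1, Pi.smul_apply, Pi.smul_apply, h2]
  exact eventuallyEq_sum this

end ContinuousRepresentatives

/-! ### Field with non-zero real and imaginary parts -/

section DecayingGaussian

variable {σ : ℝ} {a : ℂ}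

/-- For non-real `a` in the right half plane there is a decaying Gaussian for which the linear form
has real rank one. -/
theorem exists_decaying_gauss (hσ : σ ^ 2 = 1) (h1 : 0 < a.re) (h2 : a.im ≠ 0) :
    ∃ (κ : ℝ) (q : ℂ) (ρ : ℝ), 0 < ρ ∧ q ≠ 0 ∧ a = 2 * q * (1 + κ * Complex.I) ∧
      ∀ x : ℝ × ℝ, (-a / 2 * (x.1 * x.1) + q * (cplx σ x * cplx σ x)).re
        ≤ -ρ * (x.1 ^ 2 + x.2 ^ 2) := by
  set r := a.re with hr
  set s := a.im with hs
  -- For `q = a / (2 (1 + i κ))`, the quadratic form `-D` times the real part of the exponent has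
  -- trace `r (1 + κ²)` and determinant `s (κ r - s) (1 + κ²)`. It is positive definite when `s (κ r
  -- - s) > 0`; `κ = 2 s / r` is a simple choice, and it needs `s ≠ 0`.
  set κ : ℝ := 2 * s / r with hκ
  set D : ℝ := 2 * (1 + κ ^ 2) with hD
  have hDpos : 0 < D := by positivity
  have hne : (1 + (κ : ℂ) * Complex.I) ≠ 0 := by
    intro h
    have := congrArg Complex.re h
    simp at this
  have ha : a = r + s * Complex.I := (Complex.re_add_im a).symm
  have ha0 : a ≠ 0 := fun h => by rw [hr, h] at h1; simp at h1
  have hqe : a / (2 * (1 + κ * Complex.I))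
      = ((r + κ * s) / D : ℝ) + ((s - κ * r) / D : ℝ) * Complex.I := by
    have hDc : (D : ℂ) ≠ 0 := by exact_mod_cast hDpos.ne'
    rw [div_eq_iff (by simpa using hne)]
    push_cast
    field_simp
    rw [ha, hD]
    push_cast
    linear_combination (-2 * (s - κ * r) * κ : ℂ) * Complex.I_sq
  refine ⟨κ, a / (2 * (1 + κ * Complex.I)), s ^ 2 / r / D, by positivity,
    div_ne_zero ha0 (by simpa using hne), by field_simp, fun x => ?_⟩
  obtain ⟨x1, x2⟩ := x
  have hre : (-a / 2 * (x1 * x1) + a / (2 * (1 + κ * Complex.I))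
      * (cplx σ (x1, x2) * cplx σ (x1, x2))).re
      = -r / 2 * x1 ^ 2 + (r + κ * s) / D * (x1 ^ 2 - σ ^ 2 * x2 ^ 2)
        - (s - κ * r) / D * (2 * σ * x1 * x2) := by
    rw [hqe, ha]
    simp [cplx, -Complex.ofReal_div]
    ring
  rw [hre, hσ]
  have hκr : κ * r = 2 * s := by rw [hκ]; field_simp
  have hκs : κ * s = 2 * (s ^ 2 / r) := by rw [hκ]; field_simp
  have hκ2 : κ ^ 2 * r = 4 * (s ^ 2 / r) := by rw [hκ]; field_simp; norm_num
  -- The difference is the perfect square `(s σ x₁ - r x₂)² / r`.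
  have hb : 2 * (s * (σ * x1) * x2) ≤ s ^ 2 / r * x1 ^ 2 + r * x2 ^ 2 := by
    have e : s ^ 2 / r * x1 ^ 2 + r * x2 ^ 2 - 2 * (s * (σ * x1) * x2)
        = (s * (σ * x1) - r * x2) ^ 2 / r := by
      field_simp
      linear_combination (-s ^ 2 * x1 ^ 2) * hσ
    have : 0 ≤ (s * (σ * x1) - r * x2) ^ 2 / r := by positivity
    linarith
  have e : -(s ^ 2 / r / D) * (x1 ^ 2 + x2 ^ 2) - (-r / 2 * x1 ^ 2
      + (r + κ * s) / D * (x1 ^ 2 - 1 * x2 ^ 2) - (s - κ * r) / D * (2 * σ * x1 * x2))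
      = (s ^ 2 / r * x1 ^ 2 + r * x2 ^ 2 + s ^ 2 / r * x2 ^ 2 - 2 * (s * (σ * x1) * x2)) / D := by
    rw [eq_div_iff hDpos.ne', hκr, hκs]
    have hDr : r * D = 2 * r + 8 * (s ^ 2 / r) := by rw [hD]; linear_combination 2 * hκ2
    field_simp
    field_simp at hDr
    linear_combination x1 ^ 2 * hDr
  have hpos : 0 ≤ (s ^ 2 / r * x1 ^ 2 + r * x2 ^ 2 + s ^ 2 / r * x2 ^ 2
      - 2 * (s * (σ * x1) * x2)) / D := by
    have : 0 ≤ s ^ 2 / r * x2 ^ 2 := by positivity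
    exact div_nonneg (by linarith) hDpos.le
  linarith

variable {q : ℂ} {κ : ℝ}

/-- Since `a - 2 q = 2 q κ i`, the form is a fixed complex multiple of a real linear form, up to the
constant `c`. So it is invariant along a direction and omits whole half planes, where complex powers
are holomorphic. -/
theorem linForm_eq (haq : a = 2 * q * (1 + κ * Complex.I)) (c : ℂ) (x : ℝ × ℝ) :
    linForm σ a q c x = 2 * q * Complex.I * (κ * x.1 - σ * x.2) - c := by
  simp only [linForm, cplx, haq]
  ring

/-- After division by the Gaussian with `c = 0`, the modes become eigenvectors of one translation,
with eigenvalues of distinct moduli `e ^ n`. -/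
theorem linearIndependent_mode (hσ : σ ^ 2 = 1) (hq : q ≠ 0)
    (haq : a = 2 * q * (1 + κ * Complex.I)) {p : ℂ[X]} (hp : p ≠ 0) :
    LinearIndependent ℂ fun n : ℕ => mode σ a q n p := by
  have hσ' : (σ : ℂ) ^ 2 = 1 := by exact_mod_cast hσ
  -- The direction that leaves the linear form unchanged; it increases `w` by `1 + i κ`.
  let v : ℝ × ℝ := (1, σ * κ)
  let S : Module.End ℂ (ℝ × ℝ → ℂ) :=
    { toFun := fun F x => gauss σ a q 0 x / gauss σ a q 0 (x + v) * F (x + v)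
      map_add' := fun F G => by funext x; simp [mul_add]
      map_smul' := fun s F => by funext x; simp; ring }
  refine Module.End.eigenvectors_linearIndependent' S
    (fun n : ℕ => Complex.exp (n * (1 + κ * Complex.I))) ?_ _ fun n => ?_
  · intro m n hmn
    have h := congrArg norm hmn
    simp only [Complex.norm_exp] at h
    simpa using h
  · have hg : ∀ y, gauss σ a q n y = gauss σ a q 0 y * Complex.exp (n * cplx σ y) := fun y => by
      simp only [gauss, ← Complex.exp_add]
      congr 1
      ring
    refine Module.End.hasEigenvector_iff.2 ⟨Module.End.mem_eigenspace_iff.2 (funext fun x => ?_),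
      fun h0 => ?_⟩
    · have hl : linForm σ a q n (x + v) = linForm σ a q n x := by
        rw [linForm_eq haq, linForm_eq haq]
        simp only [v, Prod.fst_add, Prod.snd_add]
        push_cast
        linear_combination (-2 * q * Complex.I * κ) * hσ'
      have hw : cplx σ (x + v) = cplx σ x + (1 + κ * Complex.I) := by
        simp only [cplx, v, Prod.fst_add, Prod.snd_add]
        push_cast
        linear_combination (Complex.I * κ) * hσ'
      have hne := gauss_ne_zero (σ := σ) (a := a) (q := q) 0 (x + v)
      change gauss σ a q 0 x / gauss σ a q 0 (x + v) * mode σ a q n p (x + v)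
        = Complex.exp (n * (1 + κ * Complex.I)) * mode σ a q n p x
      simp only [mode, hl, hg, hw, mul_add, Complex.exp_add]
      field_simp
    · have hroots : ∀ t : ℝ, p.IsRoot (linForm σ a q n (0, t)) := fun t => by
        have := congrFun h0 (0, t)
        exact (mul_eq_zero.1 this).resolve_right (gauss_ne_zero _ _)
      have hinj : Function.Injective fun t : ℝ => linForm σ a q n (0, t) := by
        intro t t' h
        have hσ0 : (σ : ℂ) ≠ 0 := fun h => by simp [h] at hσ'
        simp only [linForm, cplx] at h
        have h2 : 2 * q * Complex.I * σ * ((t : ℂ) - t') = 0 := by linear_combination -h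
        have h3 : (t : ℂ) - t' = 0 := (mul_eq_zero.1 h2).resolve_left (by simp [hq, hσ0])
        exact_mod_cast sub_eq_zero.1 h3
      exact hp (p.eq_zero_of_infinite_isRoot
        ((Set.infinite_range_of_injective hinj).mono (by rintro _ ⟨t, rfl⟩; exact hroots t)))

/-- Approximate eigenfunctions for every complex number, for non-real field in the right
half plane. -/
theorem exists_pseudomode_of_re (hσ : σ ^ 2 = 1) (h1 : 0 < a.re) (h2 : a.im ≠ 0) {b : ℂ}
    (hb : b = σ * a) (z : ℂ) {ε : ℝ} (hε : 0 < ε) :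
    ∃ ψ g : L2, IsWeakAction b ψ (g + z • ψ) ∧ ψ ≠ 0 ∧ ‖g‖ ≤ ε * ‖ψ‖ := by
  obtain ⟨κ, q, ρ, hρ, hq, haq, hQ⟩ := exists_decaying_gauss hσ h1 h2
  have ha0 : a ≠ 0 := fun h => by rw [h] at h1; simp at h1
  -- The exponent for which `ζ ^ ν` solves the first-order part of the equation, as `z = (2 ν + 1)
  -- a`; the second derivative leaves the error `A / y²`.
  set ν : ℂ := (z / a - 1) / 2 with hν
  set A : ℂ := a * (a - 4 * q) * (ν * (ν - 1) / (4 * q ^ 2)) with hA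
  obtain ⟨M, hM1, hM⟩ : ∃ M : ℝ, 1 ≤ M ∧ ‖A‖ ≤ ε * M ^ 2 := by
    refine ⟨max 1 (‖A‖ / ε), le_max_left _ _, ?_⟩
    have l1 := le_max_left 1 (‖A‖ / ε)
    have l2 := le_max_right 1 (‖A‖ / ε)
    rw [div_le_iff₀ hε] at l2
    calc ‖A‖ ≤ ε * max 1 (‖A‖ / ε) := by rwa [mul_comm]
      _ ≤ ε * max 1 (‖A‖ / ε) ^ 2 := by gcongr; exact le_self_pow₀ l1 two_ne_zero
  have hM0 : 0 < M := by linarith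
  -- This shift gives `y` the constant real part `M`: the principal power of `y` is smooth, and `‖y‖
  -- ≥ M` makes the relative error at most `‖A‖ / M² ≤ ε`.
  set c : ℂ := 2 * q * M with hc
  let y : ℝ × ℝ → ℂ := fun x => -linForm σ a q c x / (2 * q)
  have hy : ∀ x, y x = (M : ℂ) - ((κ * x.1 - σ * x.2 : ℝ) : ℂ) * Complex.I := fun x => by
    simp only [y]
    rw [linForm_eq haq, hc]
    push_cast
    field_simp
    ring
  have hyre : ∀ x, (y x).re = M := fun x => by rw [hy]; simp
  have hyslit : ∀ x, y x ∈ Complex.slitPlane := fun x => Or.inl (by rw [hyre]; exact hM0)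
  have hy0 : ∀ x, y x ≠ 0 := fun x => Complex.slitPlane_ne_zero (hyslit x)
  have hyM : ∀ x, M ≤ ‖y x‖ := fun x => by
    rw [← hyre x]; exact Complex.re_le_norm _
  have hyd : ∀ ζ : ℂ, HasDerivAt (fun ζ : ℂ => -ζ / (2 * q)) (-1 / (2 * q)) ζ := fun ζ =>
    ((hasDerivAt_id ζ).neg).div_const _
  have hpow : ∀ (s : ℂ) (x : ℝ × ℝ), HasDerivAt (fun ζ : ℂ => (-ζ / (2 * q)) ^ s)
      (s * (-linForm σ a q c x / (2 * q)) ^ (s - 1) * (-1 / (2 * q))) (linForm σ a q c x) :=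
    fun s x => (hyd _).cpow_const (hyslit x)
  let g : ℂ → ℂ := fun ζ => (-ζ / (2 * q)) ^ ν
  let g' : ℂ → ℂ := fun ζ => ν * (-ζ / (2 * q)) ^ (ν - 1) * (-1 / (2 * q))
  let g'' : ℂ → ℂ := fun ζ =>
    ν * ((ν - 1) * (-ζ / (2 * q)) ^ (ν - 1 - 1) * (-1 / (2 * q))) * (-1 / (2 * q))
  let F : ℝ × ℝ → ℂ := fun x => g (linForm σ a q c x) * gauss σ a q c x
  have hexpr : ∀ x, expr b F x = z * F x - A / y x ^ 2 * F x := by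
    intro x
    refine (expr_comp_linForm_mul_gauss hσ hb (g := g) (g' := g') (g'' := g'')
      (fun x => hpow ν x) (fun x => ((hpow (ν - 1) x).const_mul ν).mul_const _) x).trans ?_
    have hl : linForm σ a q c x = -(2 * q) * y x := by simp only [y]; field_simp
    have e1 : (y x) ^ (ν - 1) = y x ^ ν / y x := by
      rw [Complex.cpow_sub _ _ (hy0 x), Complex.cpow_one]
    have e2 : (y x) ^ (ν - 1 - 1) = y x ^ ν / y x ^ 2 := by
      rw [Complex.cpow_sub _ _ (hy0 x), Complex.cpow_one, e1]
      field_simp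
    have E0 : g (linForm σ a q c x) = y x ^ ν := rfl
    have E1 : g' (linForm σ a q c x) = ν * (y x) ^ (ν - 1) * (-1 / (2 * q)) := rfl
    have E2 : g'' (linForm σ a q c x)
      = ν * ((ν - 1) * (y x) ^ (ν - 1 - 1) * (-1 / (2 * q))) * (-1 / (2 * q)) := rfl
    have hz : z = (2 * ν + 1) * a := by rw [hν]; field_simp; ring
    simp only [F]
    rw [E1, E2, E0, e1, e2, hA, hz, hl]
    have := hy0 x
    field_simp
    ring
  have hysm : ContDiff ℝ ∞ y := by
    have := contDiff_linForm σ a q c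
    simp only [y]
    fun_prop
  have hgsm : ContDiff ℝ ∞ fun x => g (linForm σ a q c x) := by
    have e : (fun x => g (linForm σ a q c x)) = fun x => Complex.exp (Complex.log (y x) * ν) :=
      funext fun x => Complex.cpow_def_of_ne_zero (hy0 x) ν
    rw [e]
    refine (ContDiff.mul ?_ contDiff_const).cexp
    rw [contDiff_iff_contDiffAt]
    exact fun x => ((Complex.contDiffAt_log (hyslit x)).restrict_scalars ℝ).comp x hysm.contDiffAt
  have hFsm : ContDiff ℝ ∞ F := hgsm.mul (contDiff_gauss σ a q c)
  -- The power grows at most exponentially, since the argument is bounded by `π` and `log ‖y‖ ≤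
  -- ‖y‖`; the Gaussian absorbs this.
  have hbound : ∀ x, ‖y x ^ ν‖ ≤ Real.exp (Real.pi * |ν.im| + |ν.re| * M)
      * Real.exp (|ν.re| * (|κ| + 1) * (|x.1| + |x.2|)) := by
    intro x
    have n0 : 0 < ‖y x‖ := norm_pos_iff.2 (hy0 x)
    rw [Complex.norm_cpow_of_ne_zero (hy0 x), Real.rpow_def_of_pos n0, ← Real.exp_sub,
      ← Real.exp_add]
    gcongr
    have hlog0 : 0 ≤ Real.log ‖y x‖ := Real.log_nonneg (hM1.trans (hyM x))
    have hlog : Real.log ‖y x‖ ≤ ‖y x‖ := (Real.log_le_sub_one_of_pos n0).trans (by linarith)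
    have hσ1 : |σ| = 1 := (pow_eq_one_iff_of_nonneg (abs_nonneg σ) two_ne_zero).1
      (by rw [sq_abs, hσ])
    have hyle : ‖y x‖ ≤ M + (|κ| + 1) * (|x.1| + |x.2|) := by
      rw [hy]
      refine (norm_sub_le _ _).trans ?_
      rw [norm_mul, Complex.norm_I, mul_one, Complex.norm_real, Complex.norm_real,
        Real.norm_eq_abs, Real.norm_eq_abs, abs_of_pos hM0]
      gcongr
      calc |κ * x.1 - σ * x.2| ≤ |κ * x.1| + |σ * x.2| := abs_sub _ _
        _ = |κ| * |x.1| + |x.2| := by rw [abs_mul, abs_mul, hσ1, one_mul]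
        _ ≤ _ := by nlinarith [abs_nonneg κ, abs_nonneg x.1, abs_nonneg x.2,
            mul_nonneg (abs_nonneg κ) (abs_nonneg x.2)]
    have i1 : Real.log ‖y x‖ * ν.re ≤ |ν.re| * (M + (|κ| + 1) * (|x.1| + |x.2|)) := by
      calc Real.log ‖y x‖ * ν.re ≤ Real.log ‖y x‖ * |ν.re| := by gcongr; exact le_abs_self _
        _ ≤ (M + (|κ| + 1) * (|x.1| + |x.2|)) * |ν.re| := by gcongr; exact hlog.trans hyle
        _ = _ := by ring
    have i2 : -((y x).arg * ν.im) ≤ Real.pi * |ν.im| := by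
      calc -((y x).arg * ν.im) ≤ |(y x).arg * ν.im| := neg_le_abs _
        _ = |(y x).arg| * |ν.im| := abs_mul _ _
        _ ≤ _ := by gcongr; exact Complex.abs_arg_le_pi _
    linarith
  have hFm : MemLp F 2 volume :=
    memLp_mul_gauss hσ hρ hQ c (u := fun x => g (linForm σ a q c x)) hgsm.continuous hbound
  have herr : ∀ x, ‖expr b F x - z * F x‖ ≤ ε * ‖F x‖ := by
    intro x
    rw [hexpr, sub_sub_cancel_left, norm_neg, norm_mul, norm_div, norm_pow]
    gcongr
    have := hyM x
    have hy1 := norm_pos_iff.2 (hy0 x)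
    rw [div_le_iff₀ (by positivity)]
    exact hM.trans (by gcongr)
  have herrm : MemLp (fun x => expr b F x - z * F x) 2 volume :=
    MemLp.of_le_mul hFm (((smooth_expr b hFsm).continuous.sub
      (continuous_const.mul hFsm.continuous)).aestronglyMeasurable) (c := ε)
      (Filter.Eventually.of_forall herr)
  have hem : MemLp (expr b F) 2 volume := by
    have := herrm.add (hFm.const_mul z)
    refine this.ae_eq (Filter.Eventually.of_forall fun x => ?_)
    simp
  refine ⟨hFm.toLp F, herrm.toLp _, ?_, fun h0 => ?_, ?_⟩
  · convert isWeakAction_toLp b hFsm hFm hem using 1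
    rw [← MemLp.toLp_const_smul, ← MemLp.toLp_add]
    refine MemLp.toLp_congr _ _ (Filter.Eventually.of_forall fun x => ?_)
    simp
  · have := congrFun (eq_zero_of_toLp_eq_zero hFsm.continuous hFm h0) 0
    refine mul_ne_zero ?_ (gauss_ne_zero c 0) this
    change y 0 ^ ν ≠ 0
    rw [Complex.cpow_ne_zero_iff]
    exact Or.inl (hy0 0)
  · refine Lp.norm_le_mul_norm_of_ae_le_mul ?_
    filter_upwards [hFm.coeFn_toLp, herrm.coeFn_toLp] with x e1 e2
    rw [e1, e2]
    exact herr x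

/-- The test Gaussian is built for `conj a`, because the weak equation is tested with the adjoint
expression. -/
theorem eq_zero_of_isWeakAction_of_re (hσ : σ ^ 2 = 1) (h1 : 0 < a.re) (h2 : a.im ≠ 0) {b z : ℂ}
    (hb : b = σ * a) (hz : ∀ k : ℕ, z ≠ (2 * k + 1) * a) {ψ : L2}
    (h : IsWeakAction b ψ (z • ψ)) : ψ = 0 := by
  obtain ⟨κ, q, ρ, hρ, hq, haq, hQ⟩ := exists_decaying_gauss (a := conj a) hσ (by simpa) (by simpa)
  refine eq_zero_of_isWeakAction_of_gaussian hσ hρ (fun h0 => ?_) hQ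
    (by rw [hb]; simp) (fun k hk => hz k ?_) h
  · have : a = 0 := by simpa using h0
    rw [this] at h1; simp at h1
  · have := congrArg (starRingEnd ℂ) hk
    simpa [map_ofNat (starRingEnd ℂ) 2] using this

theorem not_finiteNullity_of_re (hσ : σ ^ 2 = 1) (h1 : 0 < a.re) (h2 : a.im ≠ 0) {b : ℂ}
    (hb : b = σ * a) (k : ℕ) :
    ¬ UnboundedOp.FiniteNullity (maximalOp b) ((2 * k + 1) * a) := by
  obtain ⟨κ, q, ρ, hρ, hq, haq, hQ⟩ := exists_decaying_gauss hσ h1 h2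
  set p := hermitePoly (a - 4 * q) k
  have hp : p ≠ 0 := (hermitePoly_natDegree_monic (a - 4 * q) k).1.ne_zero
  have hm := fun n : ℕ => memLp_mode hσ hρ hQ n p
  refine not_finiteNullity (linearIndependent_toLp
    (fun n : ℕ => (contDiff_mode (σ := σ) (a := a) (q := q) n p).continuous) hm
    (linearIndependent_mode hσ hq haq hp)) fun n => ?_
  have he : expr b (mode σ a q n p) = fun x => ((2 * k + 1) * a) * mode σ a q n p x := by
    rw [expr_mode hσ hb, landauPoly_hermitePoly]
    funext x
    simp only [mode, eval_mul, eval_C]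
    ring
  have hem : MemLp (expr b (mode σ a q n p)) 2 volume := by
    rw [he]; exact (hm n).const_mul _
  convert isWeakAction_toLp b (contDiff_mode _ _) (hm n) hem using 1
  rw [← MemLp.toLp_const_smul]
  refine MemLp.toLp_congr _ _ (Filter.Eventually.of_forall fun x => ?_)
  rw [he]
  rfl

/-- The Hermite modes for `conj a` solve the adjoint equation at the conjugate level, so they are
orthogonal to the range. -/
theorem not_finiteDeficiency_of_re (hσ : σ ^ 2 = 1) (h1 : 0 < a.re) (h2 : a.im ≠ 0) {b : ℂ}
    (hb : b = σ * a) (k : ℕ) :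
    ¬ UnboundedOp.FiniteDeficiency (maximalOp b) ((2 * k + 1) * a) := by
  obtain ⟨κ, q, ρ, hρ, hq, haq, hQ⟩ := exists_decaying_gauss (a := conj a) hσ (by simpa) (by simpa)
  set p := hermitePoly (conj a - 4 * q) k
  have hp : p ≠ 0 := (hermitePoly_natDegree_monic (conj a - 4 * q) k).1.ne_zero
  have hm := fun n : ℕ => memLp_mode hσ hρ hQ n p
  refine not_finiteDeficiency (linearIndependent_toLp
    (fun n : ℕ => (contDiff_mode (σ := σ) (a := conj a) (q := q) n p).continuous) hm
    (linearIndependent_mode hσ hq haq hp)) fun n ψ f hw => ?_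
  have key := hw.integral_mode hσ hρ hQ (by rw [hb]; simp) n p
  rw [inner_sub_right, inner_smul_right, inner_toLp_left, inner_toLp_left, ← key, sub_eq_zero,
    ← integral_const_mul]
  refine integral_congr_ae (Filter.Eventually.of_forall fun x => ?_)
  simp only [p, landauPoly_hermitePoly]
  simp [mode, map_ofNat (starRingEnd ℂ) 2]
  ring

end DecayingGaussian

end MagneticLaplacian

namespace MagneticLaplacian

open scoped InnerProductSpace

/-! ### The weight governing the approximate eigenfunctions for imaginary field -/

section Weight

/-- The weight `x₁ ^ (2 r) |1 + δ w| ^ (-2 N)` on the half plane `1 ≤ x₁`. -/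
def weight (r : ℝ) (N : ℕ) (δ : ℝ) (x : ℝ × ℝ) : ℝ :=
  if 1 ≤ x.1 then x.1 ^ (2 * r) * (((1 + δ * x.1) ^ 2 + (δ * x.2) ^ 2) ^ N)⁻¹ else 0

variable {r δ : ℝ} {N : ℕ}

theorem weight_nonneg (r : ℝ) (N : ℕ) (δ : ℝ) (x : ℝ × ℝ) : 0 ≤ weight r N δ x := by
  unfold weight
  split_ifs with h
  · have : 0 ≤ x.1 := by linarith
    positivity
  · exact le_rfl

theorem measurable_weight (r : ℝ) (N : ℕ) (δ : ℝ) : Measurable (weight r N δ) := by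
  unfold weight
  refine Measurable.ite (measurableSet_le measurable_const measurable_fst) ?_ measurable_const
  fun_prop

theorem inv_pow_le_of_pos (hδ : 0 < δ) (n : ℕ) {x : ℝ × ℝ} (hx : 1 ≤ x.1) :
    (((1 + δ * x.1) ^ 2 + (δ * x.2) ^ 2) ^ (n + 1))⁻¹
      ≤ (((δ * x.1) ^ 2) ^ n)⁻¹ * (1 + (δ * x.2) ^ 2)⁻¹ := by
  have h0 : 0 < x.1 := by linarith
  have h1 : 0 < δ * x.1 := by positivity
  rw [← mul_inv, pow_succ]
  gcongr
  · nlinarith [sq_nonneg (δ * x.2)]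
  · nlinarith

theorem integrable_inv_one_add_mul_sq (hδ : 0 < δ) :
    Integrable fun t : ℝ => (1 + (δ * t) ^ 2)⁻¹ :=
  integrable_inv_one_add_sq.comp_mul_left' hδ.ne'

theorem integral_inv_one_add_mul_sq (hδ : 0 < δ) :
    ∫ t : ℝ, (1 + (δ * t) ^ 2)⁻¹ = Real.pi / δ := by
  rw [Measure.integral_comp_mul_left (fun t : ℝ => (1 + t ^ 2)⁻¹) δ, integral_univ_inv_one_add_sq,
    abs_of_pos (inv_pos.2 hδ), smul_eq_mul]
  field_simp

/-- One factor of `|1 + δ w|⁻²` provides integrability in `x₂`; the other `N - 1` give decay `x₁ ^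
(2 r - 2 (N - 1))`, integrable at infinity exactly because `N > r + 3 / 2`. -/
theorem integrable_weight (hδ : 0 < δ) (hN : r + 3 / 2 < N) (hN1 : 1 ≤ N) :
    Integrable (weight r N δ) := by
  obtain ⟨n, rfl⟩ : ∃ n, N = n + 1 := ⟨N - 1, by omega⟩
  have i1 : Integrable (Set.indicator (Set.Ioi (1 / 2 : ℝ)) fun t : ℝ => t ^ (2 * r - 2 * n)) := by
    rw [integrable_indicator_iff measurableSet_Ioi]
    refine integrableOn_Ioi_rpow_of_lt ?_ (by norm_num)
    push_cast at hN
    linarith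
  have i2 := (i1.const_mul ((δ ^ 2) ^ n)⁻¹).mul_prod (integrable_inv_one_add_mul_sq hδ)
  refine i2.mono' (measurable_weight _ _ _).aestronglyMeasurable
    (Filter.Eventually.of_forall fun x => ?_)
  rw [Real.norm_eq_abs, abs_of_nonneg (weight_nonneg _ _ _ _)]
  unfold weight
  split_ifs with h
  · have h0 : 0 < x.1 := by linarith
    rw [Set.indicator_of_mem (show x.1 ∈ Set.Ioi (1 / 2 : ℝ) by simp; linarith)]
    calc x.1 ^ (2 * r) * (((1 + δ * x.1) ^ 2 + (δ * x.2) ^ 2) ^ (n + 1))⁻¹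
        ≤ x.1 ^ (2 * r) * ((((δ * x.1) ^ 2) ^ n)⁻¹ * (1 + (δ * x.2) ^ 2)⁻¹) := by
          gcongr
          exact inv_pow_le_of_pos hδ n h
      _ = _ := by
          rw [Real.rpow_sub h0, mul_pow, mul_pow]
          have : x.1 ^ (2 * (n : ℝ)) = (x.1 ^ 2) ^ n := by
            rw [← pow_mul]; exact_mod_cast Real.rpow_natCast x.1 (2 * n)
          rw [this]
          have : (0 : ℝ) < 1 + (δ * x.2) ^ 2 := by positivity
          field_simp
  · have : 0 ≤ Set.indicator (Set.Ioi (1 / 2 : ℝ)) (fun t : ℝ => t ^ (2 * r - 2 * n)) x.1 :=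
      Set.indicator_nonneg (fun t ht => Real.rpow_nonneg (by
        have : (1 / 2 : ℝ) < t := ht
        linarith) _) _
    positivity

theorem integrable_inv_sq_mul_weight (hδ : 0 < δ) (hN : r + 3 / 2 < N) (hN1 : 1 ≤ N) :
    Integrable fun x : ℝ × ℝ => x.1⁻¹ ^ 2 * weight r N δ x := by
  refine (integrable_weight hδ hN hN1).mono' (((measurable_fst.inv.pow_const 2).mul
    (measurable_weight r N δ)).aestronglyMeasurable) (Filter.Eventually.of_forall fun x => ?_)
  have hw0 := weight_nonneg r N δ x
  rw [Real.norm_eq_abs, abs_of_nonneg (by positivity)]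
  by_cases h1 : 1 ≤ x.1
  · exact mul_le_of_le_one_left hw0 (pow_le_one₀ (inv_nonneg.2 (by linarith))
      (inv_le_one_of_one_le₀ h1))
  · have : weight r N δ x = 0 := if_neg h1
    rw [this, mul_zero]

/-- As `δ → 0` the weight escapes to infinity. -/
theorem exists_weight_integral_le (hr : -1 / 2 ≤ r) (hN : r + 3 / 2 < N) (hN1 : 1 ≤ N) {ε : ℝ}
    (hε : 0 < ε) : ∃ δ : ℝ, 0 < δ ∧ δ ≤ 1 ∧
      0 < ∫ x, Set.indicator {x : ℝ × ℝ | 2 ≤ x.1} (weight r N δ) x ∧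
      ∫ x, x.1⁻¹ ^ 2 * weight r N δ x
        ≤ ε * ∫ x, Set.indicator {x : ℝ × ℝ | 2 ≤ x.1} (weight r N δ) x := by
  -- Beyond `x₁ = M` the factor `x₁⁻²` is at most `ε / 2`; only the strip `1 ≤ x₁ ≤ M` needs `δ` to
  -- be small.
  obtain ⟨M, hM2, hM⟩ : ∃ M : ℝ, 2 ≤ M ∧ M⁻¹ ^ 2 ≤ ε / 2 := by
    refine ⟨max 2 (2 / ε), le_max_left _ _, ?_⟩
    set M := max 2 (2 / ε)
    have l1 : 2 ≤ M := le_max_left _ _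
    have l2 : 2 / ε ≤ M := le_max_right _ _
    have h1 : M⁻¹ ≤ ε / 2 := by
      rw [inv_le_comm₀ (by linarith) (by positivity)]
      simpa using l2
    have h2 : M⁻¹ ≤ 1 := inv_le_one_of_one_le₀ (by linarith)
    have h3 : 0 ≤ M⁻¹ := by positivity
    calc M⁻¹ ^ 2 ≤ M⁻¹ := by nlinarith
      _ ≤ _ := h1
  let k : ℝ → ℝ := Set.indicator (Set.Icc 1 M) fun t => t ^ (2 * r)
  have hk : Integrable k := by
    rw [integrable_indicator_iff measurableSet_Icc]
    refine ContinuousOn.integrableOn_Icc fun t ht => ?_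
    exact (Real.continuousAt_rpow_const t _ (Or.inl (by linarith [ht.1]))).continuousWithinAt
  have hk0 : ∀ t, 0 ≤ k t := fun t => Set.indicator_nonneg (fun t ht =>
    Real.rpow_nonneg (by linarith [ht.1]) _) t
  set K : ℝ := (∫ t, k t) * Real.pi with hK
  have hK0 : 0 ≤ K := mul_nonneg (integral_nonneg hk0) Real.pi_pos.le
  -- With `δ = e ^ (-Y) / 2`, the integral of `1 / t` over `[2, 1 / δ]` is `Y`. The strip
  -- contributes at most `K / δ` and the full mass is at least `Y / (δ 5 ^ N)`, so this `Y` makes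
  -- the former at most `ε / 2` times the latter.
  set Y : ℝ := 2 * K * 5 ^ N / ε + 1 with hY
  have hY0 : 0 < Y := by positivity
  set δ : ℝ := Real.exp (-Y) / 2 with hδ
  have hδ0 : 0 < δ := by positivity
  have hδ1 : δ ≤ 1 / 2 := by
    have : Real.exp (-Y) ≤ 1 := Real.exp_le_one_iff.2 (by linarith)
    rw [hδ]; linarith
  have hinv : 2 ≤ 1 / δ := by rw [le_div_iff₀ hδ0]; linarith
  have hlog : Real.log (1 / δ / 2) = Y := by
    have : 1 / δ / 2 = Real.exp Y := by rw [hδ, Real.exp_neg]; field_simp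
    rw [this, Real.log_exp]
  have hW := integrable_weight hδ0 hN hN1
  have hms : MeasurableSet {x : ℝ × ℝ | 2 ≤ x.1} := measurableSet_le measurable_const measurable_fst
  have hWi : Integrable (Set.indicator {x : ℝ × ℝ | 2 ≤ x.1} (weight r N δ)) := hW.indicator hms
  have hWi0 : ∀ x, 0 ≤ Set.indicator {x : ℝ × ℝ | 2 ≤ x.1} (weight r N δ) x := fun x =>
    Set.indicator_nonneg (fun x _ => weight_nonneg _ _ _ _) x
  -- On the box `2 < x₁ ≤ 1 / δ`, `0 < x₂ ≤ 1 / δ` one has `|1 + δ w|² ≤ 5`, and `x₁ ^ (2 r) ≥ x₁⁻¹`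
  -- since `r ≥ -1 / 2`. The critical exponent still yields a logarithm.
  have hlow : Y / δ / 5 ^ N ≤ ∫ x, Set.indicator {x : ℝ × ℝ | 2 ≤ x.1} (weight r N δ) x := by
    let f1 : ℝ → ℝ := Set.indicator (Set.Ioc 2 (1 / δ)) fun t => t⁻¹
    let f2 : ℝ → ℝ := Set.indicator (Set.Ioc 0 (1 / δ)) fun _ => 1
    have g1 : ∫ t, f1 t = Y := by
      rw [integral_indicator measurableSet_Ioc, ← intervalIntegral.integral_of_le hinv,
        integral_inv_of_pos (by norm_num) (by positivity), hlog]
    have g2 : ∫ t, f2 t = 1 / δ := by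
      rw [integral_indicator measurableSet_Ioc]
      simp [hδ0.le]
    have i1 : Integrable f1 := by
      rw [integrable_indicator_iff measurableSet_Ioc]
      refine (ContinuousOn.integrableOn_Icc fun t ht => ?_).mono_set Set.Ioc_subset_Icc_self
      exact (continuousAt_inv₀ (by linarith [ht.1])).continuousWithinAt
    have i2 : Integrable f2 := by
      rw [integrable_indicator_iff measurableSet_Ioc]
      simp
    have e : ∫ x : ℝ × ℝ, (5 ^ N)⁻¹ * (f1 x.1 * f2 x.2) = Y / δ / 5 ^ N := by
      rw [integral_const_mul]
      have := integral_prod_mul (μ := (volume : Measure ℝ)) (ν := (volume : Measure ℝ)) f1 f2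
      rw [Measure.volume_eq_prod, this, g1, g2]
      field_simp
    rw [← e]
    refine integral_mono ((i1.mul_prod i2).const_mul _) hWi fun x => ?_
    by_cases hx : x.1 ∈ Set.Ioc 2 (1 / δ) ∧ x.2 ∈ Set.Ioc 0 (1 / δ)
    · obtain ⟨⟨a1, a2⟩, b1, b2⟩ := hx
      have h1x : 1 ≤ x.1 := by linarith
      simp only [f1, f2]
      rw [Set.indicator_of_mem (show x.1 ∈ Set.Ioc 2 (1 / δ) from ⟨a1, a2⟩),
        Set.indicator_of_mem (show x.2 ∈ Set.Ioc 0 (1 / δ) from ⟨b1, b2⟩),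
        Set.indicator_of_mem (show x ∈ {x : ℝ × ℝ | 2 ≤ x.1} from a1.le), weight, if_pos h1x,
        mul_one, mul_comm]
      rw [le_div_iff₀ hδ0] at a2 b2
      have c1 : 0 < δ * x.1 := by positivity
      have c2 : 0 < δ * x.2 := by positivity
      gcongr
      · rw [← Real.rpow_neg_one]
        exact Real.rpow_le_rpow_of_exponent_le h1x (by linarith)
      · nlinarith
    · have : f1 x.1 * f2 x.2 = 0 := by
        rw [not_and_or] at hx
        rcases hx with h | h
        · simp only [f1]; rw [Set.indicator_of_notMem h, zero_mul]
        · simp only [f2]; rw [Set.indicator_of_notMem h, mul_zero]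
      simp only [this, mul_zero]
      exact hWi0 x
  refine ⟨δ, hδ0, by linarith, lt_of_lt_of_le (by positivity) hlow, ?_⟩
  have hInt : Integrable fun x : ℝ × ℝ => k x.1 * (1 + (δ * x.2) ^ 2)⁻¹ :=
    hk.mul_prod (integrable_inv_one_add_mul_sq hδ0)
  have hup : ∫ x : ℝ × ℝ, k x.1 * (1 + (δ * x.2) ^ 2)⁻¹ = K / δ := by
    have := integral_prod_mul (μ := (volume : Measure ℝ)) (ν := (volume : Measure ℝ)) k
      (fun t => (1 + (δ * t) ^ 2)⁻¹)
    rw [Measure.volume_eq_prod, this, integral_inv_one_add_mul_sq hδ0, hK]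
    ring
  have hptw : ∀ x : ℝ × ℝ, x.1⁻¹ ^ 2 * weight r N δ x ≤ k x.1 * (1 + (δ * x.2) ^ 2)⁻¹
      + M⁻¹ ^ 2 * Set.indicator {x : ℝ × ℝ | 2 ≤ x.1} (weight r N δ) x := by
    intro x
    have p2 : 0 ≤ M⁻¹ ^ 2 * Set.indicator {x : ℝ × ℝ | 2 ≤ x.1} (weight r N δ) x :=
      mul_nonneg (by positivity) (hWi0 x)
    have p1 : 0 ≤ k x.1 * (1 + (δ * x.2) ^ 2)⁻¹ := mul_nonneg (hk0 _) (by positivity)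
    by_cases h1 : 1 ≤ x.1
    · have h0 : 0 < x.1 := by linarith
      by_cases hxM : x.1 ≤ M
      · have hkx : k x.1 = x.1 ^ (2 * r) := Set.indicator_of_mem (show x.1 ∈ Set.Icc 1 M from
          ⟨h1, hxM⟩) _
        have hw : weight r N δ x ≤ k x.1 * (1 + (δ * x.2) ^ 2)⁻¹ := by
          rw [hkx, weight, if_pos h1]
          gcongr
          calc 1 + (δ * x.2) ^ 2 ≤ (1 + δ * x.1) ^ 2 + (δ * x.2) ^ 2 := by
                have : 0 < δ * x.1 := by positivity
                nlinarith
            _ ≤ _ := le_self_pow₀ (by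
                have : 0 < δ * x.1 := by positivity
                nlinarith [sq_nonneg (δ * x.2)]) (by omega)
        have h3 : x.1⁻¹ ^ 2 ≤ 1 := pow_le_one₀ (by positivity) (inv_le_one_of_one_le₀ h1)
        have := mul_le_of_le_one_left (weight_nonneg r N δ x) h3
        linarith
      · have hxM' : M ≤ x.1 := (not_le.1 hxM).le
        rw [Set.indicator_of_mem (show x ∈ {x : ℝ × ℝ | 2 ≤ x.1} from hM2.trans hxM')]
        have : x.1⁻¹ ^ 2 * weight r N δ x ≤ M⁻¹ ^ 2 * weight r N δ x := by
          have := weight_nonneg r N δ x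
          gcongr
        linarith
    · have : weight r N δ x = 0 := if_neg h1
      rw [this, mul_zero]
      linarith
  have hW2 := integrable_inv_sq_mul_weight hδ0 hN hN1
  have hfin := integral_mono hW2 (hInt.add (hWi.const_mul (M⁻¹ ^ 2))) hptw
  simp only [Pi.add_apply] at hfin
  rw [integral_add hInt (hWi.const_mul (M⁻¹ ^ 2)), integral_const_mul, hup] at hfin
  set S := ∫ x, Set.indicator {x : ℝ × ℝ | 2 ≤ x.1} (weight r N δ) x
  have hS0 : 0 ≤ S := integral_nonneg hWi0
  have h1 : K / δ ≤ ε / 2 * S := by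
    refine le_trans ?_ (mul_le_mul_of_nonneg_left hlow (by positivity))
    rw [hY]
    have : ε / 2 * ((2 * K * 5 ^ N / ε + 1) / δ / 5 ^ N) = K / δ + ε / 2 / δ / 5 ^ N := by
      field_simp
    rw [this]
    have : 0 ≤ ε / 2 / δ / 5 ^ N := by positivity
    linarith
  have h2 : M⁻¹ ^ 2 * S ≤ ε / 2 * S := by gcongr
  linarith

end Weight

end MagneticLaplacian

namespace MagneticLaplacian

open scoped InnerProductSpace

/-! ### The operator on separated functions -/

section LocalPartials

variable {F F₁ F₂ : ℝ × ℝ → ℂ} {F₁₁ F₁₂ F₂₁ F₂₂ : ℂ} {x : ℝ × ℝ}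

theorem HasPartialsAt.congr_of_eventuallyEq {G : ℝ × ℝ → ℂ} {G₁ G₂ : ℂ}
    (h : HasPartialsAt F G₁ G₂ x) (hG : G =ᶠ[𝓝 x] F) : HasPartialsAt G G₁ G₂ x :=
  HasFDerivAt.congr_of_eventuallyEq h hG

/-- Only the first-order formula must hold near `x`; this permits functions given by a holomorphic
expression on an open set only. -/
theorem expr_eq_of_partials (b : ℂ) (h : ∀ᶠ y in 𝓝 x, HasPartialsAt F (F₁ y) (F₂ y) y)
    (h1 : HasPartialsAt F₁ F₁₁ F₁₂ x) (h2 : HasPartialsAt F₂ F₂₁ F₂₂ x) :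
    expr b F x = -F₁₁ - F₂₂ + 2 * Complex.I * b * x.1 * F₂ x + b ^ 2 * x.1 ^ 2 * F x := by
  have e1 : D₁ F =ᶠ[𝓝 x] fun y => -Complex.I * F₁ y := h.mono fun y hy => hy.D₁_eq
  have e2 : D₂ b F =ᶠ[𝓝 x] fun y => -Complex.I * F₂ y + -b * (y.1 * F y) := h.mono fun y hy => by
    rw [hy.D₂_eq]; ring
  have p1 := ((h1.const_mul (-Complex.I)).congr_of_eventuallyEq e1).D₁_eq
  have p2 := (((h2.const_mul (-Complex.I)).add
    (((hasPartialsAt_fst x).mul h.self_of_nhds).const_mul (-b))).congr_of_eventuallyEq e2).D₂_eq b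
  rw [expr, p1, p2, h.self_of_nhds.D₂_eq]
  linear_combination (F₁₁ + F₂₂) * Complex.I_sq

theorem expr_eq_zero_of_eventuallyEq_zero (b : ℂ) (h : F =ᶠ[𝓝 x] 0) : expr b F x = 0 := by
  have h' : ∀ᶠ y in 𝓝 x, HasPartialsAt F 0 0 y :=
    h.eventually_nhds.mono fun y hy => (hasPartialsAt_const 0 y).congr_of_eventuallyEq hy
  rw [expr_eq_of_partials b (F₁ := fun _ => 0) (F₂ := fun _ => 0) h' (hasPartialsAt_const 0 x)
    (hasPartialsAt_const 0 x), h.self_of_nhds]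
  simp

theorem hasPartialsAt_comp_fst {u : ℝ → ℂ} {u' : ℂ} (hu : HasDerivAt u u' x.1) :
    HasPartialsAt (fun y => u y.1) u' 0 x := by
  have h := hu.hasFDerivAt.comp x (hasFDerivAt_fst (𝕜 := ℝ) (p := x))
  refine HasFDerivAt.congr_fderiv (f := fun y : ℝ × ℝ => u y.1) h ?_
  ext <;> simp

/-- Since `v` is holomorphic in `w`, both `Δ` and `∂₁ + iσ ∂₂` annihilate it. The only coupling
between the factors is the cross term `-2 u' v'`. -/
theorem expr_separated {σ : ℝ} (hσ : σ ^ 2 = 1) {a b : ℂ} (hb : b = σ * a) {u u' u'' : ℝ → ℂ}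
    {v v' v'' : ℂ → ℂ} (hu : ∀ t, HasDerivAt u (u' t) t) (hu' : ∀ t, HasDerivAt u' (u'' t) t)
    (hv : ∀ᶠ y in 𝓝 x, HasDerivAt v (v' (cplx σ y)) (cplx σ y))
    (hv' : HasDerivAt v' (v'' (cplx σ x)) (cplx σ x)) :
    expr b (fun y => u y.1 * v (cplx σ y) * gauss σ a 0 0 y) x =
      (a * u x.1 * v (cplx σ x) + 2 * a * x.1 * u' x.1 * v (cplx σ x)
        - u'' x.1 * v (cplx σ x) - 2 * u' x.1 * v' (cplx σ x)) * gauss σ a 0 0 x := by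
  have hσ' : (σ : ℂ) ^ 2 = 1 := by exact_mod_cast hσ
  have hg : ∀ y, HasPartialsAt (gauss σ a 0 0) (-a * y.1 * gauss σ a 0 0 y) 0 y := fun y =>
    (hasPartialsAt_gauss σ a 0 0 y).congr_partials (by simp [linForm]) (by simp [linForm])
  have hv0 := hv.self_of_nhds
  have H : ∀ᶠ y in 𝓝 x, HasPartialsAt (fun y => u y.1 * v (cplx σ y) * gauss σ a 0 0 y)
      ((u' y.1 * v (cplx σ y) + u y.1 * v' (cplx σ y) + (-a * y.1) * (u y.1 * v (cplx σ y)))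
        * gauss σ a 0 0 y)
      (Complex.I * σ * (u y.1 * v' (cplx σ y) * gauss σ a 0 0 y)) y := by
    refine hv.mono fun y hy => ?_
    refine (((hasPartialsAt_comp_fst (hu y.1)).mul
      ((hasPartialsAt_cplx σ y).comp hy)).mul (hg y)).congr_partials ?_ ?_ <;> ring
  have pu := hasPartialsAt_comp_fst (hu x.1)
  have pu' := hasPartialsAt_comp_fst (hu' x.1)
  have pv := (hasPartialsAt_cplx σ x).comp hv0
  have pv' := (hasPartialsAt_cplx σ x).comp hv'
  have p1 := (((pu'.mul pv).add (pu.mul pv')).add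
    (((hasPartialsAt_fst x).const_mul (-a)).mul (pu.mul pv))).mul (hg x)
  have p2 := ((pu.mul pv').mul (hg x)).const_mul (Complex.I * σ)
  rw [expr_eq_of_partials b H p1 p2, hb]
  have hI := Complex.I_sq
  generalize u x.1 = U at *
  generalize v (cplx σ x) = V at *
  generalize u' x.1 = U' at *
  generalize v' (cplx σ x) = V' at *
  generalize v'' (cplx σ x) = V'' at *
  generalize gauss σ a 0 0 x = G at *
  linear_combination (-U * V'' * G + 2 * a * x.1 * U * V' * G) * (σ ^ 2 * hI)
    + (a ^ 2 * x.1 ^ 2 * U * V * G + U * V'' * G - 2 * a * x.1 * U * V' * G) * hσ'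

end LocalPartials

theorem norm_toLp_sq {X : Type*} [MeasurableSpace X] {μ : Measure X} {f : X → ℂ}
    (hf : MemLp f 2 μ) : ‖hf.toLp f‖ ^ 2 = ∫ x, ‖f x‖ ^ 2 ∂μ := by
  rw [← inner_self_eq_norm_sq (𝕜 := ℂ), inner_toLp_left]
  have : ∫ x, (hf.toLp f) x * conj (f x) ∂μ = ((∫ x, ‖f x‖ ^ 2 ∂μ : ℝ) : ℂ) := by
    rw [← integral_complex_ofReal]
    refine integral_congr_ae ?_
    filter_upwards [hf.coeFn_toLp] with x hx
    rw [hx, Complex.mul_conj, Complex.normSq_eq_norm_sq]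
  rw [this]
  simp

/-! ### Smoothly truncated powers -/

section CutoffPower

/-- The power `t ^ ν`, smoothly cut off to `1 ≤ t`. -/
def cutPow (ν : ℂ) (t : ℝ) : ℂ := (Real.smoothTransition (t - 1) : ℂ) * (t : ℂ) ^ ν

variable {ν : ℂ} {t : ℝ}

theorem cutPow_eq_zero (ht : t ≤ 1) : cutPow ν t = 0 := by
  simp [cutPow, Real.smoothTransition.zero_of_nonpos (show t - 1 ≤ 0 by linarith)]

theorem cutPow_eq_cpow (ht : 2 ≤ t) : cutPow ν t = (t : ℂ) ^ ν := by
  simp [cutPow, Real.smoothTransition.one_of_one_le (show 1 ≤ t - 1 by linarith)]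

theorem norm_cutPow_le (ht : 1 ≤ t) : ‖cutPow ν t‖ ≤ t ^ ν.re := by
  rw [cutPow, norm_mul, Complex.norm_cpow_eq_rpow_re_of_pos (by linarith), Complex.norm_real,
    Real.norm_eq_abs, abs_of_nonneg (Real.smoothTransition.nonneg _)]
  exact mul_le_of_le_one_left (Real.rpow_nonneg (by linarith) _) (Real.smoothTransition.le_one _)

theorem contDiff_cutPow (ν : ℂ) : ContDiff ℝ ∞ (cutPow ν) := by
  rw [contDiff_iff_contDiffAt]
  intro t
  rcases lt_or_ge t 1 with ht | ht
  · refine (contDiffAt_const (c := (0 : ℂ))).congr_of_eventuallyEq ?_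
    filter_upwards [Iio_mem_nhds ht] with s hs
    exact cutPow_eq_zero (le_of_lt hs)
  · have h0 : 0 < t := by linarith
    have h1 : ContDiffAt ℝ ∞ (fun s : ℝ => (Real.smoothTransition (s - 1) : ℂ)) t :=
      (Complex.ofRealCLM.contDiff.comp
        (Real.smoothTransition.contDiff.comp (contDiff_id.sub contDiff_const))).contDiffAt
    have h2 : ContDiffAt ℝ ∞ (fun s : ℝ => Complex.exp (Complex.log s * ν)) t := by
      refine (ContDiffAt.mul ?_ contDiffAt_const).cexp
      exact ((Complex.contDiffAt_log (x := (t : ℂ)) (Or.inl (by simpa))).restrict_scalars ℝ).comp t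
        Complex.ofRealCLM.contDiff.contDiffAt
    refine (h1.mul h2).congr_of_eventuallyEq ?_
    filter_upwards [Ioi_mem_nhds h0] with s hs
    have : (s : ℂ) ≠ 0 := by exact_mod_cast (ne_of_gt hs)
    rw [cutPow, Complex.cpow_def_of_ne_zero this]

theorem hasDerivAt_cutPow (ν : ℂ) (t : ℝ) : HasDerivAt (cutPow ν) (deriv (cutPow ν) t) t :=
  ((contDiff_cutPow ν).differentiable (by simp) t).hasDerivAt

theorem contDiff_deriv_cutPow (ν : ℂ) : ContDiff ℝ ∞ (deriv (cutPow ν)) :=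
  (contDiff_infty_iff_deriv.1 (contDiff_cutPow ν)).2

theorem hasDerivAt_deriv_cutPow (ν : ℂ) (t : ℝ) :
    HasDerivAt (deriv (cutPow ν)) (deriv (deriv (cutPow ν)) t) t :=
  ((contDiff_deriv_cutPow ν).differentiable (by simp) t).hasDerivAt

theorem hasDerivAt_ofReal_cpow_of_pos (s : ℂ) (ht : 0 < t) :
    HasDerivAt (fun y : ℝ => (y : ℂ) ^ s) (s * (t : ℂ) ^ (s - 1)) t := by
  have h := ((hasDerivAt_id (t : ℂ)).cpow_const (c := s) (Or.inl (by simpa))).comp_ofReal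
  simpa using h

theorem deriv_cutPow (ht : 2 < t) : deriv (cutPow ν) t = ν * (t : ℂ) ^ (ν - 1) := by
  have : cutPow ν =ᶠ[𝓝 t] fun y : ℝ => (y : ℂ) ^ ν := by
    filter_upwards [Ioi_mem_nhds ht] with s hs
    exact cutPow_eq_cpow (le_of_lt hs)
  rw [this.deriv_eq]
  exact (hasDerivAt_ofReal_cpow_of_pos ν (by linarith)).deriv

theorem deriv_deriv_cutPow (ht : 2 < t) :
    deriv (deriv (cutPow ν)) t = ν * ((ν - 1) * (t : ℂ) ^ (ν - 1 - 1)) := by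
  have : deriv (cutPow ν) =ᶠ[𝓝 t] fun y : ℝ => ν * (y : ℂ) ^ (ν - 1) := by
    filter_upwards [Ioi_mem_nhds ht] with s hs
    exact deriv_cutPow hs
  rw [this.deriv_eq]
  exact ((hasDerivAt_ofReal_cpow_of_pos (ν - 1) (by linarith)).const_mul ν).deriv

/-- The transition region of the cutoff is compact, so a larger constant covers it. -/
theorem exists_norm_le_rpow {f : ℝ → ℂ} (hf : Continuous f) {s C : ℝ}
    (h : ∀ t, 2 < t → ‖f t‖ ≤ C * t ^ s) : ∃ C' : ℝ, 0 ≤ C' ∧ ∀ t, 1 ≤ t → ‖f t‖ ≤ C' * t ^ s := by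
  have hcont : ContinuousOn (fun t : ℝ => f t * ((t ^ (-s) : ℝ) : ℂ)) (Set.Icc 1 3) := by
    intro t ht
    refine (hf.continuousAt.mul (Complex.continuous_ofReal.continuousAt.comp
      (Real.continuousAt_rpow_const t _ (Or.inl (by linarith [ht.1]))))).continuousWithinAt
  obtain ⟨D, hD⟩ := isCompact_Icc.exists_bound_of_continuousOn hcont
  refine ⟨max (max C D) 0, le_max_right _ _, fun t ht => ?_⟩
  have h0 : 0 < t := by linarith
  have hp : 0 < t ^ s := Real.rpow_pos_of_pos h0 s
  rcases le_or_gt t 3 with h3 | h3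
  · have := hD t ⟨ht, h3⟩
    rw [norm_mul, Complex.norm_real, Real.norm_eq_abs, abs_of_pos (Real.rpow_pos_of_pos h0 _),
      Real.rpow_neg h0.le, ← div_eq_mul_inv, div_le_iff₀ hp] at this
    refine this.trans ?_
    gcongr
    exact (le_max_right _ _).trans (le_max_left _ _)
  · refine (h t (by linarith)).trans ?_
    gcongr
    exact (le_max_left _ _).trans (le_max_left _ _)

end CutoffPower

/-- Approximate eigenfunctions for purely imaginary field. -/
theorem exists_pseudomode_of_re_eq_zero {σ : ℝ} (hσ : σ ^ 2 = 1) {a b z : ℂ} (hb : b = σ * a)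
    (ha : a ≠ 0) (hare : a.re = 0) (hz : 0 ≤ (z / a).re) {ε : ℝ} (hε : 0 < ε) :
    ∃ ψ g : L2, IsWeakAction b ψ (g + z • ψ) ∧ ψ ≠ 0 ∧ ‖g‖ ≤ ε * ‖ψ‖ := by
  set ν : ℂ := (z / a - 1) / 2 with hν
  have hzν : z = (2 * ν + 1) * a := by rw [hν]; field_simp; ring
  set r := ν.re with hr
  have hr' : -1 / 2 ≤ r := by
    have : r = ((z / a).re - 1) / 2 := by rw [hr, hν]; simp
    rw [this]; linarith
  -- Large enough for the weight to be integrable.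
  obtain ⟨N, hN1, hN⟩ : ∃ N : ℕ, 1 ≤ N ∧ r + 3 / 2 < N := by
    obtain ⟨n, hn⟩ := exists_nat_gt (r + 3 / 2)
    exact ⟨n + 1, by omega, by push_cast; linarith⟩
  let u := cutPow ν
  let u' := deriv u
  let u'' := deriv u'
  have hu := hasDerivAt_cutPow ν
  have hu' := hasDerivAt_deriv_cutPow ν
  have husm := contDiff_cutPow ν
  have hu'sm : ContDiff ℝ ∞ u' := contDiff_deriv_cutPow ν
  have hu''sm : ContDiff ℝ ∞ u'' := (contDiff_infty_iff_deriv.1 hu'sm).2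
  obtain ⟨C1, hC10, hC1⟩ := exists_norm_le_rpow (f := u') (s := r - 1) (C := ‖ν‖) hu'sm.continuous
    fun t ht => by
      have h0 : 0 < t := by linarith
      rw [show u' t = _ from deriv_cutPow ht, norm_mul, Complex.norm_cpow_eq_rpow_re_of_pos h0]
      simp [hr]
  -- The pure power solves `(a - z) u + 2 a t u' = 0`, so for `t > 2` only `-u''`, of order `t ^ (r
  -- - 2)`, remains. The weaker order `t ^ (r - 1)` suffices, as the cross term is only bounded by
  -- that order.
  obtain ⟨C2, hC20, hC2⟩ := exists_norm_le_rpow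
    (f := fun t : ℝ => (a - z) * u t + 2 * a * t * u' t - u'' t) (s := r - 1)
    (C := ‖ν * (ν - 1)‖)
    (by
      have := husm.continuous
      have := hu'sm.continuous
      have := hu''sm.continuous
      have : Continuous u := husm.continuous
      fun_prop)
    fun t ht => by
      have h0 : 0 < t := by linarith
      have ht0 : (t : ℂ) ≠ 0 := by exact_mod_cast h0.ne'
      have e1 : (t : ℂ) ^ (ν - 1) = (t : ℂ) ^ ν / t := by rw [Complex.cpow_sub _ _ ht0, Complex.cpow_one]
      have e : (a - z) * u t + 2 * a * t * u' t - u'' t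
          = -(ν * (ν - 1)) * (t : ℂ) ^ (ν - 1 - 1) := by
        rw [show u' t = _ from deriv_cutPow ht, show u'' t = _ from deriv_deriv_cutPow ht,
          show u t = _ from cutPow_eq_cpow ht.le, e1, hzν]
        field_simp
        ring
      rw [e, norm_mul, norm_neg, Complex.norm_cpow_eq_rpow_re_of_pos h0]
      gcongr
      · linarith
      · simp [hr]
  set C := C2 + 2 * C1 * N with hC
  have hC0 : 0 ≤ C := by positivity
  -- The tolerance compensates the factor `C²` in the squared error, with `C² + 1` avoiding division
  -- by zero.
  obtain ⟨δ, hδ0, hδ1, hSpos, hle⟩ := exists_weight_integral_le (N := N) hr' hN hN1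
    (ε := ε ^ 2 / (C ^ 2 + 1)) (by positivity)
  have hWint := integrable_weight hδ0 hN hN1
  let v : ℂ → ℂ := fun ζ => ((1 + δ * ζ) ^ N)⁻¹
  let v' : ℂ → ℂ := fun ζ => -(N * δ) * ((1 + δ * ζ) ^ (N + 1))⁻¹
  let v'' : ℂ → ℂ := fun ζ => (N * (N + 1) * δ ^ 2) * ((1 + δ * ζ) ^ (N + 2))⁻¹
  have hlin : ∀ ζ : ℂ, HasDerivAt (fun ζ : ℂ => 1 + δ * ζ) (δ : ℂ) ζ := fun ζ => by
    simpa using ((hasDerivAt_id ζ).const_mul (δ : ℂ)).const_add 1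
  have hpw : ∀ (n : ℕ) (ζ : ℂ), 1 + δ * ζ ≠ 0 → HasDerivAt (fun ζ : ℂ => ((1 + δ * ζ) ^ (n + 1))⁻¹)
      (-((n + 1) * δ) * ((1 + δ * ζ) ^ (n + 2))⁻¹) ζ := by
    intro n ζ h0
    refine (((hlin ζ).fun_pow (n + 1)).fun_inv (pow_ne_zero _ h0)).congr_deriv ?_
    push_cast
    field_simp
    ring
  have hvd : ∀ ζ : ℂ, 1 + δ * ζ ≠ 0 → HasDerivAt v (v' ζ) ζ := fun ζ h0 => by
    obtain ⟨n, rfl⟩ : ∃ n, N = n + 1 := ⟨N - 1, by omega⟩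
    have := hpw n ζ h0
    simpa [v, v'] using this
  have hvd' : ∀ ζ : ℂ, 1 + δ * ζ ≠ 0 → HasDerivAt v' (v'' ζ) ζ := fun ζ h0 => by
    refine ((hpw N ζ h0).const_mul (-(N * δ : ℂ))).congr_deriv ?_
    simp only [v'']
    ring
  have hre : ∀ x : ℝ × ℝ, (1 + δ * cplx σ x).re = 1 + δ * x.1 := fun x => by simp [cplx]
  have him : ∀ x : ℝ × ℝ, (1 + δ * cplx σ x).im = δ * (σ * x.2) := fun x => by simp [cplx]
  have hne : ∀ x : ℝ × ℝ, 0 < x.1 → 1 + δ * cplx σ x ≠ 0 := fun x hx h => by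
    have := hre x
    rw [h] at this
    simp at this
    have : 0 < δ * x.1 := by positivity
    linarith
  have hnormsq : ∀ x : ℝ × ℝ, ‖1 + δ * cplx σ x‖ ^ 2 = (1 + δ * x.1) ^ 2 + (δ * x.2) ^ 2 := by
    intro x
    rw [← Complex.normSq_eq_norm_sq, Complex.normSq_apply, hre, him]
    linear_combination (δ ^ 2 * x.2 ^ 2) * hσ
  let F : ℝ × ℝ → ℂ := fun y => u y.1 * v (cplx σ y) * gauss σ a 0 0 y
  have hFzero : ∀ x : ℝ × ℝ, x.1 < 1 → F =ᶠ[𝓝 x] 0 := fun x hx => by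
    filter_upwards [(isOpen_lt continuous_fst continuous_const).mem_nhds
      (show x ∈ {y : ℝ × ℝ | y.1 < 1} from hx)] with y hy
    have : u y.1 = 0 := cutPow_eq_zero (le_of_lt hy)
    simp [F, this]
  have hpos : ∀ x : ℝ × ℝ, 0 < x.1 → ∀ᶠ y in 𝓝 x, 0 < y.1 := fun x hx =>
    (isOpen_lt continuous_const continuous_fst).mem_nhds hx
  have hFsm : ContDiff ℝ ∞ F := by
    rw [contDiff_iff_contDiffAt]
    intro x
    rcases lt_or_ge x.1 1 with hx | hx
    · exact contDiffAt_const.congr_of_eventuallyEq (hFzero x hx)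
    · have hx0 : 0 < x.1 := by linarith
      refine (ContDiffAt.mul (husm.comp contDiff_fst).contDiffAt ?_).mul
        (contDiff_gauss σ a 0 0).contDiffAt
      refine ContDiffAt.inv ?_ (pow_ne_zero _ (hne x hx0))
      have := contDiff_cplx σ
      exact ((contDiff_const.add (contDiff_const.mul this)).pow N).contDiffAt
  have hgn : ∀ x, ‖gauss σ a 0 0 x‖ = 1 := fun x => by
    rw [gauss, Complex.norm_exp]
    simp [hare]
  have hFW : ∀ x, ‖F x‖ ^ 2 ≤ weight r N δ x := by
    intro x
    simp only [F, norm_mul, hgn, mul_one]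
    by_cases hx : 1 ≤ x.1
    · rw [weight, if_pos hx, mul_pow]
      have h1 := norm_cutPow_le (ν := ν) hx
      have h0 : 0 < x.1 := by linarith
      have e1 : x.1 ^ (2 * r) = (x.1 ^ r) ^ 2 := by
        rw [mul_comm, Real.rpow_mul h0.le]; norm_cast
      have e2 : ‖v (cplx σ x)‖ ^ 2 = (((1 + δ * x.1) ^ 2 + (δ * x.2) ^ 2) ^ N)⁻¹ := by
        simp only [v]
        rw [norm_inv, norm_pow, inv_pow, ← hnormsq, pow_right_comm]
      rw [e1, e2]
      gcongr
    · have : u x.1 = 0 := cutPow_eq_zero (by linarith)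
      simp [this, weight, hx]
  have hFW2 : ∀ x : ℝ × ℝ, 2 ≤ x.1 → ‖F x‖ ^ 2 = weight r N δ x := by
    intro x hx
    have h0 : 0 < x.1 := by linarith
    simp only [F, norm_mul, hgn, mul_one]
    rw [weight, if_pos (by linarith), mul_pow, show u x.1 = _ from cutPow_eq_cpow hx,
      Complex.norm_cpow_eq_rpow_re_of_pos h0]
    have e1 : x.1 ^ (2 * r) = (x.1 ^ r) ^ 2 := by
      rw [mul_comm, Real.rpow_mul h0.le]; norm_cast
    rw [e1, hr]
    simp only [v]
    rw [norm_inv, norm_pow, inv_pow, ← hnormsq, pow_right_comm]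
  have herr : ∀ x, ‖expr b F x - z * F x‖ ^ 2 ≤ C ^ 2 * (x.1⁻¹ ^ 2 * weight r N δ x) := by
    intro x
    by_cases hx : 1 ≤ x.1
    · have h0 : 0 < x.1 := by linarith
      have hex := expr_separated (x := x) hσ hb (v := v) (v' := v') (v'' := v'') hu hu'
        ((hpos x h0).mono fun y hy => hvd _ (hne y hy)) (hvd' _ (hne x h0))
      have e : expr b F x - z * F x = (((a - z) * u x.1 + 2 * a * x.1 * u' x.1 - u'' x.1)
          * v (cplx σ x) - 2 * u' x.1 * v' (cplx σ x)) * gauss σ a 0 0 x := by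
        rw [show expr b F x = _ from hex]
        simp only [F, u, u', u'']
        ring
      have n1 : 1 ≤ ‖1 + δ * cplx σ x‖ := by
        refine le_trans ?_ (Complex.re_le_norm _)
        rw [hre]
        have : 0 < δ * x.1 := by positivity
        linarith
      have hv'n : ‖v' (cplx σ x)‖ ≤ N * ‖v (cplx σ x)‖ := by
        simp only [v, v', norm_mul, norm_neg, norm_inv, norm_pow, Complex.norm_real,
          Complex.norm_natCast, Real.norm_eq_abs, abs_of_pos hδ0]
        rw [mul_assoc]
        gcongr
        calc δ * (‖1 + δ * cplx σ x‖ ^ (N + 1))⁻¹ ≤ 1 * (‖1 + δ * cplx σ x‖ ^ N)⁻¹ := by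
              gcongr
              exact N.le_succ
          _ = _ := one_mul _
      have hb1 : ‖expr b F x - z * F x‖ ≤ C * x.1 ^ (r - 1) * ‖v (cplx σ x)‖ := by
        rw [e, norm_mul, hgn, mul_one]
        refine (norm_sub_le _ _).trans ?_
        rw [norm_mul, norm_mul, norm_mul, RCLike.norm_ofNat]
        have i1 := hC2 x.1 hx
        have i2 := hC1 x.1 hx
        have hp := Real.rpow_nonneg h0.le (r - 1)
        calc ‖(a - z) * u x.1 + 2 * a * x.1 * u' x.1 - u'' x.1‖ * ‖v (cplx σ x)‖
              + 2 * ‖u' x.1‖ * ‖v' (cplx σ x)‖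
            ≤ (C2 * x.1 ^ (r - 1)) * ‖v (cplx σ x)‖
              + 2 * (C1 * x.1 ^ (r - 1)) * (N * ‖v (cplx σ x)‖) := by gcongr
          _ = _ := by rw [hC]; ring
      have e1 : x.1⁻¹ ^ 2 * x.1 ^ (2 * r) = (x.1 ^ (r - 1)) ^ 2 := by
        rw [Real.rpow_sub_one h0.ne', div_pow, mul_comm (2 : ℝ) r, Real.rpow_mul h0.le]
        norm_cast
        field_simp
      have e2 : ‖v (cplx σ x)‖ ^ 2 = (((1 + δ * x.1) ^ 2 + (δ * x.2) ^ 2) ^ N)⁻¹ := by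
        simp only [v]
        rw [norm_inv, norm_pow, inv_pow, ← hnormsq, pow_right_comm]
      calc ‖expr b F x - z * F x‖ ^ 2 ≤ (C * x.1 ^ (r - 1) * ‖v (cplx σ x)‖) ^ 2 := by gcongr
        _ = C ^ 2 * ((x.1 ^ (r - 1)) ^ 2 * ‖v (cplx σ x)‖ ^ 2) := by ring
        _ = _ := by rw [weight, if_pos hx, ← mul_assoc (x.1⁻¹ ^ 2), e1, e2]
    · have hx' : x.1 < 1 := not_le.1 hx
      rw [expr_eq_zero_of_eventuallyEq_zero b (hFzero x hx'), (hFzero x hx').self_of_nhds]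
      have := weight_nonneg r N δ x
      simp
      positivity
  have hFm : MemLp F 2 volume := by
    rw [memLp_two_iff_integrable_sq_norm hFsm.continuous.aestronglyMeasurable]
    refine hWint.mono' (by have := hFsm.continuous; fun_prop) (Filter.Eventually.of_forall fun x => ?_)
    simpa using hFW x
  have hW2 := integrable_inv_sq_mul_weight hδ0 hN hN1
  have hecont : Continuous fun x => expr b F x - z * F x :=
    (smooth_expr b hFsm).continuous.sub (continuous_const.mul hFsm.continuous)
  have herrm : MemLp (fun x => expr b F x - z * F x) 2 volume := by
    rw [memLp_two_iff_integrable_sq_norm hecont.aestronglyMeasurable]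
    refine (hW2.const_mul (C ^ 2)).mono' (hecont.norm.pow 2).aestronglyMeasurable (Filter.Eventually.of_forall fun x => ?_)
    simpa using herr x
  have hem : MemLp (expr b F) 2 volume := by
    have := herrm.add (hFm.const_mul z)
    refine this.ae_eq (Filter.Eventually.of_forall fun x => ?_)
    simp
  have hms : MeasurableSet {x : ℝ × ℝ | 2 ≤ x.1} := measurableSet_le measurable_const measurable_fst
  -- On `x₁ ≥ 2` the cutoff is `1`, and `‖F‖²` equals the weight.
  have hSle : ∫ x, Set.indicator {x : ℝ × ℝ | 2 ≤ x.1} (weight r N δ) x ≤ ‖hFm.toLp F‖ ^ 2 := by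
    rw [norm_toLp_sq]
    refine integral_mono (hWint.indicator hms) ((memLp_two_iff_integrable_sq_norm hFm.1).1 hFm) fun x => ?_
    by_cases hx : 2 ≤ x.1
    · rw [Set.indicator_of_mem (show x ∈ {x : ℝ × ℝ | 2 ≤ x.1} from hx), ← hFW2 x hx]
    · rw [Set.indicator_of_notMem (show x ∉ {x : ℝ × ℝ | 2 ≤ x.1} from hx)]
      positivity
  refine ⟨hFm.toLp F, herrm.toLp _, ?_, fun h0 => ?_, ?_⟩
  · convert isWeakAction_toLp b hFsm hFm hem using 1
    rw [← MemLp.toLp_const_smul, ← MemLp.toLp_add]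
    refine MemLp.toLp_congr _ _ (Filter.Eventually.of_forall fun x => ?_)
    simp
  · rw [h0] at hSle
    simp at hSle
    linarith
  · refine (pow_le_pow_iff_left₀ (norm_nonneg _) (by positivity) two_ne_zero).1 ?_
    have h1 : ‖herrm.toLp _‖ ^ 2 ≤ C ^ 2 * ∫ x, x.1⁻¹ ^ 2 * weight r N δ x := by
      rw [norm_toLp_sq, ← integral_const_mul]
      exact integral_mono ((memLp_two_iff_integrable_sq_norm herrm.1).1 herrm)
        (hW2.const_mul (C ^ 2)) herr
    have h2 : C ^ 2 * (ε ^ 2 / (C ^ 2 + 1)) ≤ ε ^ 2 := by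
      rw [← mul_div_assoc, div_le_iff₀ (by positivity)]
      nlinarith [sq_nonneg ε]
    rw [mul_pow]
    calc ‖herrm.toLp _‖ ^ 2 ≤ C ^ 2 * ∫ x, x.1⁻¹ ^ 2 * weight r N δ x := h1
      _ ≤ C ^ 2 * (ε ^ 2 / (C ^ 2 + 1)
          * ∫ x, Set.indicator {x : ℝ × ℝ | 2 ≤ x.1} (weight r N δ) x) := by gcongr
      _ = C ^ 2 * (ε ^ 2 / (C ^ 2 + 1))
          * ∫ x, Set.indicator {x : ℝ × ℝ | 2 ≤ x.1} (weight r N δ) x := by ring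
      _ ≤ ε ^ 2 * ‖hFm.toLp F‖ ^ 2 := by gcongr

end MagneticLaplacian

namespace MagneticLaplacian

/-! ### Imaginary field: passage to the Fourier side, with the plane identified with `ℂ` -/

section FourierSide

open scoped SchwartzMap FourierTransform LineDeriv

theorem hasPartialsAt_schwartzMap (Φ : 𝓢(ℂ, ℂ)) (x : ℝ × ℝ) :
    HasPartialsAt (fun y => Φ (Complex.equivRealProdCLM.symm y))
      ((∂_{(1 : ℂ)} Φ) (Complex.equivRealProdCLM.symm x))
      ((∂_{Complex.I} Φ) (Complex.equivRealProdCLM.symm x)) x := by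
  have h := (Φ.differentiableAt (x := Complex.equivRealProdCLM.symm x)).hasFDerivAt.comp x
    (Complex.equivRealProdCLM.symm : ℝ × ℝ →L[ℝ] ℂ).hasFDerivAt
  refine HasFDerivAt.congr_fderiv h ?_
  rw [SchwartzMap.lineDerivOp_apply_eq_fderiv, SchwartzMap.lineDerivOp_apply_eq_fderiv]
  ext <;> simp [Complex.equivRealProdCLM_symm_apply]

/-- Multiplication of a Schwartz function on `ℂ` by the real linear form `⟪·, m⟫`. -/
def mulCoord (m : ℂ) (Φ : 𝓢(ℂ, ℂ)) : 𝓢(ℂ, ℂ) :=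
  SchwartzMap.smulLeftCLM ℂ (fun k : ℂ => inner ℝ k m) Φ

theorem mulCoord_apply (m : ℂ) (Φ : 𝓢(ℂ, ℂ)) (k : ℂ) :
    mulCoord m Φ k = (inner ℝ k m : ℝ) * Φ k := by
  rw [mulCoord, SchwartzMap.smulLeftCLM_apply_apply (by fun_prop)]
  simp

theorem mulCoord_one_apply (Φ : 𝓢(ℂ, ℂ)) (k : ℂ) : mulCoord 1 Φ k = k.re * Φ k := by
  simp [mulCoord_apply, Complex.inner]

theorem mulCoord_I_apply (Φ : 𝓢(ℂ, ℂ)) (k : ℂ) : mulCoord Complex.I Φ k = k.im * Φ k := by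
  simp [mulCoord_apply, Complex.inner]

theorem mulCoord_smul (m c : ℂ) (Φ : 𝓢(ℂ, ℂ)) : mulCoord m (c • Φ) = c • mulCoord m Φ := by
  ext k
  simp only [mulCoord_apply, smul_apply, smul_eq_mul]
  ring

theorem lineDeriv_fourierInv (h : 𝓢(ℂ, ℂ)) (m : ℂ) :
    ∂_{m} (𝓕⁻ h) = (2 * Real.pi * Complex.I) • 𝓕⁻ (mulCoord m h) := by
  rw [SchwartzMap.lineDerivOp_fourierInv_eq, FourierTransform.fourierInv_smul]
  rfl

theorem mulCoord_fourierInv (h : 𝓢(ℂ, ℂ)) (m : ℂ) :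
    (2 * Real.pi * Complex.I) • mulCoord m (𝓕⁻ h) = (-1 : ℂ) • 𝓕⁻ (∂_{m} h) := by
  rw [SchwartzMap.fourierInv_lineDerivOp_eq, mulCoord]
  module

/-- The operator `h ↦ w h + 4 π² |k|² h - 2 a ∂₁ (k h)` on Schwartz functions. -/
def fourierSideOp (a w : ℂ) (h : 𝓢(ℂ, ℂ)) : 𝓢(ℂ, ℂ) :=
  w • h + (4 * Real.pi ^ 2 : ℂ) • (mulCoord 1 (mulCoord 1 h)
    + mulCoord Complex.I (mulCoord Complex.I h))
    - (2 * a) • ∂_{(1 : ℂ)} (mulCoord 1 h + Complex.I • mulCoord Complex.I h)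

/-- Multiplication by `4 π² |k|²` corresponds to `-Δ`, and `-2 a ∂₁ (k ·)` to `2 a x₁ (∂₁ + i ∂₂)`.
The result is the magnetic operator conjugated by the unimodular Gaussian, up to the constant term
`w`. -/
theorem fourierInv_fourierSideOp (a w : ℂ) (h : 𝓢(ℂ, ℂ)) :
    𝓕⁻ (fourierSideOp a w h) = w • 𝓕⁻ h
      - (∂_{(1 : ℂ)} (∂_{(1 : ℂ)} (𝓕⁻ h)) + ∂_{Complex.I} (∂_{Complex.I} (𝓕⁻ h)))
      + (2 * a) • mulCoord 1 (∂_{(1 : ℂ)} (𝓕⁻ h) + Complex.I • ∂_{Complex.I} (𝓕⁻ h)) := by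
  have e2 : ∀ m : ℂ, ∂_{m} (∂_{m} (𝓕⁻ h))
      = (-(4 * Real.pi ^ 2) : ℂ) • 𝓕⁻ (mulCoord m (mulCoord m h)) := fun m => by
    rw [lineDeriv_fourierInv, LineDeriv.lineDerivOp_smul, lineDeriv_fourierInv, smul_smul]
    congr 1
    linear_combination (4 * Real.pi ^ 2 : ℂ) * Complex.I_sq
  have e3 : mulCoord 1 (∂_{(1 : ℂ)} (𝓕⁻ h) + Complex.I • ∂_{Complex.I} (𝓕⁻ h))
      = (-1 : ℂ) • 𝓕⁻ (∂_{(1 : ℂ)} (mulCoord 1 h + Complex.I • mulCoord Complex.I h)) := by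
    rw [lineDeriv_fourierInv, lineDeriv_fourierInv, ← mulCoord_fourierInv, ← mulCoord_smul]
    congr 1
    rw [FourierTransform.fourierInv_add, FourierTransform.fourierInv_smul]
    module
  have hsub : fourierSideOp a w h = w • h + (4 * Real.pi ^ 2 : ℂ) • (mulCoord 1 (mulCoord 1 h)
    + mulCoord Complex.I (mulCoord Complex.I h))
    + (-(2 * a)) • ∂_{(1 : ℂ)} (mulCoord 1 h + Complex.I • mulCoord Complex.I h) := by
    rw [fourierSideOp]; module
  rw [e2, e2, e3, hsub]
  simp only [FourierTransform.fourierInv_add, FourierTransform.fourierInv_smul]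
  module

theorem memLp_schwartzMap_comp (Φ : 𝓢(ℂ, ℂ)) :
    MemLp (fun x : ℝ × ℝ => Φ (Complex.equivRealProdCLM.symm x)) 2 volume :=
  (Φ.memLp 2 volume).comp_measurePreserving
    (Complex.volume_preserving_equiv_real_prod.symm Complex.measurableEquivRealProd)

theorem norm_gauss_of_re_eq_zero {σ : ℝ} {a : ℂ} (ha : a.re = 0) (x : ℝ × ℝ) :
    ‖gauss σ a 0 0 x‖ = 1 := by
  rw [gauss, Complex.norm_exp]
  simp [ha]

theorem memLp_mul_gauss_of_re_eq_zero {σ : ℝ} {a : ℂ} (ha : a.re = 0) {F : ℝ × ℝ → ℂ} (hF : MemLp F 2 volume) :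
    MemLp (fun x => F x * gauss σ a 0 0 x) 2 volume := by
  refine hF.of_le (hF.1.mul (contDiff_gauss σ a 0 0).continuous.aestronglyMeasurable)
    (Filter.Eventually.of_forall fun x => ?_)
  simp [norm_gauss_of_re_eq_zero ha]

section Test

variable (a : ℂ) (Φ : 𝓢(ℂ, ℂ))

/-- The product of a Schwartz function with the Gaussian. -/
def schwartzGauss (x : ℝ × ℝ) : ℂ := Φ (Complex.equivRealProdCLM.symm x) * gauss 1 a 0 0 x

theorem hasPartialsAt_schwartzGauss (x : ℝ × ℝ) :
    HasPartialsAt (schwartzGauss a Φ)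
      (schwartzGauss a (∂_{(1 : ℂ)} Φ - a • mulCoord 1 Φ) x)
      (schwartzGauss a (∂_{Complex.I} Φ) x) x := by
  refine ((hasPartialsAt_schwartzMap Φ x).mul (hasPartialsAt_gauss 1 a 0 0 x)).congr_partials ?_ ?_
  · simp only [schwartzGauss, linForm, sub_apply, smul_apply,
      mulCoord_one_apply, smul_eq_mul, Complex.equivRealProdCLM_symm_apply]
    simp
    ring
  · simp only [schwartzGauss, linForm]
    ring

theorem D₁_schwartzGauss :
    D₁ (schwartzGauss a Φ)
      = schwartzGauss a ((-Complex.I) • (∂_{(1 : ℂ)} Φ - a • mulCoord 1 Φ)) := by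
  funext x
  rw [(hasPartialsAt_schwartzGauss a Φ x).D₁_eq]
  simp [schwartzGauss, mul_assoc]

theorem D₂_schwartzGauss :
    D₂ a (schwartzGauss a Φ)
      = schwartzGauss a ((-Complex.I) • ∂_{Complex.I} Φ - a • mulCoord 1 Φ) := by
  funext x
  rw [(hasPartialsAt_schwartzGauss a Φ x).D₂_eq]
  simp [schwartzGauss, mulCoord_one_apply, Complex.equivRealProdCLM_symm_apply]
  ring

theorem contDiff_schwartzGauss : ContDiff ℝ ∞ (schwartzGauss a Φ) :=
  ((Φ.smooth ⊤).comp (Complex.equivRealProdCLM.symm : ℝ × ℝ →L[ℝ] ℂ).contDiff).mul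
    (contDiff_gauss 1 a 0 0)

/-- The variable coefficient multiplies a first-order term only; this is why the Fourier side is a
first-order equation. -/
theorem expr_schwartzGauss :
    expr a (schwartzGauss a Φ) = schwartzGauss a (a • Φ
      - (∂_{(1 : ℂ)} (∂_{(1 : ℂ)} Φ) + ∂_{Complex.I} (∂_{Complex.I} Φ))
      + (2 * a) • mulCoord 1 (∂_{(1 : ℂ)} Φ + Complex.I • ∂_{Complex.I} Φ)) := by
  funext x
  have h1 : HasPartialsAt (fun y => schwartzGauss a (∂_{(1 : ℂ)} Φ - a • mulCoord 1 Φ) y)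
      (schwartzGauss a (∂_{(1 : ℂ)} (∂_{(1 : ℂ)} Φ) - a • mulCoord 1 (∂_{(1 : ℂ)} Φ)) x
        + -a * (x.1 * schwartzGauss a (∂_{(1 : ℂ)} Φ - a • mulCoord 1 Φ) x
          + 1 * schwartzGauss a Φ x))
      (schwartzGauss a (∂_{Complex.I} (∂_{(1 : ℂ)} Φ)) x
        + -a * (x.1 * schwartzGauss a (∂_{Complex.I} Φ) x + 0 * schwartzGauss a Φ x)) x := by
    have h := (hasPartialsAt_schwartzGauss a (∂_{(1 : ℂ)} Φ) x).add
      (((hasPartialsAt_fst x).mul (hasPartialsAt_schwartzGauss a Φ x)).const_mul (-a))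
    convert h using 2 with y
    simp [schwartzGauss, mulCoord_one_apply, Complex.equivRealProdCLM_symm_apply]
    ring
  rw [expr_eq_of_partials a (Filter.Eventually.of_forall (hasPartialsAt_schwartzGauss a Φ)) h1
    (hasPartialsAt_schwartzGauss a (∂_{Complex.I} Φ) x)]
  simp [schwartzGauss, mulCoord_one_apply, Complex.equivRealProdCLM_symm_apply]
  ring

theorem memLp_schwartzGauss {a : ℂ} (ha : a.re = 0) : MemLp (schwartzGauss a Φ) 2 volume :=
  memLp_mul_gauss_of_re_eq_zero ha (memLp_schwartzMap_comp Φ)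

end Test

theorem schwartzGauss_sub_smul (a c : ℂ) (Φ Ψ : 𝓢(ℂ, ℂ)) (x : ℝ × ℝ) :
    schwartzGauss a (Φ - c • Ψ) x = schwartzGauss a Φ x - c * schwartzGauss a Ψ x := by
  simp [schwartzGauss]
  ring

/-- The weak equation, tested against the Fourier side of products of Schwartz functions with the
Gaussian. -/
theorem integral_mul_conj_schwartzGauss {b z : ℂ} (hb : b.re = 0) {ψ : L2}
    (h : IsWeakAction b ψ (z • ψ)) (g : 𝓢(ℂ, ℂ)) :
    ∫ x, ψ x * conj (schwartzGauss (conj b)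
      (𝓕⁻ (fourierSideOp (conj b) (conj b - conj z) g)) x) = 0 := by
  have ha : (conj b).re = 0 := by simpa using hb
  have key := h.integral_eq (contDiff_schwartzGauss (conj b) (𝓕⁻ g))
    (memLp_schwartzGauss (𝓕⁻ g) ha) (by rw [D₁_schwartzGauss]; exact memLp_schwartzGauss _ ha)
    (by rw [D₂_schwartzGauss]; exact memLp_schwartzGauss _ ha)
    (by rw [expr_schwartzGauss]; exact memLp_schwartzGauss _ ha)
  rw [expr_schwartzGauss] at key
  set Ψ := conj b • 𝓕⁻ g - (∂_{(1 : ℂ)} (∂_{(1 : ℂ)} (𝓕⁻ g)) + ∂_{Complex.I} (∂_{Complex.I} (𝓕⁻ g)))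
      + (2 * conj b) • mulCoord 1 (∂_{(1 : ℂ)} (𝓕⁻ g) + Complex.I • ∂_{Complex.I} (𝓕⁻ g)) with hΨ
  have e : 𝓕⁻ (fourierSideOp (conj b) (conj b - conj z) g) = Ψ - conj z • 𝓕⁻ g := by
    rw [fourierInv_fourierSideOp, hΨ]
    module
  have i1 : Integrable fun x => ψ x * conj (schwartzGauss (conj b) Ψ x) :=
    (Lp.memLp ψ).integrable_mul (memLp_schwartzGauss Ψ ha).star
  have i2 : Integrable fun x => (z • ψ : L2) x * conj (schwartzGauss (conj b) (𝓕⁻ g) x) :=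
    (Lp.memLp (z • ψ)).integrable_mul (memLp_schwartzGauss (𝓕⁻ g) ha).star
  rw [← sub_eq_zero, ← integral_sub i1 i2] at key
  rw [← key, e]
  refine integral_congr_ae ?_
  filter_upwards [Lp.coeFn_smul z ψ] with x hx
  rw [hx, schwartzGauss_sub_smul]
  simp
  ring

/-- The square-integrable function on `ℂ` obtained by removing the oscillating Gaussian and passing
to the Fourier side is annihilated by `fourierSideOp`. -/
theorem exists_fourierSide {b z : ℂ} (hb : b.re = 0) {ψ : L2} (h : IsWeakAction b ψ (z • ψ)) :
    ∃ v : Lp ℂ 2 (volume : Measure ℂ), (v = 0 → ψ = 0) ∧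
      ∀ g : 𝓢(ℂ, ℂ), ∫ k, v k * conj (fourierSideOp (conj b) (conj b - conj z) g k) = 0 := by
  have ha : (conj b).re = 0 := by simpa using hb
  have hmp := Complex.volume_preserving_equiv_real_prod
  have m0 : MemLp (fun x => ψ x * conj (gauss 1 (conj b) 0 0 x)) 2 volume := by
    refine (Lp.memLp ψ).of_le ((Lp.memLp ψ).1.mul
      (Complex.continuous_conj.comp (contDiff_gauss 1 (conj b) 0 0).continuous).aestronglyMeasurable)
      (Filter.Eventually.of_forall fun x => ?_)
    simp [norm_gauss_of_re_eq_zero ha]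
  have m1 := m0.comp_measurePreserving hmp
  let θ : Lp ℂ 2 (volume : Measure ℂ) := m1.toLp _
  have hinner : ∀ (Φ : 𝓢(ℂ, ℂ)) (u : Lp ℂ 2 (volume : Measure ℂ)),
      inner ℂ (Φ.toLp 2 volume) u = ∫ k, u k * conj (Φ k) := fun Φ u => by
    rw [L2.inner_def]
    refine integral_congr_ae ?_
    filter_upwards [Φ.coeFn_toLp 2 volume] with k hk
    rw [hk]
    simp
  refine ⟨𝓕 θ, fun hv => ?_, fun g => ?_⟩
  · have h0 : θ = 0 := by
      have := congrArg norm hv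
      rw [Lp.norm_fourier_eq, norm_zero] at this
      exact norm_eq_zero.1 this
    have h1 : ((fun x => ψ x * conj (gauss 1 (conj b) 0 0 x))
        ∘ Complex.measurableEquivRealProd) =ᵐ[volume] 0 :=
      (MemLp.toLp_eq_toLp_iff m1 MemLp.zero').1 (h0.trans (MemLp.toLp_zero _).symm)
    rw [Lp.eq_zero_iff_ae_eq_zero]
    have h2 := (hmp.symm Complex.measurableEquivRealProd).quasiMeasurePreserving.ae h1
    filter_upwards [h2] with x hx
    simp only [Function.comp, MeasurableEquiv.apply_symm_apply, Pi.zero_apply, mul_eq_zero,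
      map_eq_zero] at hx
    refine hx.resolve_right fun h => ?_
    have := norm_gauss_of_re_eq_zero (σ := 1) ha x
    rw [h] at this
    simp at this
  · have key := integral_mul_conj_schwartzGauss hb h g
    set T := fourierSideOp (conj b) (conj b - conj z) g
    -- Written as a Fourier transform so that Plancherel moves the pairing back to the plane of
    -- positions.
    have hT : T = 𝓕 (𝓕⁻ T) := (FourierTransform.fourier_fourierInv_eq T).symm
    rw [← hinner, hT, ← SchwartzMap.toLp_fourier_eq,
      Lp.inner_fourier_eq, hinner, ← key, ← hmp.integral_comp']
    refine integral_congr_ae ?_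
    filter_upwards [m1.coeFn_toLp] with k hk
    rw [hk]
    have e : Complex.equivRealProdCLM.symm (Complex.measurableEquivRealProd k) = k :=
      Complex.equivRealProdCLM.symm_apply_apply k
    simp only [Function.comp, schwartzGauss, e, map_mul]
    ring

end FourierSide

end MagneticLaplacian

namespace MagneticLaplacian

/-! ### The integrating factor of the transport equation -/

section Transport

open scoped SchwartzMap LineDeriv

/-- The half plane `s * Im k > 0`. -/
def halfPlane (s : ℝ) : Set ℂ := {k | 0 < s * k.im}

theorem isOpen_halfPlane (s : ℝ) : IsOpen (halfPlane s) :=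
  isOpen_lt continuous_const (continuous_const.mul Complex.continuous_im)

/-- The phase `2 π² / a * (k₁² / 2 - i k₁ k₂) + c * log (- i s k)` on the half plane. -/
def phase (a c : ℂ) (s : ℝ) (k : ℂ) : ℂ :=
  2 * Real.pi ^ 2 / a * (k.re ^ 2 / 2 - Complex.I * k.re * k.im)
    + c * Complex.log (-Complex.I * s * k)

variable {a c : ℂ} {s : ℝ}

theorem mem_slitPlane_of_mem_halfPlane {k : ℂ} (hk : k ∈ halfPlane s) :
    -Complex.I * s * k ∈ Complex.slitPlane := by
  left
  simpa using show 0 < s * k.im from hk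

theorem ne_zero_of_mem_halfPlane {k : ℂ} (hk : k ∈ halfPlane s) : k ≠ 0 := by
  rintro rfl
  simp [halfPlane] at hk

theorem add_ofReal_mem_halfPlane_iff {k : ℂ} (t : ℝ) :
    k + t ∈ halfPlane s ↔ k ∈ halfPlane s := by
  simp [halfPlane]

theorem contDiffAt_phase (a c : ℂ) {k : ℂ} (hk : k ∈ halfPlane s) :
    ContDiffAt ℝ ∞ (phase a c s) k := by
  have h1 : ContDiff ℝ ∞ (fun x : ℂ => (x.re : ℂ)) :=
    Complex.ofRealCLM.contDiff.comp Complex.reCLM.contDiff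
  have h2 : ContDiff ℝ ∞ (fun x : ℂ => (x.im : ℂ)) :=
    Complex.ofRealCLM.contDiff.comp Complex.imCLM.contDiff
  have h3 : ContDiffAt ℝ ∞ (fun x : ℂ => Complex.log (-Complex.I * s * x)) k :=
    ((Complex.contDiffAt_log (mem_slitPlane_of_mem_halfPlane hk)).restrict_scalars ℝ).comp k
      (contDiff_const.mul contDiff_id).contDiffAt
  unfold phase
  refine ContDiffAt.add ?_ (contDiffAt_const.mul h3)
  exact (contDiff_const.mul (((h1.pow 2).div_const 2).sub
    ((contDiff_const.mul h1).mul h2))).contDiffAt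

/-- The equation defining the phase: `2 a ∂₁ phase = 4 π² conj k + 2 a c / k` cancels the
zeroth-order terms of `fourierSideOp`. -/
theorem fderiv_phase_one (a c : ℂ) (hs : s ≠ 0) {k : ℂ} (hk : k ∈ halfPlane s) :
    fderiv ℝ (phase a c s) k 1 = 2 * Real.pi ^ 2 / a * conj k + c / k := by
  rw [← ((contDiffAt_phase a c hk).differentiableAt (by simp)).lineDeriv_eq_fderiv]
  refine HasLineDerivAt.lineDeriv ?_
  have h0 : HasDerivAt (fun t : ℝ => (t : ℂ)) 1 0 := Complex.ofRealCLM.hasDerivAt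
  have h1 : HasDerivAt (fun t : ℝ => (k.re : ℂ) + t) 1 0 := h0.const_add _
  have h2 : HasDerivAt (fun t : ℝ => -Complex.I * s * (k + t)) (-Complex.I * s * 1) 0 :=
    (h0.const_add k).const_mul _
  have h3 := h2.clog_real (by simpa using mem_slitPlane_of_mem_halfPlane hk)
  have h4 := ((((h1.pow 2).div_const 2).sub ((h1.const_mul Complex.I).mul_const (k.im : ℂ))).const_mul
    (2 * Real.pi ^ 2 / a)).add (h3.const_mul c)
  rw [HasLineDerivAt]
  convert h4 using 1
  · funext t
    simp [phase]
  · have hk0 := ne_zero_of_mem_halfPlane hk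
    have : (s : ℂ) ≠ 0 := by exact_mod_cast hs
    have hc : conj k = k.re - Complex.I * k.im := by
      apply Complex.ext <;> simp
    rw [hc]
    simp
    field_simp

/-- A function smooth on a neighborhood of the support of `G`, times `G`, is smooth. -/
theorem contDiff_mul_of_tsupport_subset {f G : ℂ → ℂ} {U : Set ℂ} (hf : ∀ k ∈ U, ContDiffAt ℝ ∞ f k)
    (hG : ContDiff ℝ ∞ G) (hGU : tsupport G ⊆ U) : ContDiff ℝ ∞ (fun k => f k * G k) := by
  rw [contDiff_iff_contDiffAt]
  intro k
  by_cases hk : k ∈ tsupport G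
  · exact (hf k (hGU hk)).mul hG.contDiffAt
  · refine contDiffAt_const (c := (0 : ℂ)) |>.congr_of_eventuallyEq ?_
    filter_upwards [notMem_tsupport_iff_eventuallyEq.1 hk] with y hy
    simp [hy]

/-- On `exp phase * k⁻¹ * G` the operator reduces to `-2 a exp phase ∂₁ G`, so `v * conj (exp
phase)` has zero real-direction derivative in the weak sense. -/
theorem integral_mul_conj_exp_phase_mul_fderiv {u : ℂ → ℂ} (ha : a ≠ 0) (hs : s ≠ 0)
    (hu : ∀ g : 𝓢(ℂ, ℂ), ∫ k, u k * conj (fourierSideOp a (2 * a * c) g k) = 0)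
    {G : ℂ → ℂ} (hG : ContDiff ℝ ∞ G) (hGc : HasCompactSupport G) (hGU : tsupport G ⊆ halfPlane s) :
    ∫ k, u k * conj (Complex.exp (phase a c s k) * fderiv ℝ G k 1) = 0 := by
  have hQ : ∀ k ∈ halfPlane s, ContDiffAt ℝ ∞ (fun k => Complex.exp (phase a c s k)) k :=
    fun k hk => (contDiffAt_phase a c hk).cexp
  have hh : ContDiff ℝ ∞ (fun k => Complex.exp (phase a c s k) * k⁻¹ * G k) :=
    contDiff_mul_of_tsupport_subset (fun k hk => (hQ k hk).mul
      (contDiffAt_id.inv (ne_zero_of_mem_halfPlane hk))) hG hGU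
  have hc : HasCompactSupport (fun k => Complex.exp (phase a c s k) * k⁻¹ * G k) := hGc.mul_left
  -- The factor `k⁻¹` undoes the multiplication by `k` under the derivative; it is smooth on the
  -- support of `G`, which avoids the real axis.
  set g : 𝓢(ℂ, ℂ) := hc.toSchwartzMap hh with hg
  have hga : ∀ k, g k = Complex.exp (phase a c s k) * k⁻¹ * G k := fun k => rfl
  have hG0 : G 0 = 0 := by
    refine image_eq_zero_of_notMem_tsupport fun h => ne_zero_of_mem_halfPlane (hGU h) rfl
  have hkg : ∀ k, k * g k = Complex.exp (phase a c s k) * G k := fun k => by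
    rw [hga]
    by_cases hk : k = 0
    · subst hk
      simp [hG0]
    · field_simp
  have e1 : (mulCoord 1 g + Complex.I • mulCoord Complex.I g : 𝓢(ℂ, ℂ))
      = fun k => Complex.exp (phase a c s k) * G k := by
    funext k
    rw [← hkg]
    simp only [add_apply, smul_apply, smul_eq_mul, mulCoord_one_apply, mulCoord_I_apply]
    linear_combination g k * Complex.re_add_im k
  have key : ∀ k, fourierSideOp a (2 * a * c) g k
      = -(2 * a) * (Complex.exp (phase a c s k) * fderiv ℝ G k 1) := by
    intro k
    have e2 : fourierSideOp a (2 * a * c) g k = 2 * a * c * g k + 4 * Real.pi ^ 2 *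
        (k.re * (k.re * g k) + k.im * (k.im * g k))
        - 2 * a * fderiv ℝ (fun k => Complex.exp (phase a c s k) * G k) k 1 := by
      rw [← e1, ← SchwartzMap.lineDerivOp_apply_eq_fderiv]
      simp [fourierSideOp, mulCoord_one_apply, mulCoord_I_apply]
      ring
    rw [e2]
    by_cases hk : k ∈ tsupport G
    · have hkU := hGU hk
      have hk0 := ne_zero_of_mem_halfPlane hkU
      have hp := ((contDiffAt_phase a c hkU).differentiableAt (by simp)).hasFDerivAt
      have hGd := (hG.differentiable (by simp) k).hasFDerivAt
      rw [(hp.cexp.fun_mul hGd).fderiv]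
      have hn : (k.re : ℂ) * k.re + k.im * k.im = conj k * k := by
        rw [← Complex.normSq_eq_conj_mul_self, Complex.normSq_apply]
        push_cast
        rfl
      simp only [add_apply, smul_apply, smul_eq_mul, fderiv_phase_one a c hs hkU, hga]
      have : (k.re : ℂ) * (k.re * (Complex.exp (phase a c s k) * k⁻¹ * G k))
          + k.im * (k.im * (Complex.exp (phase a c s k) * k⁻¹ * G k))
          = conj k * (Complex.exp (phase a c s k) * G k) := by
        field_simp
        linear_combination G k * hn
      rw [this]
      field_simp
      ring
    · have h0 := notMem_tsupport_iff_eventuallyEq.1 hk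
      have h1 : (fun k => Complex.exp (phase a c s k) * G k) =ᶠ[𝓝 k] fun _ => 0 := by
        filter_upwards [h0] with y hy
        simp [hy]
      rw [h1.fderiv_eq, h0.fderiv_eq, hga, h0.self_of_nhds]
      simp
  have h := hu g
  simp only [key] at h
  have h' : ∫ k, conj (-(2 * a)) * (u k * conj (Complex.exp (phase a c s k) * fderiv ℝ G k 1)) = 0 := by
    rw [← h]
    congr 1
    funext k
    rw [map_mul conj (-(2 * a))]
    ring
  rw [integral_const_mul] at h'
  refine (mul_eq_zero.1 h').resolve_left ?_
  simpa using ha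

end Transport

end MagneticLaplacian

namespace MagneticLaplacian

/-! ### Invariance of the pairing under real translations -/

section Translation

open scoped SchwartzMap

variable {a c : ℂ} {s : ℝ}

theorem tsupport_comp_sub_const (G : ℂ → ℂ) (t : ℂ) :
    tsupport (fun k => G (k - t)) = (fun k => k - t) ⁻¹' tsupport G :=
  tsupport_comp_eq_preimage G (Homeomorph.subRight t)

theorem tsupport_comp_sub_ofReal_subset {G : ℂ → ℂ} (hGU : tsupport G ⊆ halfPlane s) (t : ℝ) :
    tsupport (fun k => G (k - t)) ⊆ halfPlane s := by
  rw [tsupport_comp_sub_const]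
  intro k hk
  rw [← add_ofReal_mem_halfPlane_iff (-t)]
  simpa [sub_eq_add_neg] using hGU hk

theorem hasCompactSupport_comp_sub_const {G : ℂ → ℂ} (hGc : HasCompactSupport G) (t : ℂ) :
    HasCompactSupport (fun k => G (k - t)) :=
  hGc.comp_homeomorph (Homeomorph.subRight t)

theorem continuous_exp_phase_mul {G : ℂ → ℂ} (hG : Continuous G) (hGU : tsupport G ⊆ halfPlane s) :
    Continuous (fun k => Complex.exp (phase a c s k) * G k) := by
  rw [continuous_iff_continuousAt]
  intro k
  by_cases hk : k ∈ tsupport G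
  · exact (contDiffAt_phase a c (hGU hk)).cexp.continuousAt.mul hG.continuousAt
  · refine continuousAt_const (y := (0 : ℂ)) |>.congr ?_
    filter_upwards [notMem_tsupport_iff_eventuallyEq.1 hk] with y hy
    simp [hy]

/-- The pairing with the translates of a test function is constant along real translations. -/
theorem integral_mul_conj_exp_phase_translate (ha : a ≠ 0) (hs : s ≠ 0)
    {v : Lp ℂ 2 (volume : Measure ℂ)}
    (hv : ∀ g : 𝓢(ℂ, ℂ), ∫ k, v k * conj (fourierSideOp a (2 * a * c) g k) = 0)
    {G : ℂ → ℂ} (hG : ContDiff ℝ ∞ G) (hGc : HasCompactSupport G) (hGU : tsupport G ⊆ halfPlane s)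
    (t : ℝ) :
    ∫ k, v k * conj (Complex.exp (phase a c s k) * G (k - t))
      = ∫ k, v k * conj (Complex.exp (phase a c s k) * G k) := by
  set J : ℝ → ℂ := fun t => ∫ k, v k * conj (Complex.exp (phase a c s k) * G (k - t)) with hJ
  have hvl : LocallyIntegrable v volume := (Lp.memLp v).locallyIntegrable (by norm_num)
  have hG' : ContDiff ℝ ∞ (fun k => fderiv ℝ G k 1) :=
    (hG.fderiv_right (m := ∞) (by simp)).clm_apply contDiff_const
  have hGc' : HasCompactSupport (fun k => fderiv ℝ G k 1) := hGc.fderiv_apply ℝ 1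
  have hts : tsupport (fun k => fderiv ℝ G k 1) ⊆ tsupport G := tsupport_fderiv_apply_subset ℝ 1
  have hInt : ∀ {g : ℂ → ℂ}, Continuous g → HasCompactSupport g → tsupport g ⊆ halfPlane s →
      ∀ t : ℝ, Continuous (fun k => Complex.exp (phase a c s k) * g (k - t)) :=
    fun hg hgc hgU t => continuous_exp_phase_mul (hg.comp (continuous_id.sub continuous_const))
      (tsupport_comp_sub_ofReal_subset hgU t)
  have hderiv : ∀ t₀ : ℝ, HasDerivAt J 0 t₀ := by
    intro t₀
    -- The region swept by the support under translations near `t₀`: a compact subset of the half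
    -- plane carrying a common dominating function.
    set K : Set ℂ := (fun p : ℝ × ℂ => p.2 + p.1) '' (Metric.closedBall t₀ 1 ×ˢ tsupport G) with hK
    have hKc : IsCompact K := ((isCompact_closedBall t₀ 1).prod hGc).image (by fun_prop)
    have hKU : K ⊆ halfPlane s := by
      rintro _ ⟨⟨τ, k⟩, ⟨-, hk⟩, rfl⟩
      exact (add_ofReal_mem_halfPlane_iff τ).2 (hGU hk)
    obtain ⟨M₁, hM₁⟩ := hKc.exists_bound_of_continuousOn (f := fun k => Complex.exp (phase a c s k))
      fun k hk => (contDiffAt_phase a c (hKU hk)).cexp.continuousAt.continuousWithinAt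
    obtain ⟨M₂, hM₂⟩ := hGc'.exists_bound_of_continuous hG'.continuous
    have hmem : ∀ τ ∈ Metric.ball t₀ 1, ∀ k, k ∉ K → k - τ ∉ tsupport G := fun τ hτ k hk h =>
      hk ⟨(τ, k - τ), ⟨Metric.ball_subset_closedBall hτ, h⟩, by simp⟩
    have h := hasDerivAt_integral_of_dominated_loc_of_deriv_le (μ := (volume : Measure ℂ))
      (F := fun (τ : ℝ) k => v k * conj (Complex.exp (phase a c s k) * G (k - τ)))
      (F' := fun τ k => v k * conj (Complex.exp (phase a c s k) * -fderiv ℝ G (k - τ) 1))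
      (x₀ := t₀) (s := Metric.ball t₀ 1) (bound := K.indicator fun k => ‖v k‖ * (M₁ * M₂))
      (Metric.ball_mem_nhds t₀ one_pos) ?_ ?_ ?_ ?_ ?_ ?_
    · have h2 := h.2
      have h3 := integral_mul_conj_exp_phase_mul_fderiv ha hs hv (G := fun k => G (k - t₀))
        (hG.comp (contDiff_id.sub contDiff_const))
        (hasCompactSupport_comp_sub_const hGc t₀) (tsupport_comp_sub_ofReal_subset hGU t₀)
      have e : ∀ k, fderiv ℝ (fun k => G (k - t₀)) k = fderiv ℝ G (k - t₀) := fun k =>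
        fderiv_comp_sub (f := G) (t₀ : ℂ)
      simp only [e] at h3
      simp only [mul_neg, map_neg, integral_neg, h3, neg_zero] at h2
      exact h2
    · exact Filter.Eventually.of_forall fun τ => (Lp.memLp v).1.mul
        (Complex.continuous_conj.comp (hInt hG.continuous hGc hGU τ)).aestronglyMeasurable
    · have : MemLp (fun k => conj (Complex.exp (phase a c s k) * G (k - t₀))) 2 volume :=
        (Complex.continuous_conj.comp
          (hInt hG.continuous hGc hGU t₀)).memLp_of_hasCompactSupport
          ((hasCompactSupport_comp_sub_const hGc t₀).mul_left.comp_left (map_zero _))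
      exact (Lp.memLp v).integrable_mul this
    · have := hInt hG'.continuous hGc' (hts.trans hGU) t₀
      refine (Lp.memLp v).1.mul (Continuous.aestronglyMeasurable ?_)
      simp only [mul_neg]
      exact Complex.continuous_conj.comp this.neg
    · refine Filter.Eventually.of_forall fun k τ hτ => ?_
      by_cases hk : k ∈ K
      · rw [Set.indicator_of_mem hk, norm_mul, RCLike.norm_conj, norm_mul, norm_neg]
        have h1 := hM₁ k hk
        have h2 := hM₂ (k - τ)
        have h3 := (norm_nonneg _).trans h1
        gcongr
      · rw [Set.indicator_of_notMem hk]
        have : fderiv ℝ G (k - τ) 1 = 0 :=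
          image_eq_zero_of_notMem_tsupport (f := fun k => fderiv ℝ G k 1) fun h => hmem τ hτ k hk (hts h)
        simp [this]
    · rw [integrable_indicator_iff hKc.measurableSet]
      exact (hvl.integrableOn_isCompact hKc).norm.mul_const _
    · refine Filter.Eventually.of_forall fun k τ _ => ?_
      have h0 : HasDerivAt (fun τ : ℝ => k - (τ : ℂ)) (-1) τ :=
        (Complex.ofRealCLM.hasDerivAt (x := τ)).const_sub k
      have h1 := (hG.differentiable (by simp) (k - τ)).hasFDerivAt.comp_hasDerivAt τ h0
      rw [map_neg] at h1
      have h2 := (h1.const_mul (Complex.exp (phase a c s k)))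
      have h3 := (Complex.conjCLE.toContinuousLinearMap.hasFDerivAt).comp_hasDerivAt τ h2
      exact h3.const_mul (v k)
  have hconst := is_const_of_deriv_eq_zero (fun t => (hderiv t).differentiableAt)
    (fun t => (hderiv t).deriv) t 0
  simpa [hJ] using hconst

end Translation

end MagneticLaplacian

namespace MagneticLaplacian

/-! ### Decay of the integrating factor and absence of eigenvalues -/

section Decay

open scoped SchwartzMap

variable {a c : ℂ} {s : ℝ}

theorem phase_add_ofReal_re (ha : a.re = 0) (ha0 : a.im ≠ 0) (c : ℂ) (s t : ℝ) (k : ℂ) :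
    (phase a c s (k + t)).re = -(2 * Real.pi ^ 2 / a.im) * ((k.re + t) * k.im)
      + (c * Complex.log (-Complex.I * s * (k + t))).re := by
  have h : 2 * (Real.pi : ℂ) ^ 2 / a = ((-(2 * Real.pi ^ 2 / a.im) : ℝ) : ℂ) * Complex.I := by
    have e : a = a.im * Complex.I := by
      apply Complex.ext <;> simp [ha]
    have h0 : (a.im : ℂ) ≠ 0 := by exact_mod_cast ha0
    conv_lhs => rw [e]
    push_cast
    field_simp
    rw [Complex.I_sq, neg_neg]
  rw [phase, Complex.add_re, h]
  congr 1
  simp [pow_two]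

/-- The exponential of the phase decays along real translations in the appropriate direction. -/
theorem exists_norm_exp_phase_le (ha : a.re = 0) (ha0 : a.im ≠ 0) (c : ℂ) (hs : s ^ 2 = 1)
    {K : Set ℂ} (hK : IsCompact K) (hKU : K ⊆ halfPlane s) :
    ∃ m > 0, ∃ C, ∀ τ : ℝ, 1 ≤ τ → ∀ k ∈ K,
      ‖Complex.exp (phase a c s (k + (τ * s * a.im : ℝ)))‖
        ≤ C * (τ ^ ‖c‖ * Real.exp (-m * τ)) := by
  obtain ⟨m, hm, hmK⟩ := hK.exists_forall_le' (f := fun k => s * k.im) (a := 0)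
    (by fun_prop) fun k hk => hKU hk
  obtain ⟨R, hR, hRK⟩ := hK.isBounded.exists_pos_norm_le
  have hα : 0 < |a.im| := abs_pos.2 ha0
  have hs1 : |s| = 1 := by
    rw [← sq_eq_sq₀ (abs_nonneg s) zero_le_one, sq_abs, hs, one_pow]
  -- Large enough that both `‖k + t‖` and its inverse are at most `E τ`, so that the logarithm in
  -- the phase costs only a power of `τ`.
  set E : ℝ := R + |a.im| + 1 / m with hE
  have hE0 : 0 < E := by positivity
  refine ⟨2 * Real.pi ^ 2 * m, by positivity,
    Real.exp (2 * Real.pi ^ 2 * R ^ 2 / |a.im| + ‖c‖ * Real.pi) * E ^ ‖c‖, fun τ hτ k hk => ?_⟩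
  have hτ0 : 0 < τ := by linarith
  -- The direction `s * Im a` makes the leading real part of the phase `-2 π² (s Im k) τ`, up to a
  -- bounded term, and `s * Im k ≥ m` on `K`.
  set t : ℝ := τ * s * a.im with ht
  have hkm : m ≤ s * k.im := hmK k hk
  have hkR := hRK k hk
  have hw : ‖-Complex.I * s * (k + t)‖ = ‖k + t‖ := by
    rw [norm_mul, norm_mul, norm_neg, Complex.norm_I, Complex.norm_real, Real.norm_eq_abs, hs1]
    ring
  have hlow : m ≤ ‖k + t‖ := by
    refine hkm.trans ?_
    calc s * k.im ≤ |s * k.im| := le_abs_self _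
      _ = |(k + t).im| := by rw [abs_mul, hs1]; simp
      _ ≤ _ := Complex.abs_im_le_norm _
  have hup : ‖k + t‖ ≤ (R + |a.im|) * τ := by
    calc ‖k + t‖ ≤ ‖k‖ + ‖(t : ℂ)‖ := norm_add_le _ _
      _ = ‖k‖ + τ * |a.im| := by
          rw [Complex.norm_real, Real.norm_eq_abs, ht, abs_mul, abs_mul, hs1, abs_of_pos hτ0, mul_one]
      _ ≤ R * τ + τ * |a.im| := by
          gcongr
          nlinarith
      _ = _ := by ring
  have hy : 0 < ‖k + t‖ := hm.trans_le hlow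
  have hlog : |Real.log ‖k + t‖| ≤ Real.log (E * τ) := by
    rw [abs_le']
    constructor
    · refine Real.log_le_log hy (hup.trans ?_)
      gcongr
      rw [hE]
      have : 0 < 1 / m := by positivity
      linarith
    · rw [← Real.log_inv]
      refine Real.log_le_log (by positivity) ?_
      calc ‖k + t‖⁻¹ ≤ m⁻¹ := by gcongr
        _ = 1 / m * 1 := by ring
        _ ≤ E * τ := by
            gcongr
            rw [hE]
            have : 0 < R + |a.im| := by positivity
            linarith
  have h1 : (c * Complex.log (-Complex.I * s * (k + t))).re ≤ ‖c‖ * (Real.log (E * τ) + Real.pi) := by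
    refine (Complex.re_le_norm _).trans ?_
    rw [norm_mul]
    gcongr
    refine (Complex.norm_le_abs_re_add_abs_im _).trans ?_
    rw [Complex.log_re, Complex.log_im, hw]
    exact add_le_add hlog (Complex.abs_arg_le_pi _)
  have h2 : -(2 * Real.pi ^ 2 / a.im) * ((k.re + t) * k.im)
      ≤ 2 * Real.pi ^ 2 * R ^ 2 / |a.im| - 2 * Real.pi ^ 2 * m * τ := by
    have e : -(2 * Real.pi ^ 2 / a.im) * ((k.re + t) * k.im)
        = -(2 * Real.pi ^ 2 / a.im * (k.re * k.im)) - 2 * Real.pi ^ 2 * (s * k.im) * τ := by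
      rw [ht]
      field_simp
      ring
    rw [e]
    have i1 : -(2 * Real.pi ^ 2 / a.im * (k.re * k.im)) ≤ 2 * Real.pi ^ 2 * R ^ 2 / |a.im| := by
      refine (neg_le_abs _).trans ?_
      rw [abs_mul, abs_div, abs_mul k.re, abs_of_pos (show 0 < 2 * Real.pi ^ 2 by positivity)]
      have j1 := (Complex.abs_re_le_norm k).trans hkR
      have j2 := (Complex.abs_im_le_norm k).trans hkR
      calc 2 * Real.pi ^ 2 / |a.im| * (|k.re| * |k.im|) ≤ 2 * Real.pi ^ 2 / |a.im| * (R * R) := by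
            gcongr
        _ = _ := by ring
    have i2 : 2 * Real.pi ^ 2 * m * τ ≤ 2 * Real.pi ^ 2 * (s * k.im) * τ := by gcongr
    linarith
  rw [Complex.norm_exp, phase_add_ofReal_re ha ha0]
  calc _ ≤ Real.exp ((2 * Real.pi ^ 2 * R ^ 2 / |a.im| + ‖c‖ * Real.pi)
        + ‖c‖ * Real.log (E * τ) + -(2 * Real.pi ^ 2 * m) * τ) := by
        rw [Real.exp_le_exp]
        linarith
    _ = _ := by
        rw [Real.exp_add, Real.exp_add, mul_comm ‖c‖ (Real.log _), ← Real.rpow_def_of_pos (by positivity),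
          Real.mul_rpow hE0.le hτ0.le]
        ring

/-- Translating `G = exp (-phase) h₀` does not change the pairing, but its product with `exp phase`
tends to zero in `L²` in the decaying direction; Cauchy–Schwarz then forces the pairing to vanish.
-/
theorem integral_mul_conj_eq_zero_of_tsupport_subset (ha : a.re = 0) (ha0 : a ≠ 0) (hs : s ^ 2 = 1)
    {v : Lp ℂ 2 (volume : Measure ℂ)}
    (hv : ∀ g : 𝓢(ℂ, ℂ), ∫ k, v k * conj (fourierSideOp a (2 * a * c) g k) = 0)
    {h₀ : ℂ → ℂ} (hh : ContDiff ℝ ∞ h₀) (hc : HasCompactSupport h₀)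
    (hU : tsupport h₀ ⊆ halfPlane s) :
    ∫ k, v k * conj (h₀ k) = 0 := by
  have hs0 : s ≠ 0 := by rintro rfl; norm_num at hs
  have hα : a.im ≠ 0 := fun h => ha0 (Complex.ext ha h)
  set G : ℂ → ℂ := fun k => Complex.exp (-phase a c s k) * h₀ k with hGdef
  have hG : ContDiff ℝ ∞ G :=
    contDiff_mul_of_tsupport_subset (fun k hk => (contDiffAt_phase a c hk).neg.cexp) hh hU
  have hGc : HasCompactSupport G := hc.mul_left
  have hGU : tsupport G ⊆ halfPlane s := (tsupport_mul_subset_right).trans hU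
  have hQG : ∀ k, Complex.exp (phase a c s k) * G k = h₀ k := fun k => by
    rw [hGdef]
    simp only
    rw [← mul_assoc, ← Complex.exp_add]
    simp
  obtain ⟨m, hm, C, hC⟩ := exists_norm_exp_phase_le ha hα c hs hGc hGU
  set S : ℝ := ‖(hG.continuous.memLp_of_hasCompactSupport hGc :
    MemLp G 2 (volume : Measure ℂ)).toLp G‖ with hS
  have hbound : ∀ τ : ℝ, 1 ≤ τ →
      ‖∫ k, v k * conj (h₀ k)‖ ≤ C * (τ ^ ‖c‖ * Real.exp (-m * τ)) * (S * ‖v‖) := by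
    intro τ hτ
    set t : ℝ := τ * s * a.im with ht
    set M : ℝ := C * (τ ^ ‖c‖ * Real.exp (-m * τ)) with hM
    have hfc : Continuous (fun k => Complex.exp (phase a c s k) * G (k - t)) :=
      continuous_exp_phase_mul (hG.continuous.comp (continuous_id.sub continuous_const))
        (tsupport_comp_sub_ofReal_subset hGU t)
    have hf : MemLp (fun k => Complex.exp (phase a c s k) * G (k - t)) 2 volume :=
      hfc.memLp_of_hasCompactSupport (hasCompactSupport_comp_sub_const hGc t).mul_left
    have e : ∫ k, v k * conj (h₀ k) = inner ℂ (hf.toLp _) v := by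
      rw [inner_toLp_left, integral_mul_conj_exp_phase_translate ha0 hs0 hv hG hGc hGU t]
      simp only [hQG]
    -- A point of the support is needed to know that the bound `M` is non-negative.
    rcases Set.eq_empty_or_nonempty (tsupport G) with hemp | ⟨k₀, hk₀⟩
    · have hG0 : ∀ k, G k = 0 := fun k =>
        image_eq_zero_of_notMem_tsupport (by rw [hemp]; simp)
      have h0 : ∀ k, h₀ k = 0 := fun k => by rw [← hQG, hG0, mul_zero]
      have : S = 0 := by
        rw [hS, norm_eq_zero, Lp.eq_zero_iff_ae_eq_zero]
        filter_upwards [MemLp.coeFn_toLp (hG.continuous.memLp_of_hasCompactSupport hGc :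
          MemLp G 2 (volume : Measure ℂ))] with k hk
        rw [hk, hG0]
        rfl
      simp [h0, this]
    have hM0 : 0 ≤ M := (norm_nonneg _).trans (hC τ hτ k₀ hk₀)
    -- Translation by `t` moves the shift from `G` to the phase, where the decay bound on the
    -- support of `G` applies.
    have hn : ‖hf.toLp _‖ ≤ M * S := by
      rw [← pow_le_pow_iff_left₀ (norm_nonneg _) (by positivity) two_ne_zero, mul_pow, hS,
        norm_toLp_sq, norm_toLp_sq, ← integral_add_right_eq_self _ (t : ℂ), ← integral_const_mul]
      refine integral_mono_of_nonneg (Filter.Eventually.of_forall fun k => by positivity) ?_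
        (Filter.Eventually.of_forall fun k => ?_)
      · exact ((memLp_two_iff_integrable_sq_norm hG.continuous.aestronglyMeasurable).1
          (hG.continuous.memLp_of_hasCompactSupport hGc)).const_mul _
      · simp only [add_sub_cancel_right, norm_mul, mul_pow]
        by_cases hk : k ∈ tsupport G
        · gcongr
          exact hC τ hτ k hk
        · simp [image_eq_zero_of_notMem_tsupport hk]
    rw [e]
    calc _ ≤ ‖hf.toLp _‖ * ‖v‖ := norm_inner_le_norm _ _
      _ ≤ M * S * ‖v‖ := by gcongr
      _ = _ := by ring
  have hlim : Filter.Tendsto (fun τ : ℝ => C * (τ ^ ‖c‖ * Real.exp (-m * τ)) * (S * ‖v‖))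
      Filter.atTop (𝓝 0) := by
    simpa using ((tendsto_rpow_mul_exp_neg_mul_atTop_nhds_zero ‖c‖ m hm).const_mul C).mul_const
      (S * ‖v‖)
  have hle : ‖∫ k, v k * conj (h₀ k)‖ ≤ 0 :=
    ge_of_tendsto hlim (Filter.eventually_atTop.2 ⟨1, hbound⟩)
  exact norm_le_zero_iff.1 hle

/-- The two half planes `s = ±1` exhaust `ℂ` up to the real axis, which is a null set. -/
theorem eq_zero_of_fourierSideOp (ha : a.re = 0) (ha0 : a ≠ 0) {v : Lp ℂ 2 (volume : Measure ℂ)}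
    (hv : ∀ g : 𝓢(ℂ, ℂ), ∫ k, v k * conj (fourierSideOp a (2 * a * c) g k) = 0) : v = 0 := by
  have key : ∀ s : ℝ, s ^ 2 = 1 → ∀ᵐ k, k ∈ halfPlane s → v k = 0 := by
    intro s hs
    refine (isOpen_halfPlane s).ae_eq_zero_of_integral_contDiff_smul_eq_zero
      (((Lp.memLp v).locallyIntegrable (by norm_num)).locallyIntegrableOn _) fun g hg hc hU => ?_
    have h := integral_mul_conj_eq_zero_of_tsupport_subset ha ha0 hs hv
      (h₀ := fun k => (g k : ℂ)) (Complex.ofRealCLM.contDiff.comp hg)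
      (hc.comp_left (g := ((↑) : ℝ → ℂ)) (by simp))
      ((closure_mono (Function.support_comp_subset (g := ((↑) : ℝ → ℂ)) (by simp) g)).trans hU)
    rw [← h]
    refine integral_congr_ae (Filter.Eventually.of_forall fun k => ?_)
    simp [mul_comm]
  have hnull : ∀ᵐ k : ℂ, k.im ≠ 0 := by
    have h1 : ∀ᵐ x : ℝ × ℝ, x.2 ≠ 0 :=
      Measure.quasiMeasurePreserving_snd.ae (Measure.ae_ne volume (0 : ℝ))
    exact Complex.volume_preserving_equiv_real_prod.quasiMeasurePreserving.ae h1
  rw [Lp.eq_zero_iff_ae_eq_zero]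
  filter_upwards [key 1 (by norm_num), key (-1) (by norm_num), hnull] with k h1 h2 h3
  rcases lt_or_gt_of_ne h3 with h | h
  · exact h2 (show 0 < -1 * k.im by linarith)
  · exact h1 (show 0 < 1 * k.im by linarith)

/-- The magnetic Laplacian with purely imaginary non-zero field has no eigenvalue. -/
theorem eq_zero_of_isWeakAction_of_re_eq_zero {b z : ℂ} (hb : b.re = 0) (hb0 : b ≠ 0) {ψ : L2}
    (h : IsWeakAction b ψ (z • ψ)) : ψ = 0 := by
  obtain ⟨v, h0, hv⟩ := exists_fourierSide hb h
  have hb1 : conj b ≠ 0 := by simpa using hb0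
  refine h0 (eq_zero_of_fourierSideOp (c := (conj b - conj z) / (2 * conj b))
    (by simpa using hb) hb1 fun g => ?_)
  rw [mul_div_cancel₀ _ (by simpa using hb0)]
  exact hv g

end Decay

end MagneticLaplacian

namespace MagneticLaplacian

open UnboundedOp

/-! ### Assembly of the spectra -/

section Conclusion

variable {b z : ℂ}

/-- The equations for `(b, z)` and for the adjoint pair have no square-integrable solution, while
there are normalized approximate solutions of the first. -/
structure IsRegularPoint (b z : ℂ) : Prop where
  eq_zero : ∀ ψ : L2, IsWeakAction b ψ (z • ψ) → ψ = 0
  eq_zero_conj : ∀ ψ : L2, IsWeakAction (conj b) ψ (conj z • ψ) → ψ = 0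
  exists_pseudomode : ∀ ε > 0, ∃ ψ g : L2, IsWeakAction b ψ (g + z • ψ) ∧ ψ ≠ 0 ∧ ‖g‖ ≤ ε * ‖ψ‖

theorem IsRegularPoint.injective (h : IsRegularPoint b z) :
    Function.Injective (shift (maximalOp b) z) :=
  shift_injective_iff.2 h.eq_zero

theorem IsRegularPoint.mem_continuousSpectrum (h : IsRegularPoint b z) :
    z ∈ continuousSpectrum (maximalOp b) :=
  ⟨h.injective, dense_range_shift h.eq_zero_conj, range_shift_ne_univ h.injective h.exists_pseudomode⟩

theorem IsRegularPoint.notMem_pointSpectrum (h : IsRegularPoint b z) :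
    z ∉ pointSpectrum (maximalOp b) := fun hz => hz h.injective

/-- A closed dense range would be the whole space. -/
theorem mem_essSpectrum1_of_mem_continuousSpectrum (h : z ∈ continuousSpectrum (maximalOp b)) :
    z ∈ essSpectrum1 (maximalOp b) := by
  rintro ⟨hc, -⟩
  refine h.2.2 ?_
  rw [← IsClosed.closure_eq hc]
  exact h.2.1.closure_eq

theorem mem_spectrum_of_mem_continuousSpectrum (h : z ∈ continuousSpectrum (maximalOp b)) :
    z ∈ spectrum (maximalOp b) :=
  fun h' => h.2.2 h'.1.2.range_eq

theorem mem_spectrum_of_mem_pointSpectrum (h : z ∈ pointSpectrum (maximalOp b)) :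
    z ∈ spectrum (maximalOp b) :=
  fun h' => h h'.1.1

theorem notMem_continuousSpectrum_of_mem_pointSpectrum (h : z ∈ pointSpectrum (maximalOp b)) :
    z ∉ continuousSpectrum (maximalOp b) :=
  fun h' => h h'.1

theorem mem_pointSpectrum_of_not_finiteNullity (h : ¬ FiniteNullity (maximalOp b) z) :
    z ∈ pointSpectrum (maximalOp b) := by
  intro hinj
  refine h ?_
  rw [FiniteNullity, LinearMap.ker_eq_bot.2 hinj]
  infer_instance

/-- If no point is semi-Fredholm and the spectrum is everything, all essential spectra are the whole
plane. -/
theorem essSpectra_eq_spectrum (hs : spectrum (maximalOp b) = Set.univ)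
    (h1 : essSpectrum1 (maximalOp b) = Set.univ) :
    essSpectrum1 (maximalOp b) = spectrum (maximalOp b) ∧
    essSpectrum2 (maximalOp b) = spectrum (maximalOp b) ∧
    essSpectrum3 (maximalOp b) = spectrum (maximalOp b) ∧
    essSpectrum4 (maximalOp b) = spectrum (maximalOp b) ∧
    essSpectrum5 (maximalOp b) = spectrum (maximalOp b) := by
  have h : ∀ z, ¬ IsSemiFredholm (maximalOp b) z := fun z => by
    have : z ∈ essSpectrum1 (maximalOp b) := h1 ▸ Set.mem_univ z
    exact this
  have h' : ∀ z, z ∈ spectrum (maximalOp b) := fun z => hs ▸ Set.mem_univ z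
  rw [h1, hs]
  refine ⟨rfl, Set.eq_univ_of_forall fun z hz => h z ⟨hz.1, Or.inl hz.2⟩,
    Set.eq_univ_of_forall fun z hz => h z ⟨hz.1, Or.inl hz.2.1⟩,
    Set.eq_univ_of_forall fun z hz => h z ⟨hz.1.1, Or.inl hz.1.2.1⟩,
    Set.eq_univ_of_forall fun z => ⟨h' z, fun hz => ?_⟩⟩
  -- An isolated eigenvalue would need a nearby point outside the spectrum, which is everything.
  obtain ⟨w, hw⟩ := hz.1.2.exists
  exact hw (h' w)

theorem isRegularPoint_of_re_eq_zero (hb : b.re = 0) (hb0 : b ≠ 0) (z : ℂ) :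
    IsRegularPoint b z where
  eq_zero _ h := eq_zero_of_isWeakAction_of_re_eq_zero hb hb0 h
  eq_zero_conj _ h := eq_zero_of_isWeakAction_of_re_eq_zero (by simpa using hb) (by simpa using hb0) h
  exists_pseudomode ε hε := by
    -- When `Re b = 0` both `a = b` and `a = -b` are admissible; the sign is chosen so that `Re (z /
    -- a) ≥ 0`.
    rcases le_total 0 (z / b).re with h | h
    · exact exists_pseudomode_of_re_eq_zero (σ := 1) (a := b) (by norm_num) (by simp) hb0 hb h hε
    · refine exists_pseudomode_of_re_eq_zero (σ := -1) (a := -b) (by norm_num) (by simp)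
        (by simpa using hb0) (by simpa using hb) ?_ hε
      rw [div_neg, Complex.neg_re]
      linarith

theorem isRegularPoint_of_re {σ : ℝ} {a : ℂ} (hσ : σ ^ 2 = 1) (h1 : 0 < a.re) (h2 : a.im ≠ 0)
    (hb : b = σ * a) (hz : ∀ k : ℕ, z ≠ (2 * k + 1) * a) : IsRegularPoint b z where
  eq_zero _ h := eq_zero_of_isWeakAction_of_re hσ h1 h2 hb hz h
  eq_zero_conj _ h := by
    refine eq_zero_of_isWeakAction_of_re (a := conj a) hσ (by simpa using h1) (by simpa using h2)
      (by simp [hb]) (fun k hk => hz k ?_) h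
    have := congrArg conj hk
    simpa [Complex.conj_ofNat] using this
  exists_pseudomode _ hε := exists_pseudomode_of_re hσ h1 h2 hb z hε

/-- Here `σ` is the sign of `Re b`, which treats both definitions of the Landau levels at once. -/
theorem exists_landau_form (h1 : b.re ≠ 0) (h2 : b.im ≠ 0) :
    ∃ (σ : ℝ) (a : ℂ), σ ^ 2 = 1 ∧ 0 < a.re ∧ a.im ≠ 0 ∧ b = σ * a ∧
      landauLevels b = {z | ∃ k : ℕ, z = (2 * k + 1) * a} := by
  rcases lt_or_gt_of_ne h1 with h | h
  · refine ⟨-1, -b, by norm_num, by simpa using h, by simpa using h2, by simp, ?_⟩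
    ext z
    simp [landauLevels, h, h.not_gt]
  · refine ⟨1, b, by norm_num, h, h2, by simp, ?_⟩
    ext z
    simp [landauLevels, h, h.not_gt]

theorem not_isSemiFredholm_of_mem_landauLevels (h1 : b.re ≠ 0) (h2 : b.im ≠ 0)
    (hz : z ∈ landauLevels b) :
    z ∈ pointSpectrum (maximalOp b) ∧ z ∈ essSpectrum1 (maximalOp b) := by
  obtain ⟨σ, a, hσ, ha1, ha2, hb, hl⟩ := exists_landau_form h1 h2
  rw [hl] at hz
  obtain ⟨k, rfl⟩ := hz
  have hn := not_finiteNullity_of_re hσ ha1 ha2 hb k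
  exact ⟨mem_pointSpectrum_of_not_finiteNullity hn, fun h =>
    h.2.elim hn (not_finiteDeficiency_of_re hσ ha1 ha2 hb k)⟩

theorem isRegularPoint_of_notMem_landauLevels (h1 : b.re ≠ 0) (h2 : b.im ≠ 0)
    (hz : z ∉ landauLevels b) : IsRegularPoint b z := by
  obtain ⟨σ, a, hσ, ha1, ha2, hb, hl⟩ := exists_landau_form h1 h2
  rw [hl] at hz
  exact isRegularPoint_of_re hσ ha1 ha2 hb fun k hk => hz ⟨k, hk⟩

theorem spectra_of_re_ne_zero (h1 : b.re ≠ 0) (h2 : b.im ≠ 0) :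
    spectrum (maximalOp b) = Set.univ ∧
    continuousSpectrum (maximalOp b) = (landauLevels b)ᶜ ∧
    pointSpectrum (maximalOp b) = landauLevels b ∧
    essSpectrum1 (maximalOp b) = Set.univ := by
  have hl := fun z => not_isSemiFredholm_of_mem_landauLevels (z := z) h1 h2
  have hr := fun z => isRegularPoint_of_notMem_landauLevels (z := z) h1 h2
  refine ⟨Set.eq_univ_of_forall fun z => ?_, ?_, ?_, Set.eq_univ_of_forall fun z => ?_⟩
  · by_cases hz : z ∈ landauLevels b
    · exact mem_spectrum_of_mem_pointSpectrum (hl z hz).1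
    · exact mem_spectrum_of_mem_continuousSpectrum (hr z hz).mem_continuousSpectrum
  · ext z
    exact ⟨fun h hz => notMem_continuousSpectrum_of_mem_pointSpectrum (hl z hz).1 h,
      fun h => (hr z h).mem_continuousSpectrum⟩
  · ext z
    exact ⟨fun h => by_contra fun hz => (hr z hz).notMem_pointSpectrum h, fun h => (hl z h).1⟩
  · by_cases hz : z ∈ landauLevels b
    · exact (hl z hz).2
    · exact mem_essSpectrum1_of_mem_continuousSpectrum (hr z hz).mem_continuousSpectrum

theorem spectra_of_re_eq_zero (hb : b.re = 0) (hb0 : b ≠ 0) :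
    spectrum (maximalOp b) = Set.univ ∧
    continuousSpectrum (maximalOp b) = Set.univ ∧
    pointSpectrum (maximalOp b) = ∅ ∧
    essSpectrum1 (maximalOp b) = Set.univ := by
  have hr := isRegularPoint_of_re_eq_zero hb hb0
  exact ⟨Set.eq_univ_of_forall fun z =>
      mem_spectrum_of_mem_continuousSpectrum (hr z).mem_continuousSpectrum,
    Set.eq_univ_of_forall fun z => (hr z).mem_continuousSpectrum,
    Set.eq_empty_of_forall_notMem fun z => (hr z).notMem_pointSpectrum,
    Set.eq_univ_of_forall fun z =>
      mem_essSpectrum1_of_mem_continuousSpectrum (hr z).mem_continuousSpectrum⟩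

end Conclusion

end MagneticLaplacian

end

theorem theorem1p2 (b : ℂ) :
    (b.re ≠ 0 → b.im ≠ 0 →
      UnboundedOp.spectrum (MagneticLaplacian.maximalOp b) = Set.univ ∧
      UnboundedOp.continuousSpectrum (MagneticLaplacian.maximalOp b) =
        (MagneticLaplacian.landauLevels b)ᶜ ∧
      UnboundedOp.pointSpectrum (MagneticLaplacian.maximalOp b) =
        MagneticLaplacian.landauLevels b) ∧
    (b.re = 0 → b ≠ 0 →
      UnboundedOp.spectrum (MagneticLaplacian.maximalOp b) = Set.univ ∧
      UnboundedOp.continuousSpectrum (MagneticLaplacian.maximalOp b) = Set.univ ∧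
      UnboundedOp.pointSpectrum (MagneticLaplacian.maximalOp b) = ∅) ∧
    ((b.re ≠ 0 ∧ b.im ≠ 0) ∨ (b.re = 0 ∧ b ≠ 0) →
      UnboundedOp.essSpectrum1 (MagneticLaplacian.maximalOp b) =
        UnboundedOp.spectrum (MagneticLaplacian.maximalOp b) ∧
      UnboundedOp.essSpectrum2 (MagneticLaplacian.maximalOp b) =
        UnboundedOp.spectrum (MagneticLaplacian.maximalOp b) ∧
      UnboundedOp.essSpectrum3 (MagneticLaplacian.maximalOp b) =
        UnboundedOp.spectrum (MagneticLaplacian.maximalOp b) ∧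
      UnboundedOp.essSpectrum4 (MagneticLaplacian.maximalOp b) =
        UnboundedOp.spectrum (MagneticLaplacian.maximalOp b) ∧
      UnboundedOp.essSpectrum5 (MagneticLaplacian.maximalOp b) =
        UnboundedOp.spectrum (MagneticLaplacian.maximalOp b)) := by
  refine ⟨fun h1 h2 => ?_, fun h1 h2 => ?_, ?_⟩
  · obtain ⟨hs, hc, hp, -⟩ := MagneticLaplacian.spectra_of_re_ne_zero h1 h2
    exact ⟨hs, hc, hp⟩
  · obtain ⟨hs, hc, hp, -⟩ := MagneticLaplacian.spectra_of_re_eq_zero h1 h2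
    exact ⟨hs, hc, hp⟩
  · rintro (⟨h1, h2⟩ | ⟨h1, h2⟩)
    · obtain ⟨hs, -, -, he⟩ := MagneticLaplacian.spectra_of_re_ne_zero h1 h2
      exact MagneticLaplacian.essSpectra_eq_spectrum hs he
    · obtain ⟨hs, -, -, he⟩ := MagneticLaplacian.spectra_of_re_eq_zero h1 h2
      exact MagneticLaplacian.essSpectra_eq_spectrum hs he
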